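/- Let $G$ be a (finite-dimensional, real) Lie group with Lie algebra $\mathfrak g$ and exponential map $\exp$, and let $H\subset G$ be a closed subgroup with Lie algebra $\mathfrak h$ and center $\mathfrak z(\mathfrak h)$ of $\mathfrak h$. Let $\pi:G\to G/H$ be the projection, $o=\pi(e)$, and for $p\in G$ let $\tau_p:G/H\to G/H$ be the left translation by $p$. Let $B$ be an $\operatorname{Ad}(G)$-invariant (positive definite) inner product on $\mathfrak g$, let $\mathfrak m$ be the $B$-orthogonal complement of $\mathfrak h$, so that $\mathfrak g=\mathfrak h\oplus\mathfrak m$ is a reductive decomposition, and identify $T_o(G/H)$ with $\mathfrak m$ by means of $d\pi_e$. Assume the following. (i) $\mathfrak m=\mathfrak m_1\oplus\cdots\oplus\mathfrak m_s$ is a $B$-orthogonal decomposition into $\operatorname{Ad}(H)$-invariant subspaces, and $G/H$ carries the $G$-invariant Riemannian metric $g$ which at $o$ is the inner product $\lambda_1B|_{\mathfrak m_1}+\cdots+\lambda_sB|_{\mathfrak m_s}$ on $\mathfrak m$, with $\lambda_1,\dots,\lambda_s>0$. Let $\nabla$ be the Levi-Civita connection of $g$. (ii) $a,b\in\{1,\dots,s\}$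 satisfy $[\mathfrak m_a,\mathfrak m_b]\subset\mathfrak m_a$. Put $\lambda=\lambda_b/\lambda_a$. (iii) $W\in\mathfrak z(\mathfrak h)$, and $I$ is a $G$-invariant $(1,1)$-tensor field on $G/H$ (that is, $I_{\tau_p(y)}\circ(d\tau_p)_y=(d\tau_p)_y\circ I_y$ for all $p\in G$, $y\in G/H$) such that $I_o=\operatorname{ad}(W)$ on $\mathfrak m_a$ and $I_o=\frac1\lambda\operatorname{ad}(W)$ on $\mathfrak m_b$. Let $k\in\mathbb R$, $X_a\in\mathfrak m_a$, $X_b\in\mathfrak m_b$. Then the motion of a charged particle under the electromagnetic field $kI$ with these initial data, i.e. the solution $x(t)$ of $$\nabla_{\dot x}\dot x=kI(\dot x),\qquad x(0)=o,\qquad \dot x(0)=X_a+X_b,$$ is defined for all $t\in\mathbb R$ and is given by $$x(t)=\exp t(X_a+\lambda X_b+kW)\,\exp t(1-\lambda)\Big(X_b+\frac k\lambda W\Big)\cdot o .$$ That is, this curve is a solution on $\mathbb R$, and every $C^2$ solution with the same initial conditions on an open interval containing $0$ coincides with it there. -/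

import Mathlib

open Set Bundle Manifold
open scoped Manifold ContDiff Topology

noncomputable section

/-! ### The exponential map and the adjoint representation of a Lie group -/

section LieGroup

variable {E : Type*} [NormedAddCommGroup E] [NormedSpace ℝ E]
  {G : Type*} [TopologicalSpace G] [ChartedSpace E G] [Group G]

/-- The field `mulInvariantVectorField X` is invariant under left translations. -/
theorem mulInvariantVectorField_mul_left [LieGroup 𝓘(ℝ, E) ∞ G]
    (X : GroupLieAlgebra 𝓘(ℝ, E) G) (p x : G) :
    mulInvariantVectorField X (p * x) =
      mfderiv 𝓘(ℝ, E) 𝓘(ℝ, E) (fun y : G => p * y) x (mulInvariantVectorField X x) := by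
  have hd : ∀ (q z : G), MDifferentiableAt 𝓘(ℝ, E) 𝓘(ℝ, E) (fun y : G => q * y) z := fun q z =>
    (contMDiff_mul_left (I := 𝓘(ℝ, E)) (n := ∞) (a := q)).contMDiffAt.mdifferentiableAt (by simp)
  have h2 : (fun y : G => p * x * y) = (fun y => p * y) ∘ (fun y => x * y) := by
    ext y; simp [mul_assoc]
  have h3 := mfderiv_comp_of_eq (x := (1 : G)) (y := x) (hd p x) (hd x 1) (by simp)
  unfold mulInvariantVectorField
  rw [h2, h3]
  have h4 : ∀ z : G, z = x → ∀ v : E, (mfderiv 𝓘(ℝ, E) 𝓘(ℝ, E) (fun y : G => p * y) z : E →L[ℝ] E) v =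
      (mfderiv 𝓘(ℝ, E) 𝓘(ℝ, E) (fun y : G => p * y) x : E →L[ℝ] E) v := by
    rintro z rfl v; rfl
  exact h4 (x * 1) (mul_one x) _

/-- The left translate of an integral curve of a left-invariant vector field is an integral curve
of the same field. -/
theorem IsMIntegralCurveOn.mul_left_invariant [LieGroup 𝓘(ℝ, E) ∞ G]
    {X : GroupLieAlgebra 𝓘(ℝ, E) G} {γ : ℝ → G} {s : Set ℝ}
    (h : IsMIntegralCurveOn γ (mulInvariantVectorField X) s) (p : G) :
    IsMIntegralCurveOn (fun t => p * γ t) (mulInvariantVectorField X) s := by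
  intro t ht
  have hd : ∀ (q z : G), MDifferentiableAt 𝓘(ℝ, E) 𝓘(ℝ, E) (fun y : G => q * y) z := fun q z =>
    (contMDiff_mul_left (I := 𝓘(ℝ, E)) (n := ∞) (a := q)).contMDiffAt.mdifferentiableAt (by simp)
  have h1 := (hd p (γ t)).hasMFDerivAt.comp_hasMFDerivWithinAt t (h t ht)
  have h2 : (mfderiv 𝓘(ℝ, E) 𝓘(ℝ, E) (fun y : G => p * y) (γ t)).comp
      ((1 : ℝ →L[ℝ] ℝ).smulRight (mulInvariantVectorField X (γ t))) =
      (1 : ℝ →L[ℝ] ℝ).smulRight (mulInvariantVectorField X (p * γ t)) := by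
    rw [mulInvariantVectorField_mul_left]
    refine ContinuousLinearMap.ext fun c => ?_
    exact map_smul (mfderiv 𝓘(ℝ, E) 𝓘(ℝ, E) (fun y : G => p * y) (γ t)) c _
  exact h2 ▸ h1

/-- Every element `X` of the Lie algebra generates a one-parameter subgroup: the left-invariant
vector field of `X` has an integral curve through the identity that is defined for all times. -/
theorem exists_oneParam [FiniteDimensional ℝ E] [T2Space G] [LieGroup 𝓘(ℝ, E) ∞ G]
    (X : GroupLieAlgebra 𝓘(ℝ, E) G) :
    ∃ γ : ℝ → G, γ 0 = 1 ∧ IsMIntegralCurve γ (mulInvariantVectorField X) := by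
  have : CompleteSpace E := FiniteDimensional.complete ℝ E
  have : LieGroup 𝓘(ℝ, E) (minSmoothness ℝ 3) G := by
    simp only [minSmoothness_of_isRCLikeNormedField]; infer_instance
  have hv : ContMDiff 𝓘(ℝ, E) (𝓘(ℝ, E).prod 𝓘(ℝ, E)) 1
      (fun x : G => (⟨x, mulInvariantVectorField X x⟩ : TangentBundle 𝓘(ℝ, E) G)) := by
    refine (contMDiff_mulInvariantVectorField X).of_le ?_
    simp only [minSmoothness_of_isRCLikeNormedField]
    norm_num
  obtain ⟨γ, h0, hγ⟩ := exists_isMIntegralCurveAt_of_contMDiffAt_boundaryless (t₀ := (0 : ℝ))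
    (hv.contMDiffAt (x := (1 : G)))
  rw [isMIntegralCurveAt_iff'] at hγ
  obtain ⟨ε, hε, hγ⟩ := hγ
  refine exists_isMIntegralCurve_of_isMIntegralCurveOn hv hε (fun x => ?_) 1
  refine ⟨fun t => x * γ t, by simp [h0], ?_⟩
  have := hγ.mul_left_invariant x
  rwa [Real.ball_eq_Ioo, zero_sub, zero_add] at this

variable [FiniteDimensional ℝ E] [T2Space G] [LieGroup 𝓘(ℝ, E) ∞ G]

/-- The exponential map `exp : 𝔤 → G`: the value at time `1` of the integral curve through the
identity of the left-invariant vector field of `X`. -/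
def lieExp (X : GroupLieAlgebra 𝓘(ℝ, E) G) : G :=
  (exists_oneParam X).choose 1

/-- The Lie algebra `𝔥` of a closed subgroup `H`: all `X` with `exp(tX) ∈ H` for every `t`. -/
def subgroupLieAlgebra (H : Subgroup G) : Set (GroupLieAlgebra 𝓘(ℝ, E) G) :=
  {X | ∀ t : ℝ, lieExp (t • X) ∈ H}

/-- The center `𝔷(𝔥)` of the Lie algebra of `H`. -/
def subgroupLieAlgebraCenter (H : Subgroup G) : Set (GroupLieAlgebra 𝓘(ℝ, E) G) :=
  {W | W ∈ subgroupLieAlgebra H ∧ ∀ V ∈ (subgroupLieAlgebra H : Set (GroupLieAlgebra 𝓘(ℝ, E) G)), ⁅W, V⁆ = 0}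

/-- The adjoint representation: `Ad p` is the differential at the identity of `y ↦ p y p⁻¹`
(the tangent spaces at `1` and at `p 1 p⁻¹ = 1` are the same space). -/
def lieAd (p : G) : GroupLieAlgebra 𝓘(ℝ, E) G →L[ℝ] GroupLieAlgebra 𝓘(ℝ, E) G :=
  mfderiv 𝓘(ℝ, E) 𝓘(ℝ, E) (fun y : G => p * y * p⁻¹) 1

end LieGroup

/-! ### Connections and motions of charged particles -/

section Motion

variable {F : Type*} [NormedAddCommGroup F] [NormedSpace ℝ F]
  {M : Type*} [TopologicalSpace M] [ChartedSpace F M]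

/-- The velocity `ẋ(t)` of a curve in a manifold. -/
def velocity (x : ℝ → M) (t : ℝ) : TangentSpace 𝓘(ℝ, F) (x t) :=
  mfderiv 𝓘(ℝ, ℝ) 𝓘(ℝ, F) x t (1 : ℝ)

variable [IsManifold 𝓘(ℝ, F) ∞ M]

/-- A smooth Riemannian metric on `M`. -/
abbrev SmoothMetric (F : Type*) [NormedAddCommGroup F] [NormedSpace ℝ F]
    (M : Type*) [TopologicalSpace M] [ChartedSpace F M] [IsManifold 𝓘(ℝ, F) ∞ M] :=
  ContMDiffRiemannianMetric 𝓘(ℝ, F) ∞ F (fun y : M => TangentSpace 𝓘(ℝ, F) y)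

/-- A connection on the tangent bundle of `M`. -/
abbrev Connection (F : Type*) [NormedAddCommGroup F] [NormedSpace ℝ F]
    (M : Type*) [TopologicalSpace M] [ChartedSpace F M] [IsManifold 𝓘(ℝ, F) ∞ M] :=
  CovariantDerivative 𝓘(ℝ, F) F (fun y : M => TangentSpace 𝓘(ℝ, F) y)

/-- `nabla` is the Levi-Civita connection of `g`: it is torsion-free and compatible with `g`, i.e.
`u g(Y, Z) = g(∇_u Y, Z) + g(Y, ∇_u Z)` for every tangent vector `u` and all vector fields `Y`, `Z`
that are differentiable at its base point (`nabla Y p u` is `∇_u Y`). -/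
def IsLeviCivita [FiniteDimensional ℝ F] (g : SmoothMetric F M) (nabla : Connection F M) : Prop :=
  nabla.torsion = 0 ∧
  ∀ (p : M) (u : TangentSpace 𝓘(ℝ, F) p) (Y Z : ∀ y : M, TangentSpace 𝓘(ℝ, F) y),
    MDifferentiableAt 𝓘(ℝ, F) (𝓘(ℝ, F).prod 𝓘(ℝ, F))
      (fun y => (⟨y, Y y⟩ : TangentBundle 𝓘(ℝ, F) M)) p →
    MDifferentiableAt 𝓘(ℝ, F) (𝓘(ℝ, F).prod 𝓘(ℝ, F))
      (fun y => (⟨y, Z y⟩ : TangentBundle 𝓘(ℝ, F) M)) p →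
    mvfderiv 𝓘(ℝ, F) (fun y => g.inner y (Y y) (Z y)) p u =
      g.inner p (nabla Y p u) (Z p) + g.inner p (Y p) (nabla Z p u)

/-- The covariant derivative `D V / dt` at time `t` of a vector field `V` along the curve `x`.
With `E j` the coordinate frame at `x t` and `V s = ∑ j, v j s • E j (x s)` near `t`, this is
`∑ j, v j' t • E j + ∑ j, v j t • ∇_{ẋ(t)} (E j)`: the first summand is the derivative of the
components of `V`, read in the trivialization `e` of the tangent bundle given by the chart at `x t`,
and the field to which `nabla` is applied in the second one is `∑ j, v j t • E j`, the vector field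
near `x t` whose components are constant, equal to those of `V t`. -/
def covDerivAlong (nabla : Connection F M) (x : ℝ → M)
    (V : ∀ t, TangentSpace 𝓘(ℝ, F) (x t)) (t : ℝ) : TangentSpace 𝓘(ℝ, F) (x t) :=
  let e := trivializationAt F (fun y : M => TangentSpace 𝓘(ℝ, F) y) (x t)
  e.symm (x t) (deriv (fun s => (e ⟨x s, V s⟩).2) t)
    + nabla (fun y => e.symm y (e ⟨x t, V t⟩).2) (x t) (velocity x t)

/-- On the open set of times `J`, the curve `x` is a motion of a charged particle under the
electromagnetic field `k A`, i.e. a (twice continuously differentiable) solution of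
`∇_ẋ ẋ = k A(ẋ)`. -/
def IsChargedMotionOn (nabla : Connection F M)
    (A : ∀ y : M, TangentSpace 𝓘(ℝ, F) y →L[ℝ] TangentSpace 𝓘(ℝ, F) y) (k : ℝ)
    (J : Set ℝ) (x : ℝ → M) : Prop :=
  ContMDiffOn 𝓘(ℝ, ℝ) 𝓘(ℝ, F) 2 x J ∧
    ∀ t ∈ J, covDerivAlong nabla x (velocity x) t = k • A (x t) (velocity x t)

/-- The metric `g` is invariant under the action of `G` on `M`. -/
def IsInvariantMetric (G : Type*) [SMul G M] (g : SmoothMetric F M) : Prop :=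
  ∀ (p : G) (y : M) (u v : TangentSpace 𝓘(ℝ, F) y),
    g.inner (p • y) (mfderiv 𝓘(ℝ, F) 𝓘(ℝ, F) (fun z : M => p • z) y u)
      (mfderiv 𝓘(ℝ, F) 𝓘(ℝ, F) (fun z : M => p • z) y v) = g.inner y u v

/-- The `(1,1)`-tensor field `A` is invariant under the action of `G` on `M`. -/
def IsInvariantTensor (G : Type*) [SMul G M]
    (A : ∀ y : M, TangentSpace 𝓘(ℝ, F) y →L[ℝ] TangentSpace 𝓘(ℝ, F) y) : Prop :=
  ∀ (p : G) (y : M) (u : TangentSpace 𝓘(ℝ, F) y),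
    A (p • y) (mfderiv 𝓘(ℝ, F) 𝓘(ℝ, F) (fun z : M => p • z) y u) =
      mfderiv 𝓘(ℝ, F) 𝓘(ℝ, F) (fun z : M => p • z) y (A y u)

end Motion

/-! ### Homogeneous spaces -/

section Homogeneous

/-- The differential at the identity of the projection `π : G → G/H`. -/
def projDeriv (E F : Type*) [NormedAddCommGroup E] [NormedSpace ℝ E]
    [NormedAddCommGroup F] [NormedSpace ℝ F]
    {G : Type*} [TopologicalSpace G] [ChartedSpace E G] [Group G]
    (H : Subgroup G) [ChartedSpace F (G ⧸ H)] :
    GroupLieAlgebra 𝓘(ℝ, E) G →L[ℝ] TangentSpace 𝓘(ℝ, F) ((1 : G) : G ⧸ H) :=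
  mfderiv 𝓘(ℝ, E) 𝓘(ℝ, F) (fun p : G => (p : G ⧸ H)) 1

end Homogeneous

end

/-!
The motion is found through its momentum. A fundamental vector field `K_Z` of the action of `G` on
`G/H` is a Killing field of the invariant metric, so Noether's theorem `hasDerivAt_momentum` says
that `d/dt g(ẋ, K_Z) = g(∇_ẋ ẋ, K_Z)` along every curve `x`. The fields `K_Z` span all tangent
spaces, since `π` is a submersion. Hence `∇_ẋ ẋ = k I(ẋ)` holds if and only if every momentum
`g(ẋ, K_Z)` has the derivative `k g(I(ẋ), K_Z)`.

*Existence.* Put `N = X_b + (k/c) W`, `U = X_a + c N` and `p(t) = exp(tU) exp(t(1-c)N)`. The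
logarithmic derivative of `p` is `X_a(t) + N`, where `X_a(t) = Ad(exp(-t(1-c)N)) X_a` stays in `𝔪_a`
because `ad N` preserves `𝔪_a`; moreover `Ad(p(t)) (X_a(t) + c N) = U` for all `t`
(`Adj_motionLift`). As `dπ W = 0`, the metric at `o` is `λ_a B` on `𝔪_a` and `c λ_a B` on `𝔪_b`, and
`B` is `Ad`-invariant, the momentum of `p(t) o` is `λ_a B(U - k Ad(p(t)) W, Z)`. Its derivative is
`k λ_a B(Ad(p(t)) [W, X_a(t) + X_b], Z)`, which is the momentum of the force
(`isChargedMotionOn_motionLift`). That `λ_i B` computes `g(dπ X, dπ Z)` for `X` in `𝔪_i` and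
*every* `Z` uses that the kernel of `dπ` is `𝔥` (`mem_subgroupLieAlgebra_iff`, `form_apply_of_mem`).

*Uniqueness.* Velocity is recovered from momentum by a linear map that depends smoothly on the
position, through a local section of `π`. So position and momentum together satisfy a first-order
equation with smooth right hand side (`eventually_hasDerivAt_position_momentum`), to which the
uniqueness theorem for differential equations applies; a connectedness argument makes the result
global on the interval (`eqOn_of_charged`). No regularity of the connection is needed: all that is
used of it is the Koszul formula `metricForm_christoffel_self`.

All tangent spaces of a manifold are copies of its model space. Differentials, metrics and tensor
fields are therefore treated as maps between the model spaces `E` (of `G`) and `F` (of `G/H`); the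
definitions `mderiv`, `metricForm`, `tensorForm`, `vel`, `Adj`, `adj`, `lieBr` and `gexp` are these
versions of the objects in the statement.
-/

noncomputable section

/-! ### Differentials and velocities in the model spaces -/

section Calculus

variable (E₁ E₂ E₃ : Type*) [NormedAddCommGroup E₁] [NormedSpace ℝ E₁]
  [NormedAddCommGroup E₂] [NormedSpace ℝ E₂] [NormedAddCommGroup E₃] [NormedSpace ℝ E₃]
  {M₁ M₂ M₃ : Type*} [TopologicalSpace M₁] [ChartedSpace E₁ M₁]
  [TopologicalSpace M₂] [ChartedSpace E₂ M₂] [TopologicalSpace M₃] [ChartedSpace E₃ M₃]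

/-- The differential of a map between manifolds, as a linear map between the model spaces (all
tangent spaces of a manifold are copies of its model space). -/
def mderiv (f : M₁ → M₂) (x : M₁) : E₁ →L[ℝ] E₂ := mfderiv 𝓘(ℝ, E₁) 𝓘(ℝ, E₂) f x

/-- `f` is differentiable at `x`, with differential `f'`. -/
def HasMDerivAt (f : M₁ → M₂) (f' : E₁ →L[ℝ] E₂) (x : M₁) : Prop :=
  HasMFDerivAt 𝓘(ℝ, E₁) 𝓘(ℝ, E₂) f x f'

variable {E₁ E₂ E₃}

theorem mderiv_comp {g : M₂ → M₃} {f : M₁ → M₂} {x : M₁} {y : M₂}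
    (hg : MDifferentiableAt 𝓘(ℝ, E₂) 𝓘(ℝ, E₃) g y)
    (hf : MDifferentiableAt 𝓘(ℝ, E₁) 𝓘(ℝ, E₂) f x) (hy : f x = y) :
    mderiv E₁ E₃ (fun z => g (f z)) x = (mderiv E₂ E₃ g y).comp (mderiv E₁ E₂ f x) := by
  subst hy
  exact mfderiv_comp x hg hf

theorem mderiv_congr {f g : M₁ → M₂} {x : M₁} (h : f =ᶠ[𝓝 x] g) :
    mderiv E₁ E₂ f x = mderiv E₁ E₂ g x := by
  have h1 := h.mfderiv_eq (I := 𝓘(ℝ, E₁)) (I' := 𝓘(ℝ, E₂))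
  exact h1

theorem mderiv_id (x : M₁) : mderiv E₁ E₁ (fun z : M₁ => z) x = ContinuousLinearMap.id ℝ E₁ :=
  mfderiv_id

theorem mderiv_const (c : M₂) (x : M₁) : mderiv E₁ E₂ (fun _ : M₁ => c) x = 0 :=
  mfderiv_const

theorem mderiv_eq_fderiv (f : E₁ → E₂) (x : E₁) : mderiv E₁ E₂ f x = fderiv ℝ f x :=
  mfderiv_eq_fderiv

theorem mderiv_chart_self [IsManifold 𝓘(ℝ, E₁) 1 M₁] (x : M₁) :
    mderiv E₁ E₁ (extChartAt 𝓘(ℝ, E₁) x) x = ContinuousLinearMap.id ℝ E₁ :=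
  mfderiv_extChartAt_self

variable (E₁)

/-- The curve `x` is differentiable at time `t`, with velocity `v`. -/
def HasVelocityAt (x : ℝ → M₁) (v : E₁) (t : ℝ) : Prop :=
  HasMDerivAt ℝ E₁ x ((1 : ℝ →L[ℝ] ℝ).smulRight v) t

variable {E₁}

theorem HasVelocityAt.continuousAt {x : ℝ → M₁} {v : E₁} {t : ℝ}
    (h : HasVelocityAt E₁ x v t) : ContinuousAt x t :=
  HasMFDerivAt.continuousAt h

theorem HasVelocityAt.velocity_eq {x : ℝ → M₁} {v : E₁} {t : ℝ}
    (h : HasVelocityAt E₁ x v t) : (velocity x t : E₁) = v := by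
  have h1 : mderiv ℝ E₁ x t = (1 : ℝ →L[ℝ] ℝ).smulRight v := HasMFDerivAt.mfderiv h
  change mderiv ℝ E₁ x t 1 = v
  rw [h1]; simp

theorem MDifferentiableAt.hasVelocityAt {x : ℝ → M₁} {t : ℝ}
    (h : MDifferentiableAt 𝓘(ℝ, ℝ) 𝓘(ℝ, E₁) x t) : HasVelocityAt E₁ x (velocity x t) t := by
  have h1 : mderiv ℝ E₁ x t = (1 : ℝ →L[ℝ] ℝ).smulRight (mderiv ℝ E₁ x t 1) := by
    ext; simp
  have h2 : HasMFDerivAt 𝓘(ℝ, ℝ) 𝓘(ℝ, E₁) x t (mderiv ℝ E₁ x t) := h.hasMFDerivAt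
  rw [h1] at h2
  exact h2

theorem HasVelocityAt.comp {f : M₁ → M₂} {x : ℝ → M₁} {v : E₁} {t : ℝ} {y : M₁}
    (h : HasVelocityAt E₁ x v t) (hf : MDifferentiableAt 𝓘(ℝ, E₁) 𝓘(ℝ, E₂) f y) (hy : x t = y) :
    HasVelocityAt E₂ (fun s => f (x s)) (mderiv E₁ E₂ f y v) t := by
  subst hy
  have h1 : HasMDerivAt ℝ E₂ (fun s => f (x s))
    ((mderiv E₁ E₂ f (x t)).comp ((1 : ℝ →L[ℝ] ℝ).smulRight v)) t :=
    hf.hasMFDerivAt.comp t h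
  have h2 : (mderiv E₁ E₂ f (x t)).comp ((1 : ℝ →L[ℝ] ℝ).smulRight v) =
    (1 : ℝ →L[ℝ] ℝ).smulRight (mderiv E₁ E₂ f (x t) v) := by ext; simp
  unfold HasVelocityAt
  rw [← h2]
  exact h1

theorem hasVelocityAt_iff_hasDerivAt {x : ℝ → E₁} {v : E₁} {t : ℝ} :
    HasVelocityAt E₁ x v t ↔ HasDerivAt x v t := by
  unfold HasVelocityAt
  rw [hasDerivAt_iff_hasFDerivAt]
  exact hasMFDerivAt_iff_hasFDerivAt

theorem HasVelocityAt.congr {x y : ℝ → M₁} {v : E₁} {t : ℝ} (h : HasVelocityAt E₁ x v t)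
    (hxy : y =ᶠ[𝓝 t] x) : HasVelocityAt E₁ y v t :=
  HasMFDerivAt.congr_of_eventuallyEq (f := x) h hxy

/-- The chain rule along a curve for a map of two variables. -/
theorem HasVelocityAt.comp₂ {f : M₁ × M₂ → M₃} {x : ℝ → M₁} {y : ℝ → M₂} {v : E₁} {w : E₂} {t : ℝ}
    {a : M₁} {b : M₂}
    (hx : HasVelocityAt E₁ x v t) (hy : HasVelocityAt E₂ y w t) (ha : x t = a) (hb : y t = b)
    (hf : MDifferentiableAt (𝓘(ℝ, E₁).prod 𝓘(ℝ, E₂)) 𝓘(ℝ, E₃) f (a, b)) :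
    HasVelocityAt E₃ (fun s => f (x s, y s))
      (mderiv E₁ E₃ (fun z => f (z, b)) a v + mderiv E₂ E₃ (fun z => f (a, z)) b w) t := by
  subst ha hb
  have hxy : HasMFDerivAt 𝓘(ℝ, ℝ) (𝓘(ℝ, E₁).prod 𝓘(ℝ, E₂)) (fun s => (x s, y s)) t
      (((1 : ℝ →L[ℝ] ℝ).smulRight v).prod ((1 : ℝ →L[ℝ] ℝ).smulRight w)) :=
    HasMFDerivAt.prodMk hx hy
  have h1 : HasMDerivAt ℝ E₃ (fun s => f (x s, y s))
      (((mderiv E₁ E₃ (fun z => f (z, y t)) (x t)).comp (ContinuousLinearMap.fst ℝ E₁ E₂) +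
        (mderiv E₂ E₃ (fun z => f (x t, z)) (y t)).comp (ContinuousLinearMap.snd ℝ E₁ E₂)).comp
      (((1 : ℝ →L[ℝ] ℝ).smulRight v).prod ((1 : ℝ →L[ℝ] ℝ).smulRight w))) t := by
    have h3 := hf.hasMFDerivAt
    rw [mfderiv_prod_eq_add_comp hf] at h3
    exact h3.comp t hxy
  have h2 : (((mderiv E₁ E₃ (fun z => f (z, y t)) (x t)).comp (ContinuousLinearMap.fst ℝ E₁ E₂) +
        (mderiv E₂ E₃ (fun z => f (x t, z)) (y t)).comp (ContinuousLinearMap.snd ℝ E₁ E₂)).comp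
      (((1 : ℝ →L[ℝ] ℝ).smulRight v).prod ((1 : ℝ →L[ℝ] ℝ).smulRight w))) =
      (1 : ℝ →L[ℝ] ℝ).smulRight (mderiv E₁ E₃ (fun z => f (z, y t)) (x t) v +
        mderiv E₂ E₃ (fun z => f (x t, z)) (y t) w) := by
    ext; simp
  unfold HasVelocityAt
  rw [← h2]
  exact h1

end Calculus

/-! ### Charts -/

section Charts

variable {E : Type*} [NormedAddCommGroup E] [NormedSpace ℝ E]
  {M : Type*} [TopologicalSpace M] [ChartedSpace E M] [IsManifold 𝓘(ℝ, E) ∞ M]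

theorem contMDiffAt_extChartAt_of_mem {x y : M} (hy : y ∈ (extChartAt 𝓘(ℝ, E) x).source) :
    ContMDiffAt 𝓘(ℝ, E) 𝓘(ℝ, E) ∞ (extChartAt 𝓘(ℝ, E) x) y :=
  contMDiffAt_extChartAt' (by simpa using hy)

theorem contMDiffAt_extChartAt_symm_of_mem {x : M} {a : E}
    (ha : a ∈ (extChartAt 𝓘(ℝ, E) x).target) :
    ContMDiffAt 𝓘(ℝ, E) 𝓘(ℝ, E) ∞ (extChartAt 𝓘(ℝ, E) x).symm a :=
  (contMDiffOn_extChartAt_symm x).contMDiffAt (extChartAt_target_mem_nhds' ha)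

omit [IsManifold 𝓘(ℝ, E) ∞ M] in
theorem eventually_mem_target (x : M) :
    ∀ᶠ a in 𝓝 (extChartAt 𝓘(ℝ, E) x x), a ∈ (extChartAt 𝓘(ℝ, E) x).target :=
  extChartAt_target_mem_nhds x

omit [IsManifold 𝓘(ℝ, E) ∞ M] in
theorem eventually_mem_source (x : M) :
    ∀ᶠ y in 𝓝 x, y ∈ (extChartAt 𝓘(ℝ, E) x).source :=
  extChartAt_source_mem_nhds x

theorem mderiv_extChartAt_comp_symm {x : M} {a : E} (ha : a ∈ (extChartAt 𝓘(ℝ, E) x).target) :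
    (mderiv E E (extChartAt 𝓘(ℝ, E) x) ((extChartAt 𝓘(ℝ, E) x).symm a)).comp
      (mderiv E E (extChartAt 𝓘(ℝ, E) x).symm a) = ContinuousLinearMap.id ℝ E := by
  have h1 := (contMDiffAt_extChartAt_symm_of_mem ha).mdifferentiableAt (by simp)
  have h2 := (contMDiffAt_extChartAt_of_mem
    ((extChartAt 𝓘(ℝ, E) x).map_target ha)).mdifferentiableAt (by simp)
  rw [← mderiv_comp h2 h1 rfl, ← mderiv_id (M₁ := E)]
  refine mderiv_congr ?_
  filter_upwards [extChartAt_target_mem_nhds' ha] with z hz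
  exact (extChartAt 𝓘(ℝ, E) x).right_inv hz

theorem mderiv_symm_comp_extChartAt {x y : M} (hy : y ∈ (extChartAt 𝓘(ℝ, E) x).source) :
    (mderiv E E (extChartAt 𝓘(ℝ, E) x).symm (extChartAt 𝓘(ℝ, E) x y)).comp
      (mderiv E E (extChartAt 𝓘(ℝ, E) x) y) = ContinuousLinearMap.id ℝ E := by
  have h1 := (contMDiffAt_extChartAt_symm_of_mem
    ((extChartAt 𝓘(ℝ, E) x).map_source hy)).mdifferentiableAt (by simp)
  have h2 := (contMDiffAt_extChartAt_of_mem hy).mdifferentiableAt (by simp)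
  rw [← mderiv_comp h1 h2 rfl, ← mderiv_id (M₁ := M)]
  refine mderiv_congr ?_
  filter_upwards [(isOpen_extChartAt_source x).mem_nhds hy] with z hz
  exact (extChartAt 𝓘(ℝ, E) x).left_inv hz

theorem mderiv_extChartAt_symm_self (x : M) :
    mderiv E E (extChartAt 𝓘(ℝ, E) x).symm (extChartAt 𝓘(ℝ, E) x x) =
      ContinuousLinearMap.id ℝ E := by
  have : IsManifold 𝓘(ℝ, E) 1 M := .of_le (n := ∞) (by simp)
  have h := mderiv_symm_comp_extChartAt (mem_extChartAt_source (I := 𝓘(ℝ, E)) x)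
  rwa [mderiv_chart_self, ContinuousLinearMap.comp_id] at h

end Charts

/-! ### The adjoint representation and the Lie bracket -/

section Adjoint

variable {E : Type*} [NormedAddCommGroup E] [NormedSpace ℝ E]
  {G : Type*} [TopologicalSpace G] [ChartedSpace E G] [Group G] [LieGroup 𝓘(ℝ, E) ∞ G]

theorem mdifferentiableAt_mul_left' (p z : G) :
    MDifferentiableAt 𝓘(ℝ, E) 𝓘(ℝ, E) (fun y : G => p * y) z :=
  (contMDiff_mul_left (I := 𝓘(ℝ, E)) (n := ∞) (a := p)).contMDiffAt.mdifferentiableAt (by simp)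

theorem mdifferentiableAt_mul_right' (p z : G) :
    MDifferentiableAt 𝓘(ℝ, E) 𝓘(ℝ, E) (fun y : G => y * p) z :=
  (contMDiff_mul_right (I := 𝓘(ℝ, E)) (n := ∞) (a := p)).contMDiffAt.mdifferentiableAt (by simp)

theorem mdifferentiableAt_conj (p z : G) :
    MDifferentiableAt 𝓘(ℝ, E) 𝓘(ℝ, E) (fun y : G => p * y * p⁻¹) z :=
  (mdifferentiableAt_mul_right' p⁻¹ (p * z)).comp z (mdifferentiableAt_mul_left' p z)

variable (E) in
/-- The adjoint representation, as a family of endomorphisms of the model space. -/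
def Adj (p : G) : E →L[ℝ] E := mderiv E E (fun y : G => p * y * p⁻¹) 1

theorem Adj_mul (p q : G) : Adj E (p * q) = (Adj E p).comp (Adj E q) := by
  unfold Adj
  rw [← mderiv_comp (mdifferentiableAt_conj p 1) (mdifferentiableAt_conj q 1) (by simp)]
  congr 1
  ext y; group

omit [LieGroup 𝓘(ℝ, E) ∞ G] in
theorem Adj_one : Adj E (1 : G) = ContinuousLinearMap.id ℝ E := by
  unfold Adj
  rw [← mderiv_id (1 : G)]
  congr 1
  ext y; simp

theorem Adj_inv_comp (p : G) : (Adj E p⁻¹).comp (Adj E p) = ContinuousLinearMap.id ℝ E := by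
  rw [← Adj_mul, inv_mul_cancel, Adj_one]

theorem Adj_comp_inv (p : G) : (Adj E p).comp (Adj E p⁻¹) = ContinuousLinearMap.id ℝ E := by
  rw [← Adj_mul, mul_inv_cancel, Adj_one]

theorem Adj_inv_apply (p : G) (v : E) : Adj E p⁻¹ (Adj E p v) = v :=
  congrArg (fun T : E →L[ℝ] E => T v) (Adj_inv_comp p)

theorem Adj_apply_inv (p : G) (v : E) : Adj E p (Adj E p⁻¹ v) = v :=
  congrArg (fun T : E →L[ℝ] E => T v) (Adj_comp_inv p)

/-- Left translation is right translation after `Ad`, infinitesimally. -/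
theorem mderiv_mul_left_eq (p : G) :
    mderiv E E (fun y : G => p * y) 1 = (mderiv E E (fun y : G => y * p) 1).comp (Adj E p) := by
  unfold Adj
  rw [← mderiv_comp (mdifferentiableAt_mul_right' p 1) (mdifferentiableAt_conj p 1) (by simp)]
  congr 1
  ext y; simp

variable (E G) in
/-- The multiplication of the group, read in the chart at the identity. -/
def chartMul (c : E × E) : E :=
  extChartAt 𝓘(ℝ, E) (1 : G)
    ((extChartAt 𝓘(ℝ, E) (1 : G)).symm c.1 * (extChartAt 𝓘(ℝ, E) (1 : G)).symm c.2)

theorem contDiffAt_chartMul :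
    ContDiffAt ℝ ∞ (chartMul E G)
      (extChartAt 𝓘(ℝ, E) (1 : G) 1, extChartAt 𝓘(ℝ, E) (1 : G) 1) := by
  rw [← contMDiffAt_iff_contDiffAt]
  have hs : ContMDiffAt 𝓘(ℝ, E) 𝓘(ℝ, E) ∞ (extChartAt 𝓘(ℝ, E) (1 : G)).symm
      (extChartAt 𝓘(ℝ, E) (1 : G) 1) := contMDiffAt_extChartAt_symm_of_mem (by simp)
  have hf : ContMDiffAt 𝓘(ℝ, E × E) 𝓘(ℝ, E) ∞
      (fun c : E × E => (extChartAt 𝓘(ℝ, E) (1 : G)).symm c.1)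
      (extChartAt 𝓘(ℝ, E) (1 : G) 1, extChartAt 𝓘(ℝ, E) (1 : G) 1) :=
    hs.comp (extChartAt 𝓘(ℝ, E) (1 : G) 1, extChartAt 𝓘(ℝ, E) (1 : G) 1)
      contDiff_fst.contMDiff.contMDiffAt
  have hg : ContMDiffAt 𝓘(ℝ, E × E) 𝓘(ℝ, E) ∞
      (fun c : E × E => (extChartAt 𝓘(ℝ, E) (1 : G)).symm c.2)
      (extChartAt 𝓘(ℝ, E) (1 : G) 1, extChartAt 𝓘(ℝ, E) (1 : G) 1) :=
    hs.comp (extChartAt 𝓘(ℝ, E) (1 : G) 1, extChartAt 𝓘(ℝ, E) (1 : G) 1)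
      contDiff_snd.contMDiff.contMDiffAt
  have hm := hf.mul hg
  refine ContMDiffAt.comp _ (contMDiffAt_extChartAt_of_mem ?_) hm
  simp

variable (E G) in
/-- In the chart at the identity, the value at `a` of the left-invariant vector field of `Y`, as a
linear function of `Y`. -/
def chartLeft (a : E) : E →L[ℝ] E :=
  (fderiv ℝ (chartMul E G) (a, extChartAt 𝓘(ℝ, E) (1 : G) 1)).comp (ContinuousLinearMap.inr ℝ E E)

variable (E G) in
/-- In the chart at the identity, the value at `a` of the right-invariant vector field of `Y`, as a
linear function of `Y`. -/
def chartRight (a : E) : E →L[ℝ] E :=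
  (fderiv ℝ (chartMul E G) (extChartAt 𝓘(ℝ, E) (1 : G) 1, a)).comp (ContinuousLinearMap.inl ℝ E E)

theorem contDiffAt_chartLeft :
    ContDiffAt ℝ ∞ (chartLeft E G) (extChartAt 𝓘(ℝ, E) (1 : G) 1) := by
  have h : ContDiffAt ℝ ∞ (fderiv ℝ (chartMul E G))
    (extChartAt 𝓘(ℝ, E) (1 : G) 1, extChartAt 𝓘(ℝ, E) (1 : G) 1) :=
    contDiffAt_chartMul.fderiv_right (m := ∞) (by simp)
  refine ContDiffAt.clm_comp ?_ contDiffAt_const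
  exact ContDiffAt.comp (f := fun a : E => (a, extChartAt 𝓘(ℝ, E) (1 : G) 1)) _ h (by fun_prop)

theorem contDiffAt_chartRight :
    ContDiffAt ℝ ∞ (chartRight E G) (extChartAt 𝓘(ℝ, E) (1 : G) 1) := by
  have h : ContDiffAt ℝ ∞ (fderiv ℝ (chartMul E G))
    (extChartAt 𝓘(ℝ, E) (1 : G) 1, extChartAt 𝓘(ℝ, E) (1 : G) 1) :=
    contDiffAt_chartMul.fderiv_right (m := ∞) (by simp)
  refine ContDiffAt.clm_comp ?_ contDiffAt_const
  exact ContDiffAt.comp (f := fun a : E => (extChartAt 𝓘(ℝ, E) (1 : G) 1, a)) _ h (by fun_prop)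

theorem eventually_differentiableAt_chartMul :
    ∀ᶠ c in 𝓝 (extChartAt 𝓘(ℝ, E) (1 : G) 1, extChartAt 𝓘(ℝ, E) (1 : G) 1),
      DifferentiableAt ℝ (chartMul E G) c := by
  have h : ContDiffAt ℝ 1 (chartMul E G)
    (extChartAt 𝓘(ℝ, E) (1 : G) 1, extChartAt 𝓘(ℝ, E) (1 : G) 1) :=
    contDiffAt_chartMul.of_le (by simp)
  filter_upwards [h.eventually (by simp)] with c hc
  exact hc.differentiableAt (by simp)

theorem mderiv_chart_mul_eq {f : E → E} {g : G → G}
    (hf : ∀ᶠ b in 𝓝 (extChartAt 𝓘(ℝ, E) (1 : G) 1), f b = extChartAt 𝓘(ℝ, E) (1 : G)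
      (g ((extChartAt 𝓘(ℝ, E) (1 : G)).symm b)))
    (hg : MDifferentiableAt 𝓘(ℝ, E) 𝓘(ℝ, E) g 1)
    (hg1 : g 1 ∈ (extChartAt 𝓘(ℝ, E) (1 : G)).source) :
    fderiv ℝ f (extChartAt 𝓘(ℝ, E) (1 : G) 1) =
      (mderiv E E (extChartAt 𝓘(ℝ, E) (1 : G)) (g 1)).comp (mderiv E E g 1) := by
  have h0 := (contMDiffAt_extChartAt_symm_of_mem (E := E) (x := (1 : G))
    (a := extChartAt 𝓘(ℝ, E) (1 : G) 1) (by simp)).mdifferentiableAt (by simp)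
  have hsymm : (extChartAt 𝓘(ℝ, E) (1 : G)).symm (extChartAt 𝓘(ℝ, E) (1 : G) 1) = 1 := by simp
  rw [← mderiv_eq_fderiv, mderiv_congr hf]
  have h2 := (contMDiffAt_extChartAt_of_mem hg1).mdifferentiableAt (by simp)
  rw [mderiv_comp (f := fun b => g ((extChartAt 𝓘(ℝ, E) (1 : G)).symm b)) (y := g 1) h2
    (MDifferentiableAt.comp_of_eq _ hg h0 hsymm) (by rw [hsymm]),
    mderiv_comp hg h0 hsymm, mderiv_extChartAt_symm_self, ContinuousLinearMap.comp_id]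

theorem eventually_chartLeft_eq :
    ∀ᶠ a in 𝓝 (extChartAt 𝓘(ℝ, E) (1 : G) 1),
      chartLeft E G a = (mderiv E E (extChartAt 𝓘(ℝ, E) (1 : G))
        ((extChartAt 𝓘(ℝ, E) (1 : G)).symm a)).comp
        (mderiv E E (fun y : G => (extChartAt 𝓘(ℝ, E) (1 : G)).symm a * y) 1) := by
  have hd := (by fun_prop : ContinuousAt (fun a : E => (a, extChartAt 𝓘(ℝ, E) (1 : G) 1))
    (extChartAt 𝓘(ℝ, E) (1 : G) 1)).eventually (eventually_differentiableAt_chartMul (E := E))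
  filter_upwards [hd, eventually_mem_target (E := E) (1 : G)] with a ha hat
  have h1 := mderiv_chart_mul_eq (E := E) (f := fun b => chartMul E G (a, b))
    (g := fun y : G => (extChartAt 𝓘(ℝ, E) (1 : G)).symm a * y)
    (Filter.Eventually.of_forall fun b => rfl) (mdifferentiableAt_mul_left' _ _)
    (by simpa using (extChartAt 𝓘(ℝ, E) (1 : G)).map_target hat)
  simp only [mul_one] at h1
  rw [← h1]
  exact ((ha.hasFDerivAt.comp _ (hasFDerivAt_prodMk_right a _)).fderiv).symm

theorem eventually_chartRight_eq :
    ∀ᶠ a in 𝓝 (extChartAt 𝓘(ℝ, E) (1 : G) 1),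
      chartRight E G a = (mderiv E E (extChartAt 𝓘(ℝ, E) (1 : G))
        ((extChartAt 𝓘(ℝ, E) (1 : G)).symm a)).comp
        (mderiv E E (fun y : G => y * (extChartAt 𝓘(ℝ, E) (1 : G)).symm a) 1) := by
  have hd := (by fun_prop : ContinuousAt (fun a : E => (extChartAt 𝓘(ℝ, E) (1 : G) 1, a))
    (extChartAt 𝓘(ℝ, E) (1 : G) 1)).eventually (eventually_differentiableAt_chartMul (E := E))
  filter_upwards [hd, eventually_mem_target (E := E) (1 : G)] with a ha hat
  have h1 := mderiv_chart_mul_eq (E := E) (f := fun b => chartMul E G (b, a))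
    (g := fun y : G => y * (extChartAt 𝓘(ℝ, E) (1 : G)).symm a)
    (Filter.Eventually.of_forall fun b => rfl) (mdifferentiableAt_mul_right' _ _)
    (by simpa using (extChartAt 𝓘(ℝ, E) (1 : G)).map_target hat)
  simp only [one_mul] at h1
  rw [← h1]
  exact ((HasFDerivAt.comp (f := fun b : E => (b, a)) _ ha.hasFDerivAt
    (hasFDerivAt_prodMk_left _ a)).fderiv).symm

theorem eventually_chartLeft_eq_comp_Adj :
    ∀ᶠ a in 𝓝 (extChartAt 𝓘(ℝ, E) (1 : G) 1),
      chartLeft E G a = (chartRight E G a).comp (Adj E ((extChartAt 𝓘(ℝ, E) (1 : G)).symm a)) := by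
  filter_upwards [eventually_chartLeft_eq (E := E) (G := G),
    eventually_chartRight_eq (E := E) (G := G)] with a h1 h2
  rw [h1, h2, mderiv_mul_left_eq]; rfl

theorem chartRight_self : chartRight E G (extChartAt 𝓘(ℝ, E) (1 : G) 1) =
    ContinuousLinearMap.id ℝ E := by
  have : IsManifold 𝓘(ℝ, E) 1 G := .of_le (n := ∞) (by simp)
  have h := (eventually_chartRight_eq (E := E) (G := G)).self_of_nhds
  simp only [extChartAt_to_inv, mul_one] at h
  rw [h, mderiv_chart_self, mderiv_id]; rfl

theorem chartLeft_self : chartLeft E G (extChartAt 𝓘(ℝ, E) (1 : G) 1) =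
    ContinuousLinearMap.id ℝ E := by
  have h := (eventually_chartLeft_eq_comp_Adj (E := E) (G := G)).self_of_nhds
  simp only [extChartAt_to_inv] at h
  rw [h, chartRight_self, Adj_one]; rfl

variable [CompleteSpace E]

/-- Near the identity `Ad` is the quotient of the left by the right trivialization of the tangent
bundle, hence smooth. -/
theorem contDiffAt_Adj_chart :
    ContDiffAt ℝ ∞ (fun a : E => Adj E ((extChartAt 𝓘(ℝ, E) (1 : G)).symm a))
      (extChartAt 𝓘(ℝ, E) (1 : G) 1) := by
  have h1 : ContDiffAt ℝ ∞ (fun a : E => ((chartRight E G a).inverse).comp (chartLeft E G a))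
      (extChartAt 𝓘(ℝ, E) (1 : G) 1) := by
    refine ContDiffAt.clm_comp ?_ contDiffAt_chartLeft
    have h2 : ContDiffAt ℝ ∞ (ContinuousLinearMap.inverse : (E →L[ℝ] E) → (E →L[ℝ] E))
        (chartRight E G (extChartAt 𝓘(ℝ, E) (1 : G) 1)) := by
      rw [chartRight_self]
      exact contDiffAt_map_inverse (ContinuousLinearEquiv.refl ℝ E)
    exact h2.comp _ contDiffAt_chartRight
  refine h1.congr_of_eventuallyEq ?_
  have hinv : ∀ᶠ a in 𝓝 (extChartAt 𝓘(ℝ, E) (1 : G) 1),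
      chartRight E G a ∈ range ((↑) : (E ≃L[ℝ] E) → (E →L[ℝ] E)) := by
    refine (contDiffAt_chartRight (E := E) (G := G)).continuousAt.eventually ?_
    rw [chartRight_self]
    exact ContinuousLinearEquiv.nhds (ContinuousLinearEquiv.refl ℝ E)
  filter_upwards [eventually_chartLeft_eq_comp_Adj (E := E) (G := G), hinv] with a h3 ⟨L, hL⟩
  rw [h3, ← hL, ContinuousLinearMap.inverse_equiv]
  ext v; simp

/-- The derivatives of the two trivializations are the two orders of the mixed second derivative of
the multiplication, so the derivative of `Ad` is the antisymmetrization of that of `chartLeft`. -/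
theorem fderiv_Adj_chart (X Y : E) :
    fderiv ℝ (fun a : E => Adj E ((extChartAt 𝓘(ℝ, E) (1 : G)).symm a))
      (extChartAt 𝓘(ℝ, E) (1 : G) 1) X Y =
    fderiv ℝ (chartLeft E G) (extChartAt 𝓘(ℝ, E) (1 : G) 1) X Y -
      fderiv ℝ (chartLeft E G) (extChartAt 𝓘(ℝ, E) (1 : G) 1) Y X := by
  set e₀ := extChartAt 𝓘(ℝ, E) (1 : G) 1 with he₀
  have hA := ((contDiffAt_Adj_chart (E := E) (G := G)).differentiableAt (by simp)).hasFDerivAt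
  have hR := ((contDiffAt_chartRight (E := E) (G := G)).differentiableAt (by simp)).hasFDerivAt
  have h1 := (hR.clm_comp hA).congr_of_eventuallyEq
    (eventually_chartLeft_eq_comp_Adj (E := E) (G := G))
  have h2 : fderiv ℝ (chartLeft E G) e₀ X Y = fderiv ℝ (fun a : E => Adj E
      ((extChartAt 𝓘(ℝ, E) (1 : G)).symm a)) e₀ X Y + fderiv ℝ (chartRight E G) e₀ X Y := by
    rw [h1.fderiv]
    simp only [_root_.add_apply, ContinuousLinearMap.comp_apply,
      ContinuousLinearMap.compL_apply, ContinuousLinearMap.flip_apply, extChartAt_to_inv, Adj_one,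
      chartRight_self, ContinuousLinearMap.comp_id, ContinuousLinearMap.id_comp, he₀]
  -- the mixed partial derivatives of the multiplication agree
  have hμ : ContDiffAt ℝ ∞ (fderiv ℝ (chartMul E G)) (e₀, e₀) :=
    contDiffAt_chartMul.fderiv_right (m := ∞) (by simp)
  have hμ' := (hμ.differentiableAt (by simp)).hasFDerivAt
  have hL : ∀ X Y, fderiv ℝ (chartLeft E G) e₀ X Y =
      fderiv ℝ (fderiv ℝ (chartMul E G)) (e₀, e₀) (X, 0) (0, Y) := by
    intro X Y
    have h := (HasFDerivAt.comp (f := fun a : E => (a, e₀)) e₀ hμ'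
      (hasFDerivAt_prodMk_left e₀ e₀)).clm_comp
      (hasFDerivAt_const (ContinuousLinearMap.inr ℝ E E) e₀)
    have h' : HasFDerivAt (chartLeft E G) _ e₀ := h
    rw [h'.fderiv]; simp
  have hR : ∀ X Y, fderiv ℝ (chartRight E G) e₀ X Y =
      fderiv ℝ (fderiv ℝ (chartMul E G)) (e₀, e₀) (0, X) (Y, 0) := by
    intro X Y
    have h := (HasFDerivAt.comp (f := fun a : E => (e₀, a)) e₀ hμ'
      (hasFDerivAt_prodMk_right e₀ e₀)).clm_comp
      (hasFDerivAt_const (ContinuousLinearMap.inl ℝ E E) e₀)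
    have h' : HasFDerivAt (chartRight E G) _ e₀ := h
    rw [h'.fderiv]; simp
  have hsymm : IsSymmSndFDerivAt ℝ (chartMul E G) (e₀, e₀) :=
    contDiffAt_chartMul.isSymmSndFDerivAt (by
      rw [minSmoothness_of_isRCLikeNormedField]; exact ENat.LEInfty.out)
  rw [h2, hR, hL, hsymm.eq]
  abel

variable (G) in
/-- The Lie bracket of the Lie algebra of `G`, as an operation on the model space. -/
def lieBr (X Y : E) : E :=
  VectorField.mlieBracket 𝓘(ℝ, E) (mulInvariantVectorField (I := 𝓘(ℝ, E)) (G := G) X)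
    (mulInvariantVectorField (I := 𝓘(ℝ, E)) (G := G) Y) (1 : G)

variable (G) in
/-- The left-invariant vector field of `Y`, read in the chart at the identity. -/
def chartInvariantField (Y : E) (a : E) : E :=
  VectorField.mpullbackWithin 𝓘(ℝ, E) 𝓘(ℝ, E) (extChartAt 𝓘(ℝ, E) (1 : G)).symm
    (mulInvariantVectorField (I := 𝓘(ℝ, E)) (G := G) Y) (range 𝓘(ℝ, E)) a

omit [CompleteSpace E] in
theorem chartInvariantField_eventuallyEq (Y : E) :
    chartInvariantField G Y =ᶠ[𝓝 (extChartAt 𝓘(ℝ, E) (1 : G) 1)]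
      fun a => chartLeft E G a Y := by
  filter_upwards [eventually_chartLeft_eq (E := E) (G := G),
    eventually_mem_target (E := E) (1 : G)] with a h1 h2
  rw [h1]
  have h3 := mderiv_extChartAt_comp_symm h2
  have h4 := mderiv_symm_comp_extChartAt ((extChartAt 𝓘(ℝ, E) (1 : G)).map_target h2)
  rw [(extChartAt 𝓘(ℝ, E) (1 : G)).right_inv h2] at h4
  have h5 := ContinuousLinearMap.inverse_eq h4 h3
  have h6 : (mderiv E E (extChartAt 𝓘(ℝ, E) (1 : G)).symm a) = mfderivWithin 𝓘(ℝ, E) 𝓘(ℝ, E)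
    (extChartAt 𝓘(ℝ, E) (1 : G)).symm (range 𝓘(ℝ, E)) a := by
    rw [modelWithCornersSelf_coe, range_id, mfderivWithin_univ]; rfl
  have key : ∀ (L : E →L[ℝ] E) (w : E), L = mderiv E E (extChartAt 𝓘(ℝ, E) (1 : G)).symm a →
      L.inverse w = mderiv E E (extChartAt 𝓘(ℝ, E) (1 : G))
        ((extChartAt 𝓘(ℝ, E) (1 : G)).symm a) w := by
    rintro L w rfl
    rw [h5]
  exact key _ (mderiv E E (fun y : G => (extChartAt 𝓘(ℝ, E) (1 : G)).symm a * y) 1 Y) h6.symm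

omit [CompleteSpace E] in
/-- Mathlib's bracket of the left-invariant vector fields, computed in the chart. -/
theorem lieBr_eq (X Y : E) : lieBr G X Y =
    fderiv ℝ (chartLeft E G) (extChartAt 𝓘(ℝ, E) (1 : G) 1) X Y -
      fderiv ℝ (chartLeft E G) (extChartAt 𝓘(ℝ, E) (1 : G) 1) Y X := by
  have : IsManifold 𝓘(ℝ, E) 1 G := .of_le (n := ∞) (by simp)
  have h1 : lieBr G X Y = (mderiv E E (extChartAt 𝓘(ℝ, E) (1 : G)) 1).inverse
      (VectorField.lieBracketWithin ℝ (chartInvariantField G X) (chartInvariantField G Y)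
        ((extChartAt 𝓘(ℝ, E) (1 : G)).symm ⁻¹' univ ∩ range 𝓘(ℝ, E))
        (extChartAt 𝓘(ℝ, E) (1 : G) 1)) := rfl
  rw [h1, mderiv_chart_self, ContinuousLinearMap.inverse_id]
  simp only [modelWithCornersSelf_coe, range_id, preimage_univ, inter_univ,
    VectorField.lieBracketWithin_univ]
  rw [Filter.EventuallyEq.lieBracket_vectorField_eq (chartInvariantField_eventuallyEq X)
    (chartInvariantField_eventuallyEq Y)]
  have hL := ((contDiffAt_chartLeft (E := E) (G := G)).differentiableAt (by simp)).hasFDerivAt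
  have hL' : ∀ Y : E, fderiv ℝ (fun a => chartLeft E G a Y) (extChartAt 𝓘(ℝ, E) (1 : G) 1) =
      (fderiv ℝ (chartLeft E G) (extChartAt 𝓘(ℝ, E) (1 : G) 1)).flip Y := by
    intro Y
    rw [(hL.clm_apply (hasFDerivAt_const Y _)).fderiv]
    ext; simp
  simp only [VectorField.lieBracket, hL', chartLeft_self]
  rfl

/-- The differential of the adjoint representation at the identity is the bracket. -/
theorem fderiv_Adj_chart_eq_lieBr (X Y : E) :
    fderiv ℝ (fun a : E => Adj E ((extChartAt 𝓘(ℝ, E) (1 : G)).symm a))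
      (extChartAt 𝓘(ℝ, E) (1 : G) 1) X Y = lieBr G X Y := by
  rw [fderiv_Adj_chart, lieBr_eq]

end Adjoint

/-! ### Logarithmic derivatives of curves in a Lie group -/

section LogarithmicDerivative

variable {E : Type*} [NormedAddCommGroup E] [NormedSpace ℝ E] [CompleteSpace E]
  {G : Type*} [TopologicalSpace G] [ChartedSpace E G] [Group G] [LieGroup 𝓘(ℝ, E) ∞ G]

variable (G) in
/-- The endomorphism `ad X = [X, ·]`, as a linear function of `X`. -/
def adj : E →L[ℝ] E →L[ℝ] E :=
  fderiv ℝ (fun a : E => Adj E ((extChartAt 𝓘(ℝ, E) (1 : G)).symm a))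
    (extChartAt 𝓘(ℝ, E) (1 : G) 1)

theorem adj_eq_lieBr (X Y : E) : adj G X Y = lieBr G X Y := fderiv_Adj_chart_eq_lieBr X Y

theorem adj_antisymm (X Y : E) : adj G X Y = -adj G Y X := by
  rw [adj_eq_lieBr, adj_eq_lieBr, lieBr_eq, lieBr_eq]; abel

theorem adj_self (X : E) : adj G X X = 0 := by
  rw [adj_eq_lieBr, lieBr_eq, sub_self]

theorem contMDiff_Adj : ContMDiff 𝓘(ℝ, E) 𝓘(ℝ, E →L[ℝ] E) ∞ (Adj E : G → E →L[ℝ] E) := by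
  intro p
  have h1 : ContMDiffAt 𝓘(ℝ, E) 𝓘(ℝ, E →L[ℝ] E) ∞ (Adj E : G → E →L[ℝ] E) 1 := by
    have h2 := (contDiffAt_Adj_chart (E := E) (G := G)).contMDiffAt.comp (1 : G)
      (contMDiffAt_extChartAt_of_mem (E := E) (by simp))
    refine h2.congr_of_eventuallyEq ?_
    filter_upwards [eventually_mem_source (E := E) (1 : G)] with y hy
    simp only [Function.comp_apply, (extChartAt 𝓘(ℝ, E) (1 : G)).left_inv hy]
  have h3 : ContMDiffAt 𝓘(ℝ, E) 𝓘(ℝ, E →L[ℝ] E) ∞ (fun q : G => Adj E (p⁻¹ * q)) p :=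
    ContMDiffAt.comp_of_eq (g := Adj E) h1
      (contMDiff_mul_left (I := 𝓘(ℝ, E)) (n := ∞) (a := p⁻¹)).contMDiffAt (by simp)
  have h4 : (Adj E : G → E →L[ℝ] E) = fun q : G => (Adj E p).comp (Adj E (p⁻¹ * q)) := by
    ext q : 1
    rw [← Adj_mul]; simp
  rw [h4]
  exact (contMDiffAt_const (c := Adj E p)).clm_comp h3

theorem mderiv_Adj_one (X : E) : mderiv E (E →L[ℝ] E) (Adj E : G → E →L[ℝ] E) 1 X = adj G X := by
  have h0 := (contMDiffAt_extChartAt_symm_of_mem (E := E) (x := (1 : G))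
    (a := extChartAt 𝓘(ℝ, E) (1 : G) 1) (by simp)).mdifferentiableAt (by simp)
  have hsymm : (extChartAt 𝓘(ℝ, E) (1 : G)).symm (extChartAt 𝓘(ℝ, E) (1 : G) 1) = 1 := by simp
  unfold adj
  rw [← mderiv_eq_fderiv, mderiv_comp (g := (Adj E : G → E →L[ℝ] E))
    (contMDiff_Adj.contMDiffAt.mdifferentiableAt (by simp)) h0 hsymm, mderiv_extChartAt_symm_self]
  rfl

/-- The curve `p` in the group has logarithmic derivative `p⁻¹ p' = η` at time `t`. -/
def HasLogDerivAt (p : ℝ → G) (η : E) (t : ℝ) : Prop :=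
  HasVelocityAt E (fun s => (p t)⁻¹ * p s) η t

omit [CompleteSpace E] in
theorem HasVelocityAt.hasLogDerivAt {p : ℝ → G} {η : E} {t : ℝ}
    (h : HasVelocityAt E p (mderiv E E (fun y : G => p t * y) 1 η) t) : HasLogDerivAt p η t := by
  have h1 := HasVelocityAt.comp h (mdifferentiableAt_mul_left' (p t)⁻¹ (p t)) rfl
  have h2 := mderiv_comp (mdifferentiableAt_mul_left' (E := E) (p t)⁻¹ (p t))
    (mdifferentiableAt_mul_left' (p t) 1) (by simp)
  have h3 := congrArg (fun L : E →L[ℝ] E => L η) h2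
  simp only [inv_mul_cancel_left, mderiv_id] at h3
  unfold HasLogDerivAt
  have h4 : (mderiv E E (fun y => (p t)⁻¹ * y) (p t)) (mderiv E E (fun y : G => p t * y) 1 η) = η :=
    h3.symm
  rwa [h4] at h1

theorem HasLogDerivAt.hasDerivAt_Adj {p : ℝ → G} {η : E} {t : ℝ} (h : HasLogDerivAt p η t) :
    HasDerivAt (fun s => Adj E (p s)) ((Adj E (p t)).comp (adj G η)) t := by
  have h1 := HasVelocityAt.comp (f := (Adj E : G → E →L[ℝ] E)) (y := 1) h
    (contMDiff_Adj.contMDiffAt.mdifferentiableAt (by simp)) (by simp)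
  rw [mderiv_Adj_one, hasVelocityAt_iff_hasDerivAt] at h1
  have h2 : (fun s => Adj E (p s)) = fun s => (Adj E (p t)).comp (Adj E ((p t)⁻¹ * p s)) := by
    ext s : 1
    rw [← Adj_mul]; simp
  rw [h2]
  simpa using (hasDerivAt_const t (Adj E (p t))).clm_comp h1

theorem HasLogDerivAt.hasDerivAt_Adj_apply {p : ℝ → G} {η : E} {t : ℝ} (h : HasLogDerivAt p η t)
    (Y : E) : HasDerivAt (fun s => Adj E (p s) Y) (Adj E (p t) (adj G η Y)) t := by
  simpa using h.hasDerivAt_Adj.clm_apply (hasDerivAt_const t Y)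

omit [CompleteSpace E] in
/-- The product rule `(p q)⁻¹ (p q)' = Ad(q⁻¹) (p⁻¹ p') + q⁻¹ q'`. -/
theorem HasLogDerivAt.mul {p q : ℝ → G} {η ζ : E} {t : ℝ} (hp : HasLogDerivAt p η t)
    (hq : HasLogDerivAt q ζ t) :
    HasLogDerivAt (fun s => p s * q s) (Adj E (q t)⁻¹ η + ζ) t := by
  have h1 := HasVelocityAt.comp (f := fun y : G => (q t)⁻¹ * y * (q t)⁻¹⁻¹) (y := 1) hp
    (mdifferentiableAt_conj _ _) (by simp)
  have h2 : MDifferentiableAt (𝓘(ℝ, E).prod 𝓘(ℝ, E)) 𝓘(ℝ, E) (fun c : G × G => c.1 * c.2) (1, 1) :=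
    (contMDiff_mul 𝓘(ℝ, E) ∞).contMDiffAt.mdifferentiableAt (by simp)
  have h3 := HasVelocityAt.comp₂ (a := 1) (b := 1) h1 hq (by simp) (by simp) h2
  simp only [mul_one, one_mul, mderiv_id] at h3
  refine HasVelocityAt.congr h3 (Filter.Eventually.of_forall fun s => ?_)
  simp [mul_assoc]

end LogarithmicDerivative

/-! ### The exponential map -/

section Exponential

/-- A solution of an autonomous differential equation with smooth right hand side is smooth. -/
theorem contDiffAt_of_autonomous_ode {V : Type*} [NormedAddCommGroup V] [NormedSpace ℝ V]
    {f : V → V} {u : ℝ → V} {t₀ : ℝ} (hf : ContDiffAt ℝ ∞ f (u t₀))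
    (hu : ∀ᶠ t in 𝓝 t₀, HasDerivAt u (f (u t)) t) (n : ℕ) : ContDiffAt ℝ n u t₀ := by
  induction n with
  | zero =>
    rw [Nat.cast_zero, contDiffAt_zero]
    exact ⟨_, hu, fun t ht => HasDerivAt.continuousAt ht |>.continuousWithinAt⟩
  | succ n ih =>
    rw [Nat.cast_succ, contDiffAt_succ_iff_hasFDerivAt]
    refine ⟨fun t => (1 : ℝ →L[ℝ] ℝ).smulRight (f (u t)), ⟨_, hu, fun t ht => ?_⟩, ?_⟩
    · exact HasDerivAt.hasFDerivAt ht
    · refine ContDiffAt.smulRight contDiffAt_const ?_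
      exact ContDiffAt.comp t₀ (hf.of_le (by exact_mod_cast le_top)) ih

variable {E : Type*} [NormedAddCommGroup E] [NormedSpace ℝ E] [FiniteDimensional ℝ E]
  {G : Type*} [TopologicalSpace G] [ChartedSpace E G] [Group G] [T2Space G]
  [LieGroup 𝓘(ℝ, E) ∞ G]

/-- The exponential map, with the Lie algebra written as the model space. -/
def gexp (G : Type*) [TopologicalSpace G] [ChartedSpace E G] [Group G] [T2Space G]
    [LieGroup 𝓘(ℝ, E) ∞ G] (X : E) : G := lieExp (E := E) (G := G) X

omit [FiniteDimensional ℝ E] [T2Space G] in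
theorem contMDiff_mulInvariantVectorField_one (X : GroupLieAlgebra 𝓘(ℝ, E) G) :
    ContMDiff 𝓘(ℝ, E) (𝓘(ℝ, E).prod 𝓘(ℝ, E)) 1
      (fun x : G => (⟨x, mulInvariantVectorField X x⟩ : TangentBundle 𝓘(ℝ, E) G)) := by
  have : LieGroup 𝓘(ℝ, E) (minSmoothness ℝ 3) G := by
    simp only [minSmoothness_of_isRCLikeNormedField]; infer_instance
  refine (contMDiff_mulInvariantVectorField X).of_le ?_
  simp only [minSmoothness_of_isRCLikeNormedField]
  norm_num

theorem eq_of_isMIntegralCurve_mulInvariantVectorField {X : GroupLieAlgebra 𝓘(ℝ, E) G}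
    {γ γ' : ℝ → G} (h : IsMIntegralCurve γ (mulInvariantVectorField X))
    (h' : IsMIntegralCurve γ' (mulInvariantVectorField X)) (h0 : γ 0 = γ' 0) : γ = γ' := by
  have : CompleteSpace E := FiniteDimensional.complete ℝ E
  have : IsManifold 𝓘(ℝ, E) 1 G := .of_le (n := ∞) (by simp)
  exact isMIntegralCurve_Ioo_eq_of_contMDiff_boundaryless (t₀ := 0)
    (contMDiff_mulInvariantVectorField_one X) h h' h0

theorem gexp_smul_eq (X : E) (t : ℝ) :
    gexp G (t • X) = (exists_oneParam (E := E) (G := G) X).choose t := by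
  set γ := (exists_oneParam (E := E) (G := G) X).choose with hγ
  obtain ⟨h0, h1⟩ := (exists_oneParam (E := E) (G := G) X).choose_spec
  set γ' := (exists_oneParam (E := E) (G := G) (t • X)).choose with hγ'
  obtain ⟨h0', h1'⟩ := (exists_oneParam (E := E) (G := G) (t • X)).choose_spec
  have h2 := h1.comp_mul t
  have h3 : t • mulInvariantVectorField (I := 𝓘(ℝ, E)) (G := G) X =
      mulInvariantVectorField (I := 𝓘(ℝ, E)) (G := G) (t • X) :=
    (mulInvariantVectorField_smul t (X : GroupLieAlgebra 𝓘(ℝ, E) G)).symm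
  rw [h3] at h2
  have h4 := eq_of_isMIntegralCurve_mulInvariantVectorField h1' h2 (by
    rw [← hγ, ← hγ'] at *; simp [h0, h0'])
  have h5 := congrFun h4 1
  simp only [Function.comp_apply, one_mul] at h5
  exact h5

theorem gexp_zero : gexp G (0 : E) = 1 := by
  have h := gexp_smul_eq (G := G) (0 : E) 0
  rw [zero_smul] at h
  exact h.trans (exists_oneParam (E := E) (G := G) 0).choose_spec.1

theorem isMIntegralCurve_gexp (X : E) : IsMIntegralCurve (fun t : ℝ => gexp G (t • X))
    (mulInvariantVectorField (I := 𝓘(ℝ, E)) (G := G) X) := by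
  simp_rw [gexp_smul_eq]
  exact (exists_oneParam (E := E) (G := G) X).choose_spec.2

theorem gexp_add_smul (X : E) (s t : ℝ) :
    gexp G ((s + t) • X) = gexp G (s • X) * gexp G (t • X) := by
  have h1 := (isMIntegralCurve_gexp (G := G) X).comp_add s
  have h2 : IsMIntegralCurve (fun t : ℝ => gexp G (s • X) * gexp G (t • X))
      (mulInvariantVectorField (I := 𝓘(ℝ, E)) (G := G) X) := by
    rw [isMIntegralCurve_iff_isMIntegralCurveOn]
    exact ((isMIntegralCurve_gexp (G := G) X).isMIntegralCurveOn univ).mul_left_invariant _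
  have h3 := congrFun (eq_of_isMIntegralCurve_mulInvariantVectorField h1 h2
    (by simp [gexp_zero])) t
  simp only [Function.comp_apply] at h3
  rw [add_comm, h3]

theorem hasVelocityAt_gexp (X : E) (t : ℝ) : HasVelocityAt E (fun t : ℝ => gexp G (t • X))
    (mderiv E E (fun y : G => gexp G (t • X) * y) 1 X) t :=
  isMIntegralCurve_gexp (G := G) X t

theorem hasLogDerivAt_gexp (X : E) (t : ℝ) :
    HasLogDerivAt (fun t : ℝ => gexp G (t • X)) X t :=
  (hasVelocityAt_gexp X t).hasLogDerivAt

theorem hasLogDerivAt_gexp_mul (X : E) (r t : ℝ) :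
    HasLogDerivAt (fun t : ℝ => gexp G ((t * r) • X)) (r • X) t := by
  simp_rw [mul_smul]
  exact hasLogDerivAt_gexp (r • X) t

/-- Near the identity the curve solves an autonomous equation with smooth right hand side; the
homomorphism property carries the regularity to all times. -/
theorem contMDiff_gexp_smul (X : E) :
    ContMDiff 𝓘(ℝ, ℝ) 𝓘(ℝ, E) 2 (fun t : ℝ => gexp G (t • X)) := by
  have h0 : ContMDiffAt 𝓘(ℝ, ℝ) 𝓘(ℝ, E) 2 (fun t : ℝ => gexp G (t • X)) 0 := by
    set e := extChartAt 𝓘(ℝ, E) (1 : G) with he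
    have hc : ContinuousAt (fun t : ℝ => gexp G (t • X)) 0 := (hasVelocityAt_gexp X 0).continuousAt
    have hz : gexp G ((0 : ℝ) • X) = 1 := by rw [zero_smul, gexp_zero]
    have hmem : ∀ᶠ t : ℝ in 𝓝 0, gexp G (t • X) ∈ e.source := by
      have h1 := hc.tendsto
      rw [hz] at h1
      exact h1.eventually <| eventually_mem_source (E := E) (1 : G)
    have hcu : ContinuousAt (fun t : ℝ => e (gexp G (t • X))) 0 :=
      ContinuousAt.comp (f := fun t : ℝ => gexp G (t • X)) (g := e)
        (by rw [hz]; exact continuousAt_extChartAt (1 : G)) hc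
    have hu : ContDiffAt ℝ (2 : ℕ) (fun t : ℝ => e (gexp G (t • X))) 0 := by
      refine contDiffAt_of_autonomous_ode (f := fun a => chartLeft E G a X) ?_ ?_ 2
      · rw [hz]
        exact contDiffAt_chartLeft.clm_apply contDiffAt_const
      · have h1 : ∀ᶠ t : ℝ in 𝓝 0, chartLeft E G (e (gexp G (t • X))) =
          (mderiv E E e (e.symm (e (gexp G (t • X))))).comp
            (mderiv E E (fun y : G => e.symm (e (gexp G (t • X))) * y) 1) := by
          have h1 := hcu.tendsto
          rw [hz] at h1
          exact h1.eventually eventually_chartLeft_eq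
        filter_upwards [hmem, h1] with t ht h1
        rw [e.left_inv ht] at h1
        rw [h1, ← hasVelocityAt_iff_hasDerivAt]
        exact (hasVelocityAt_gexp X t).comp
          ((contMDiffAt_extChartAt_of_mem ht).mdifferentiableAt (by simp)) rfl
    have h2 : ContMDiffAt 𝓘(ℝ, ℝ) 𝓘(ℝ, E) 2 (fun t : ℝ => e.symm (e (gexp G (t • X)))) 0 := by
      refine ContMDiffAt.comp_of_eq (g := e.symm) (f := fun t : ℝ => e (gexp G (t • X)))
        (y := e 1) ?_ hu.contMDiffAt (by rw [hz])
      exact (contMDiffAt_extChartAt_symm_of_mem (E := E) (x := (1 : G))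
        (mem_extChartAt_target (1 : G))).of_le
        ENat.LEInfty.out
    refine h2.congr_of_eventuallyEq ?_
    filter_upwards [hmem] with t ht
    exact (e.left_inv ht).symm
  intro t
  have h1 : (fun s : ℝ => gexp G (s • X)) = fun s => gexp G (t • X) * gexp G ((s - t) • X) := by
    ext s
    rw [← gexp_add_smul, add_sub_cancel]
  rw [h1]
  have h2 : ContMDiffAt 𝓘(ℝ, ℝ) 𝓘(ℝ, E) 2 (fun s : ℝ => gexp G ((s - t) • X)) t :=
    ContMDiffAt.comp_of_eq (g := fun t : ℝ => gexp G (t • X)) (f := fun s : ℝ => s - t) h0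
      (contDiff_id.sub contDiff_const).contMDiff.contMDiffAt (by simp)
  exact ((contMDiff_mul_left (I := 𝓘(ℝ, E)) (n := ∞) (a := gexp G (t • X))).of_le
    ENat.LEInfty.out).contMDiffAt.comp t h2

variable [CompleteSpace E]

theorem Adj_gexp_eq_self {V N : E} (h : adj G V N = 0) (t : ℝ) :
    Adj E (gexp G (t • V)) N = N := by
  have h1 : ∀ s : ℝ, HasDerivAt (fun s : ℝ => Adj E (gexp G (s • V)) N) 0 s := fun s => by
    simpa [h] using (hasLogDerivAt_gexp (G := G) V s).hasDerivAt_Adj_apply N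
  have h2 := is_const_of_deriv_eq_zero (fun s => (h1 s).differentiableAt)
    (fun s => (h1 s).deriv) t 0
  rw [h2, zero_smul, gexp_zero, Adj_one]; rfl

/-- `Ad (exp V)⁻¹ = e^{-ad V}`. -/
theorem Adj_gexp_inv (V : E) (t : ℝ) :
    Adj E (gexp G (t • V))⁻¹ = NormedSpace.exp (t • (-adj G V)) := by
  have h1 : ∀ s : ℝ, HasDerivAt (fun s : ℝ => (Adj E (gexp G (s • V))).comp
      (NormedSpace.exp (s • (-adj G V)))) 0 s := fun s => by
    have h2 := (hasLogDerivAt_gexp (G := G) V s).hasDerivAt_Adj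
    have h3 := hasDerivAt_exp_smul_const' (𝕂 := ℝ) (-adj G V) s
    have h4 := h2.clm_comp h3
    convert h4 using 1
    ext v
    simp
  have h2 := is_const_of_deriv_eq_zero (fun s => (h1 s).differentiableAt)
    (fun s => (h1 s).deriv) t 0
  simp only [zero_smul, gexp_zero, Adj_one, NormedSpace.exp_zero] at h2
  have h3 : (Adj E (gexp G (t • V))).comp (NormedSpace.exp (t • (-adj G V))) =
    ContinuousLinearMap.id ℝ E := h2
  calc Adj E (gexp G (t • V))⁻¹ = (Adj E (gexp G (t • V))⁻¹).comp
        ((Adj E (gexp G (t • V))).comp (NormedSpace.exp (t • (-adj G V)))) := by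
        rw [h3, ContinuousLinearMap.comp_id]
    _ = _ := by
      rw [← ContinuousLinearMap.comp_assoc, Adj_inv_comp, ContinuousLinearMap.id_comp]

/-- The operator exponential preserves the invariant subspaces. -/
theorem exp_apply_mem {V : Type*} [NormedAddCommGroup V] [NormedSpace ℝ V] [FiniteDimensional ℝ V]
    {T : V →L[ℝ] V} {S : Submodule ℝ V} (h : ∀ v ∈ S, T v ∈ S) {v : V} (hv : v ∈ S) :
    NormedSpace.exp T v ∈ S := by
  have : CompleteSpace V := FiniteDimensional.complete ℝ V
  have h1 := NormedSpace.exp_series_hasSum_exp' (𝕂 := ℝ) T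
  have h2 : HasSum (fun n : ℕ => ((n.factorial : ℝ)⁻¹ • T ^ n) v) (NormedSpace.exp T v) :=
    h1.mapL (ContinuousLinearMap.apply ℝ V v)
  have hcl : IsClosed (S : Set V) := S.closed_of_finiteDimensional
  have h3 : ∀ n : ℕ, (T ^ n) v ∈ S := fun n => by
    induction n with
    | zero => simpa using hv
    | succ n ih => rw [pow_succ']; exact h _ ih
  exact hcl.mem_of_tendsto h2 (Filter.Eventually.of_forall fun s =>
    S.sum_mem fun n _ => S.smul_mem _ (h3 n))

theorem Adj_gexp_inv_mem {V : E} {S : Submodule ℝ E} (h : ∀ v ∈ S, adj G V v ∈ S) (t : ℝ) {v : E}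
    (hv : v ∈ S) : Adj E (gexp G (t • V))⁻¹ v ∈ S := by
  rw [Adj_gexp_inv]
  exact exp_apply_mem (fun v hv => S.smul_mem t (S.neg_mem (h v hv))) hv

/-- A subspace that is invariant under `Ad (exp tV)` for all `t` is invariant under `ad V`. -/
theorem adj_mem_of_Adj_gexp_mem {V : E} {S : Submodule ℝ E}
    (h : ∀ t : ℝ, ∀ v ∈ S, Adj E (gexp G (t • V)) v ∈ S) {v : E} (hv : v ∈ S) :
    adj G V v ∈ S := by
  have h1 := (hasLogDerivAt_gexp (G := G) V 0).hasDerivAt_Adj_apply v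
  rw [zero_smul, gexp_zero, Adj_one] at h1
  have hcl : IsClosed (S : Set E) := S.closed_of_finiteDimensional
  rw [hasDerivAt_iff_tendsto_slope] at h1
  refine hcl.mem_of_tendsto h1 (Filter.Eventually.of_forall fun s => ?_)
  exact S.smul_mem _ (S.sub_mem (h s v hv) (h 0 v hv))

end Exponential

/-! ### The Levi-Civita connection in a chart -/

section ChartGeometry

variable {F : Type*} [NormedAddCommGroup F] [NormedSpace ℝ F]
  {M : Type*} [TopologicalSpace M] [ChartedSpace F M] [IsManifold 𝓘(ℝ, F) ∞ M]

/-- The vector field near `y₀` with constant components `w` in the chart at `y₀`. These are the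
fields to which `covDerivAlong` applies the connection. -/
def constField (y₀ : M) (w : F) : ∀ y : M, TangentSpace 𝓘(ℝ, F) y :=
  fun y => (trivializationAt F (fun y : M => TangentSpace 𝓘(ℝ, F) y) y₀).symm y w

theorem constField_eq {y₀ y : M} (hy : y ∈ (extChartAt 𝓘(ℝ, F) y₀).source) (w : F) :
    (constField y₀ w y : F) =
      mderiv F F (extChartAt 𝓘(ℝ, F) y₀).symm (extChartAt 𝓘(ℝ, F) y₀ y) w := by
  have : IsManifold 𝓘(ℝ, F) 1 M := .of_le (n := ∞) (by simp)
  have hy' : y ∈ (chartAt F y₀).source := by simpa using hy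
  have h1 := TangentBundle.symmL_trivializationAt (I := 𝓘(ℝ, F)) hy'
  have h2 := (trivializationAt F (fun y : M => TangentSpace 𝓘(ℝ, F) y) y₀).symmL_apply (R := ℝ)
    (b := y) hy' w
  have h3 : (mfderivWithin 𝓘(ℝ, F) 𝓘(ℝ, F) (extChartAt 𝓘(ℝ, F) y₀).symm (range 𝓘(ℝ, F))
      (extChartAt 𝓘(ℝ, F) y₀ y)) =
      mderiv F F (extChartAt 𝓘(ℝ, F) y₀).symm (extChartAt 𝓘(ℝ, F) y₀ y) := by
    rw [modelWithCornersSelf_coe, range_id, mfderivWithin_univ]; rfl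
  refine h2.symm.trans ?_
  exact congrArg (fun L : F →L[ℝ] F => L w) (h1.trans h3)

theorem constField_self (y₀ : M) (w : F) : (constField y₀ w y₀ : F) = w := by
  rw [constField_eq (mem_extChartAt_source y₀), mderiv_extChartAt_symm_self]; rfl

theorem trivializationAt_snd_eq {y₀ y : M} (hy : y ∈ (extChartAt 𝓘(ℝ, F) y₀).source)
    (v : TangentSpace 𝓘(ℝ, F) y) :
    (trivializationAt F (fun y : M => TangentSpace 𝓘(ℝ, F) y) y₀ ⟨y, v⟩).2 =
      mderiv F F (extChartAt 𝓘(ℝ, F) y₀) y v := by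
  have : IsManifold 𝓘(ℝ, F) 1 M := .of_le (n := ∞) (by simp)
  have hy' : y ∈ (chartAt F y₀).source := by simpa using hy
  have h1 := TangentBundle.continuousLinearMapAt_trivializationAt (I := 𝓘(ℝ, F)) hy'
  have h2 := Trivialization.continuousLinearMapAt_apply_of_mem
    (trivializationAt F (fun y : M => TangentSpace 𝓘(ℝ, F) y) y₀) (R := ℝ) (b := y) hy' v
  refine h2.symm.trans ?_
  exact congrArg (fun L : F →L[ℝ] F => L v) h1

theorem contMDiffAt_constField (y₀ : M) (w : F) :
    ContMDiffAt 𝓘(ℝ, F) (𝓘(ℝ, F).prod 𝓘(ℝ, F)) ∞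
      (fun y => (⟨y, constField y₀ w y⟩ : TangentBundle 𝓘(ℝ, F) M)) y₀ := by
  have hy₀ : y₀ ∈ (trivializationAt F (fun y : M => TangentSpace 𝓘(ℝ, F) y) y₀).baseSet :=
    mem_baseSet_trivializationAt F _ y₀
  rw [(trivializationAt F (fun y : M => TangentSpace 𝓘(ℝ, F) y) y₀).contMDiffAt_section_iff hy₀]
  refine (contMDiffAt_const (c := w)).congr_of_eventuallyEq ?_
  filter_upwards [(trivializationAt F
    (fun y : M => TangentSpace 𝓘(ℝ, F) y) y₀).open_baseSet.mem_nhds hy₀] with y hy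
  exact congrArg Prod.snd
    ((trivializationAt F (fun y : M => TangentSpace 𝓘(ℝ, F) y) y₀).apply_mk_symm hy w)

theorem mdifferentiableAt_constField (y₀ : M) (w : F) :
    MDifferentiableAt 𝓘(ℝ, F) (𝓘(ℝ, F).prod 𝓘(ℝ, F))
      (fun y => (⟨y, constField y₀ w y⟩ : TangentBundle 𝓘(ℝ, F) M)) y₀ :=
  (contMDiffAt_constField y₀ w).mdifferentiableAt (by simp)

/-- The metric at a point, as a bilinear form on the model space. -/
def metricForm (g : SmoothMetric F M) (y : M) : F →L[ℝ] F →L[ℝ] ℝ := g.inner y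

theorem metricForm_symm (g : SmoothMetric F M) (y : M) (v w : F) :
    metricForm g y v w = metricForm g y w v := g.symm y v w

theorem metricForm_pos (g : SmoothMetric F M) (y : M) (v : F) (hv : v ≠ 0) :
    0 < metricForm g y v v := g.pos y v hv

/-- The metric, read in the chart at `y₀`. -/
def chartMetric (g : SmoothMetric F M) (y₀ : M) (a : F) : F →L[ℝ] F →L[ℝ] ℝ :=
  (metricForm g ((extChartAt 𝓘(ℝ, F) y₀).symm a)).bilinearComp
    (mderiv F F (extChartAt 𝓘(ℝ, F) y₀).symm a) (mderiv F F (extChartAt 𝓘(ℝ, F) y₀).symm a)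

theorem chartMetric_apply (g : SmoothMetric F M) (y₀ : M) (a v w : F) :
    chartMetric g y₀ a v w = metricForm g ((extChartAt 𝓘(ℝ, F) y₀).symm a)
      (mderiv F F (extChartAt 𝓘(ℝ, F) y₀).symm a v)
      (mderiv F F (extChartAt 𝓘(ℝ, F) y₀).symm a w) := rfl

theorem chartMetric_self (g : SmoothMetric F M) (y₀ : M) :
    chartMetric g y₀ (extChartAt 𝓘(ℝ, F) y₀ y₀) = metricForm g y₀ := by
  ext v w
  rw [chartMetric_apply, mderiv_extChartAt_symm_self, extChartAt_to_inv]; rfl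

theorem chartMetric_mderiv (g : SmoothMetric F M) {y₀ y : M}
    (hy : y ∈ (extChartAt 𝓘(ℝ, F) y₀).source) (v w : F) :
    chartMetric g y₀ (extChartAt 𝓘(ℝ, F) y₀ y) (mderiv F F (extChartAt 𝓘(ℝ, F) y₀) y v)
      (mderiv F F (extChartAt 𝓘(ℝ, F) y₀) y w) = metricForm g y v w := by
  have h := mderiv_symm_comp_extChartAt hy
  have h' : ∀ v, mderiv F F (extChartAt 𝓘(ℝ, F) y₀).symm (extChartAt 𝓘(ℝ, F) y₀ y)
    (mderiv F F (extChartAt 𝓘(ℝ, F) y₀) y v) = v := fun v => congrArg (fun L : F →L[ℝ] F => L v) h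
  rw [chartMetric_apply, h', h', (extChartAt 𝓘(ℝ, F) y₀).left_inv hy]

theorem inner_constField (g : SmoothMetric F M) {y₀ y : M}
    (hy : y ∈ (extChartAt 𝓘(ℝ, F) y₀).source) (v w : F) :
    g.inner y (constField y₀ v y) (constField y₀ w y) =
      chartMetric g y₀ (extChartAt 𝓘(ℝ, F) y₀ y) v w := by
  change metricForm g y (constField y₀ v y) (constField y₀ w y) = _
  rw [constField_eq hy, constField_eq hy, chartMetric_apply, (extChartAt 𝓘(ℝ, F) y₀).left_inv hy]

theorem contMDiffAt_inner_constField (g : SmoothMetric F M) (y₀ : M) (v w : F) :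
    ContMDiffAt 𝓘(ℝ, F) 𝓘(ℝ, ℝ) ∞
      (fun y => g.inner y (constField y₀ v y) (constField y₀ w y)) y₀ := by
  have h : ContMDiffAt 𝓘(ℝ, F) (𝓘(ℝ, F).prod 𝓘(ℝ, ℝ)) ∞
      (fun y => TotalSpace.mk' ℝ (E := Bundle.Trivial M ℝ) y
        (g.inner y (constField y₀ v y) (constField y₀ w y))) y₀ := by
    apply ContMDiffAt.clm_bundle_apply₂ (F₁ := F) (F₂ := F)
    · exact g.contMDiff.contMDiffAt
    · exact contMDiffAt_constField y₀ v
    · exact contMDiffAt_constField y₀ w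
  rw [contMDiffAt_totalSpace] at h
  exact h.2

variable [FiniteDimensional ℝ F]

omit [FiniteDimensional ℝ F] in
theorem contDiffAt_chartMetric_apply (g : SmoothMetric F M) (y₀ : M) (v w : F) :
    ContDiffAt ℝ ∞ (fun a => chartMetric g y₀ a v w) (extChartAt 𝓘(ℝ, F) y₀ y₀) := by
  rw [← contMDiffAt_iff_contDiffAt]
  have h := ContMDiffAt.comp_of_eq (contMDiffAt_inner_constField g y₀ v w)
    (contMDiffAt_extChartAt_symm_of_mem (E := F) (mem_extChartAt_target y₀)) (by simp)
  refine h.congr_of_eventuallyEq ?_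
  filter_upwards [eventually_mem_target (E := F) y₀] with a ha
  have h1 := inner_constField g ((extChartAt 𝓘(ℝ, F) y₀).map_target ha) v w
  rw [(extChartAt 𝓘(ℝ, F) y₀).right_inv ha] at h1
  exact h1.symm

/-- A family of linear maps on a finite-dimensional space is differentiable if all its
applications are. -/
theorem differentiableAt_of_clm_apply {V D W : Type*} [NormedAddCommGroup V] [NormedSpace ℝ V]
    [FiniteDimensional ℝ V] [NormedAddCommGroup D] [NormedSpace ℝ D]
    [NormedAddCommGroup W] [NormedSpace ℝ W] {f : D → V →L[ℝ] W} {x : D}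
    (h : ∀ v, DifferentiableAt ℝ (fun y => f y v) x) : DifferentiableAt ℝ f x := by
  let b := Module.finBasis ℝ V
  have h1 : f = fun y =>
      ∑ i, (LinearMap.toContinuousLinearMap (b.coord i)).smulRight (f y (b i)) := by
    ext y v
    conv_lhs => rw [← b.sum_repr v, map_sum]
    simp
  rw [h1]
  refine DifferentiableAt.fun_sum fun i _ => ?_
  exact ((ContinuousLinearMap.smulRightL ℝ V W
    (LinearMap.toContinuousLinearMap (b.coord i))).differentiableAt).comp x (h (b i))

theorem differentiableAt_chartMetric (g : SmoothMetric F M) (y₀ : M) :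
    DifferentiableAt ℝ (chartMetric g y₀) (extChartAt 𝓘(ℝ, F) y₀ y₀) :=
  differentiableAt_of_clm_apply fun v => differentiableAt_of_clm_apply fun w =>
    (contDiffAt_chartMetric_apply g y₀ v w).differentiableAt (by simp)

theorem fderiv_chartMetric_apply (g : SmoothMetric F M) (y₀ : M) (u v w : F) :
    fderiv ℝ (chartMetric g y₀) (extChartAt 𝓘(ℝ, F) y₀ y₀) u v w =
      mderiv F ℝ (fun y => g.inner y (constField y₀ v y) (constField y₀ w y)) y₀ u := by
  have : IsManifold 𝓘(ℝ, F) 1 M := .of_le (n := ∞) (by simp)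
  have h1 : mderiv F ℝ (fun y => g.inner y (constField y₀ v y) (constField y₀ w y)) y₀ =
      mderiv F ℝ (fun y => (fun a => chartMetric g y₀ a v w) (extChartAt 𝓘(ℝ, F) y₀ y)) y₀ := by
    refine mderiv_congr ?_
    filter_upwards [eventually_mem_source (E := F) y₀] with y hy
    exact inner_constField g hy v w
  have h2 := contDiffAt_chartMetric_apply g y₀ v w
  rw [h1, mderiv_comp (g := fun a => chartMetric g y₀ a v w)
    (h2.contMDiffAt.mdifferentiableAt (by simp))
    ((contMDiffAt_extChartAt_of_mem (mem_extChartAt_source y₀)).mdifferentiableAt (by simp)) rfl,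
    mderiv_chart_self, mderiv_eq_fderiv]
  have h3 := ((differentiableAt_chartMetric g y₀).hasFDerivAt.clm_apply
    (hasFDerivAt_const v _)).clm_apply (hasFDerivAt_const w _)
  rw [h3.fderiv]
  simp

/-- The constant field read in the chart. -/
def chartConstField (y₀ : M) (w : F) (a : F) : F :=
  VectorField.mpullbackWithin 𝓘(ℝ, F) 𝓘(ℝ, F) (extChartAt 𝓘(ℝ, F) y₀).symm
    (constField y₀ w) (range 𝓘(ℝ, F)) a

omit [FiniteDimensional ℝ F] in
theorem chartConstField_eventuallyEq (y₀ : M) (w : F) :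
    chartConstField y₀ w =ᶠ[𝓝 (extChartAt 𝓘(ℝ, F) y₀ y₀)] fun _ => w := by
  filter_upwards [eventually_mem_target (E := F) y₀] with a ha
  have h0 := (extChartAt 𝓘(ℝ, F) y₀).map_target ha
  have h1 := constField_eq h0 w
  have h3 := mderiv_extChartAt_comp_symm ha
  have h4 := mderiv_symm_comp_extChartAt h0
  rw [(extChartAt 𝓘(ℝ, F) y₀).right_inv ha] at h1 h4
  have h5 := ContinuousLinearMap.inverse_eq h4 h3
  have h6 : (mderiv F F (extChartAt 𝓘(ℝ, F) y₀).symm a) = mfderivWithin 𝓘(ℝ, F) 𝓘(ℝ, F)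
    (extChartAt 𝓘(ℝ, F) y₀).symm (range 𝓘(ℝ, F)) a := by
    rw [modelWithCornersSelf_coe, range_id, mfderivWithin_univ]; rfl
  have key : ∀ (L : F →L[ℝ] F) (v : F), L = mderiv F F (extChartAt 𝓘(ℝ, F) y₀).symm a →
      v = mderiv F F (extChartAt 𝓘(ℝ, F) y₀).symm a w → L.inverse v = w := by
    rintro L v rfl rfl
    rw [h5]
    exact congrArg (fun L : F →L[ℝ] F => L w) h3
  exact key _ (constField y₀ w ((extChartAt 𝓘(ℝ, F) y₀).symm a)) h6.symm h1

omit [FiniteDimensional ℝ F] in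
theorem mlieBracket_constField (y₀ : M) (v w : F) :
    VectorField.mlieBracket 𝓘(ℝ, F) (constField y₀ v) (constField y₀ w) y₀ = (0 : F) := by
  have h1 : VectorField.mlieBracket 𝓘(ℝ, F) (constField y₀ v) (constField y₀ w) y₀ =
      (mderiv F F (extChartAt 𝓘(ℝ, F) y₀) y₀).inverse
      (VectorField.lieBracketWithin ℝ (chartConstField y₀ v) (chartConstField y₀ w)
        ((extChartAt 𝓘(ℝ, F) y₀).symm ⁻¹' univ ∩ range 𝓘(ℝ, F))
        (extChartAt 𝓘(ℝ, F) y₀ y₀)) := rfl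
  rw [h1]
  simp only [modelWithCornersSelf_coe, range_id, preimage_univ, inter_univ,
    VectorField.lieBracketWithin_univ]
  rw [Filter.EventuallyEq.lieBracket_vectorField_eq (chartConstField_eventuallyEq y₀ v)
    (chartConstField_eventuallyEq y₀ w)]
  simp [VectorField.lieBracket]
  rfl

/-- The covariant derivative at `y₀`, in the direction `u`, of the field that has constant
components `w` in the chart at `y₀`. -/
def christoffel (nabla : Connection F M) (y₀ : M) (w u : F) : F := nabla (constField y₀ w) y₀ u

theorem christoffel_symm {g : SmoothMetric F M} {nabla : Connection F M}
    (h : IsLeviCivita g nabla) (y₀ : M) (v w : F) :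
    christoffel nabla y₀ v w = christoffel nabla y₀ w v := by
  have : CompleteSpace F := FiniteDimensional.complete ℝ F
  have h1 := (CovariantDerivative.torsion_eq_zero_iff nabla).1 h.1
    (mdifferentiableAt_constField y₀ w) (mdifferentiableAt_constField y₀ v)
  have h2 : christoffel nabla y₀ v (constField y₀ w y₀) -
      christoffel nabla y₀ w (constField y₀ v y₀) = 0 := h1.trans (mlieBracket_constField y₀ w v)
  rw [constField_self, constField_self] at h2
  exact sub_eq_zero.1 h2

theorem fderiv_chartMetric_eq {g : SmoothMetric F M} {nabla : Connection F M}
    (h : IsLeviCivita g nabla) (y₀ : M) (u v w : F) :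
    fderiv ℝ (chartMetric g y₀) (extChartAt 𝓘(ℝ, F) y₀ y₀) u v w =
      metricForm g y₀ (christoffel nabla y₀ v u) w +
        metricForm g y₀ v (christoffel nabla y₀ w u) := by
  rw [fderiv_chartMetric_apply]
  have h1 := h.2 y₀ u (constField y₀ v) (constField y₀ w) (mdifferentiableAt_constField y₀ v)
    (mdifferentiableAt_constField y₀ w)
  have h2 : mderiv F ℝ (fun y => g.inner y (constField y₀ v y) (constField y₀ w y)) y₀ u =
      metricForm g y₀ (christoffel nabla y₀ v u) (constField y₀ w y₀) +
        metricForm g y₀ (constField y₀ v y₀) (christoffel nabla y₀ w u) := h1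
  rwa [constField_self, constField_self] at h2

/-- The Koszul formula for the coordinate fields, on the diagonal. -/
theorem metricForm_christoffel_self {g : SmoothMetric F M} {nabla : Connection F M}
    (h : IsLeviCivita g nabla) (y₀ : M) (v w : F) :
    metricForm g y₀ (christoffel nabla y₀ v v) w =
      fderiv ℝ (chartMetric g y₀) (extChartAt 𝓘(ℝ, F) y₀ y₀) v v w -
        (1 / 2) * fderiv ℝ (chartMetric g y₀) (extChartAt 𝓘(ℝ, F) y₀ y₀) w v v := by
  rw [fderiv_chartMetric_eq h, fderiv_chartMetric_eq h, christoffel_symm h y₀ w v,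
    metricForm_symm g y₀ v]
  ring

omit [FiniteDimensional ℝ F] in
theorem eventually_velocity_chart {x : ℝ → M} {t : ℝ} (hx : ContMDiffAt 𝓘(ℝ, ℝ) 𝓘(ℝ, F) 2 x t) :
    ∀ᶠ s in 𝓝 t, x s ∈ (extChartAt 𝓘(ℝ, F) (x t)).source ∧
      HasDerivAt (fun s => extChartAt 𝓘(ℝ, F) (x t) (x s))
        (mderiv F F (extChartAt 𝓘(ℝ, F) (x t)) (x s) (velocity x s)) s := by
  filter_upwards [hx.continuousAt.eventually (eventually_mem_source (E := F) (x t)),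
    (contMDiffAt_iff_contMDiffAt_nhds (by simp)).1 (hx.of_le one_le_two)] with s hs hxs
  refine ⟨hs, ?_⟩
  rw [← hasVelocityAt_iff_hasDerivAt]
  exact (hxs.mdifferentiableAt (by simp)).hasVelocityAt.comp
    ((contMDiffAt_extChartAt_of_mem hs).mdifferentiableAt (by simp)) rfl

omit [FiniteDimensional ℝ F] in
theorem contDiffAt_chart_curve {x : ℝ → M} {t : ℝ} (hx : ContMDiffAt 𝓘(ℝ, ℝ) 𝓘(ℝ, F) 2 x t) :
    ContDiffAt ℝ 2 (fun s => extChartAt 𝓘(ℝ, F) (x t) (x s)) t := by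
  rw [← contMDiffAt_iff_contDiffAt]
  exact ((contMDiffAt_extChartAt_of_mem (mem_extChartAt_source (x t))).of_le
    ENat.LEInfty.out).comp t hx

omit [FiniteDimensional ℝ F] in
/-- The acceleration of a curve, in the chart at the point of the curve. -/
theorem covDerivAlong_velocity (nabla : Connection F M) {x : ℝ → M} {t : ℝ}
    (hx : ContMDiffAt 𝓘(ℝ, ℝ) 𝓘(ℝ, F) 2 x t) :
    (covDerivAlong nabla x (velocity x) t : F) =
      deriv (deriv (fun s => extChartAt 𝓘(ℝ, F) (x t) (x s))) t +
        christoffel nabla (x t) (velocity x t) (velocity x t) := by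
  have : IsManifold 𝓘(ℝ, F) 1 M := .of_le (n := ∞) (by simp)
  have h1 : (trivializationAt F (fun y : M => TangentSpace 𝓘(ℝ, F) y) (x t)
      ⟨x t, velocity x t⟩).2 = (velocity x t : F) := by
    rw [trivializationAt_snd_eq (mem_extChartAt_source (x t)), mderiv_chart_self]; rfl
  have h2 : deriv (fun s => (trivializationAt F (fun y : M => TangentSpace 𝓘(ℝ, F) y) (x t)
      ⟨x s, velocity x s⟩).2) t = deriv (deriv (fun s => extChartAt 𝓘(ℝ, F) (x t) (x s))) t := by
    refine Filter.EventuallyEq.deriv_eq ?_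
    filter_upwards [eventually_velocity_chart hx] with s hs
    rw [hs.2.deriv, trivializationAt_snd_eq hs.1]
  have h3 : (covDerivAlong nabla x (velocity x) t : F) =
      HAdd.hAdd (α := F) (β := F) (γ := F) (constField (x t) (deriv (fun s => (trivializationAt F
        (fun y : M => TangentSpace 𝓘(ℝ, F) y) (x t) ⟨x s, velocity x s⟩).2) t) (x t))
      (christoffel nabla (x t) (trivializationAt F (fun y : M => TangentSpace 𝓘(ℝ, F) y) (x t)
        ⟨x t, velocity x t⟩).2 (velocity x t)) := rfl
  rw [h3, constField_self, h1, h2]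

end ChartGeometry

/-! ### Noether's theorem -/

section Noether

/-- Infinitesimal form of the invariance of the bilinear forms `g a` under the local action `Φ` of a
parameter space: `L_κ g = 0` for the vector field `κ` generated by `Z`. -/
theorem lieDerivative_metric_eq_zero {E F : Type*} [NormedAddCommGroup E] [NormedSpace ℝ E]
    [NormedAddCommGroup F] [NormedSpace ℝ F] {Φ : E × F → F} {g : F → F →L[ℝ] F →L[ℝ] ℝ}
    {e₀ Z : E} {a₀ v : F} (hΦ : ContDiffAt ℝ ∞ Φ (e₀, a₀)) (hΦ₀ : ∀ᶠ a in 𝓝 a₀, Φ (e₀, a) = a)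
    (hg : DifferentiableAt ℝ g a₀) (hsymm : ∀ v w, g a₀ v w = g a₀ w v)
    (hinv : ∀ᶠ ζ in 𝓝 e₀, g (Φ (ζ, a₀)) (fderiv ℝ Φ (ζ, a₀) (0, v)) (fderiv ℝ Φ (ζ, a₀) (0, v)) =
      g a₀ v v) :
    fderiv ℝ g a₀ (fderiv ℝ Φ (e₀, a₀) (Z, 0)) v v +
      2 * g a₀ (fderiv ℝ (fun a => fderiv ℝ Φ (e₀, a) (Z, 0)) a₀ v) v = 0 := by
  have hΦd := (hΦ.differentiableAt (by simp)).hasFDerivAt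
  have hΦ' : ContDiffAt ℝ ∞ (fderiv ℝ Φ) (e₀, a₀) := hΦ.fderiv_right (m := ∞) (by simp)
  have hΦ'd := (hΦ'.differentiableAt (by simp)).hasFDerivAt
  have h0 : Φ (e₀, a₀) = a₀ := hΦ₀.self_of_nhds
  have hid : fderiv ℝ Φ (e₀, a₀) (0, v) = v := by
    have h1 := HasFDerivAt.comp (f := fun a : F => (e₀, a)) a₀ hΦd (hasFDerivAt_prodMk_right e₀ a₀)
    have h2 := (hasFDerivAt_id (𝕜 := ℝ) a₀).congr_of_eventuallyEq hΦ₀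
    exact congrArg (fun L : F →L[ℝ] F => L v) (h1.unique h2)
  -- the line `s ↦ e₀ + s Z` in the parameter space
  have hl : HasDerivAt (fun s : ℝ => (e₀ + s • Z, a₀)) (Z, (0 : F)) 0 := by
    have h1 : HasDerivAt (fun s : ℝ => e₀ + s • Z) Z 0 := by
      simpa using ((hasDerivAt_id (0 : ℝ)).smul_const Z).const_add e₀
    exact h1.prodMk (hasDerivAt_const 0 a₀)
  have hl0 : (e₀ + (0 : ℝ) • Z, a₀) = (e₀, a₀) := by simp
  have hb : HasDerivAt (fun s : ℝ => Φ (e₀ + s • Z, a₀)) (fderiv ℝ Φ (e₀, a₀) (Z, 0)) 0 :=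
    HasFDerivAt.comp_hasDerivAt_of_eq 0 hΦd hl hl0.symm
  have hw : HasDerivAt (fun s : ℝ => fderiv ℝ Φ (e₀ + s • Z, a₀) (0, v))
      (fderiv ℝ (fderiv ℝ Φ) (e₀, a₀) (Z, 0) (0, v)) 0 := by
    have h1 : HasDerivAt (fun s : ℝ => fderiv ℝ Φ (e₀ + s • Z, a₀)) _ 0 :=
      HasFDerivAt.comp_hasDerivAt_of_eq 0 hΦ'd hl hl0.symm
    simpa using h1.clm_apply (hasDerivAt_const 0 ((0 : E), v))
  have hgb : HasDerivAt (fun s : ℝ => g (Φ (e₀ + s • Z, a₀)))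
      (fderiv ℝ g a₀ (fderiv ℝ Φ (e₀, a₀) (Z, 0))) 0 :=
    HasFDerivAt.comp_hasDerivAt_of_eq (E := F →L[ℝ] F →L[ℝ] ℝ) 0 hg.hasFDerivAt hb (by simp [h0])
  have h1 := (hgb.clm_apply hw).clm_apply hw
  simp only [zero_smul, add_zero, h0, hid] at h1
  have h2 : HasDerivAt (fun s : ℝ => g (Φ (e₀ + s • Z, a₀)) (fderiv ℝ Φ (e₀ + s • Z, a₀) (0, v))
      (fderiv ℝ Φ (e₀ + s • Z, a₀) (0, v))) 0 0 := by
    refine (hasDerivAt_const (0 : ℝ) (g a₀ v v)).congr_of_eventuallyEq ?_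
    have hc : Filter.Tendsto (fun s : ℝ => e₀ + s • Z) (𝓝 0) (𝓝 e₀) := by
      have : ContinuousAt (fun s : ℝ => e₀ + s • Z) 0 := by fun_prop
      simpa [ContinuousAt] using this
    exact hc.eventually hinv
  have h3 := h1.unique h2
  have hκ : fderiv ℝ (fun a => fderiv ℝ Φ (e₀, a) (Z, 0)) a₀ v =
      fderiv ℝ (fderiv ℝ Φ) (e₀, a₀) (Z, 0) (0, v) := by
    have h4 := (HasFDerivAt.comp (f := fun a : F => (e₀, a)) a₀ hΦ'd
      (hasFDerivAt_prodMk_right e₀ a₀)).clm_apply (hasFDerivAt_const (Z, (0 : F)) a₀)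
    have h4' : HasFDerivAt (fun a => fderiv ℝ Φ (e₀, a) (Z, 0)) _ a₀ := h4
    rw [h4'.fderiv]
    have hs : IsSymmSndFDerivAt ℝ Φ (e₀, a₀) :=
      hΦ.isSymmSndFDerivAt (by
        rw [minSmoothness_of_isRCLikeNormedField]; exact ENat.LEInfty.out)
    simp [hs.eq (Z, (0 : F)) (0, v)]
  rw [hκ]
  simp only [_root_.add_apply] at h3
  rw [hsymm v] at h3
  linarith

variable {E F : Type*} [NormedAddCommGroup E] [NormedSpace ℝ E]
  [NormedAddCommGroup F] [NormedSpace ℝ F]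
  {G : Type*} [TopologicalSpace G] [ChartedSpace E G] [Group G] [LieGroup 𝓘(ℝ, E) ∞ G]
  {M : Type*} [TopologicalSpace M] [ChartedSpace F M] [IsManifold 𝓘(ℝ, F) ∞ M] [MulAction G M]
  [ContMDiffSMul 𝓘(ℝ, E) 𝓘(ℝ, F) ∞ G M]

variable (E F G) in
/-- The differential at the identity of the orbit map `q ↦ q • y`. Its value at `Z` is the velocity
of `exp(sZ) • y` at `s = 0`, so that `y ↦ orbitDeriv E F G y Z` is the fundamental vector field of
`Z`; for an isometric action it is a Killing field. -/
def orbitDeriv (y : M) : E →L[ℝ] F := mderiv E F (fun q : G => q • y) 1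

theorem mdifferentiableAt_smul_left (E : Type*) [NormedAddCommGroup E] [NormedSpace ℝ E]
    {F : Type*} [NormedAddCommGroup F] [NormedSpace ℝ F]
    {G : Type*} [TopologicalSpace G] [ChartedSpace E G] [Group G]
    {M : Type*} [TopologicalSpace M] [ChartedSpace F M] [MulAction G M]
    [ContMDiffSMul 𝓘(ℝ, E) 𝓘(ℝ, F) ∞ G M] (p : G) (y : M) :
    MDifferentiableAt 𝓘(ℝ, F) 𝓘(ℝ, F) (fun z : M => p • z) y := by
  have h : ContMDiff 𝓘(ℝ, F) 𝓘(ℝ, F) ∞ (fun z : M => p • z) :=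
    (contMDiff_smul (I := 𝓘(ℝ, E)) (G := G)).comp (contMDiff_const.prodMk contMDiff_id)
  exact h.contMDiffAt.mdifferentiableAt (by simp)

omit [LieGroup 𝓘(ℝ, E) ∞ G] [IsManifold 𝓘(ℝ, F) ∞ M] in
theorem mdifferentiableAt_smul_right (p : G) (y : M) :
    MDifferentiableAt 𝓘(ℝ, E) 𝓘(ℝ, F) (fun q : G => q • y) p := by
  have h : ContMDiff 𝓘(ℝ, E) 𝓘(ℝ, F) ∞ (fun q : G => q • y) :=
    (contMDiff_smul (I := 𝓘(ℝ, E)) (G := G)).comp (contMDiff_id.prodMk contMDiff_const)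
  exact h.contMDiffAt.mdifferentiableAt (by simp)

variable (E G) in
/-- The action of `G` on `M`, read in the charts at `1` and `y₀`. -/
def chartAct (y₀ : M) (c : E × F) : F :=
  extChartAt 𝓘(ℝ, F) y₀
    ((extChartAt 𝓘(ℝ, E) (1 : G)).symm c.1 • (extChartAt 𝓘(ℝ, F) y₀).symm c.2)

theorem contDiffAt_chartAct (y₀ : M) : ContDiffAt ℝ ∞ (chartAct E G y₀)
    (extChartAt 𝓘(ℝ, E) (1 : G) 1, extChartAt 𝓘(ℝ, F) y₀ y₀) := by
  rw [← contMDiffAt_iff_contDiffAt]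
  have hf : ContMDiffAt 𝓘(ℝ, E × F) 𝓘(ℝ, E) ∞
      (fun c : E × F => (extChartAt 𝓘(ℝ, E) (1 : G)).symm c.1)
      (extChartAt 𝓘(ℝ, E) (1 : G) 1, extChartAt 𝓘(ℝ, F) y₀ y₀) :=
    (contMDiffAt_extChartAt_symm_of_mem (mem_extChartAt_target (1 : G))).comp
      (extChartAt 𝓘(ℝ, E) (1 : G) 1, extChartAt 𝓘(ℝ, F) y₀ y₀) contDiff_fst.contMDiff.contMDiffAt
  have hg : ContMDiffAt 𝓘(ℝ, E × F) 𝓘(ℝ, F) ∞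
      (fun c : E × F => (extChartAt 𝓘(ℝ, F) y₀).symm c.2)
      (extChartAt 𝓘(ℝ, E) (1 : G) 1, extChartAt 𝓘(ℝ, F) y₀ y₀) :=
    (contMDiffAt_extChartAt_symm_of_mem (mem_extChartAt_target y₀)).comp
      (extChartAt 𝓘(ℝ, E) (1 : G) 1, extChartAt 𝓘(ℝ, F) y₀ y₀) contDiff_snd.contMDiff.contMDiffAt
  have hm : ContMDiffAt 𝓘(ℝ, E × F) 𝓘(ℝ, F) ∞ (fun c : E × F =>
      (extChartAt 𝓘(ℝ, E) (1 : G)).symm c.1 • (extChartAt 𝓘(ℝ, F) y₀).symm c.2)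
      (extChartAt 𝓘(ℝ, E) (1 : G) 1, extChartAt 𝓘(ℝ, F) y₀ y₀) :=
    (contMDiff_smul (I := 𝓘(ℝ, E)) (I' := 𝓘(ℝ, F)) (n := ∞) (G := G) (M := M)).contMDiffAt.comp
      (extChartAt 𝓘(ℝ, E) (1 : G) 1, extChartAt 𝓘(ℝ, F) y₀ y₀) (hf.prodMk hg)
  refine ContMDiffAt.comp _ (contMDiffAt_extChartAt_of_mem ?_) hm
  simp

omit [LieGroup 𝓘(ℝ, E) ∞ G]
  [ContMDiffSMul 𝓘(ℝ, E) 𝓘(ℝ, F) ∞ G M] in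
omit [IsManifold 𝓘(ℝ, F) ∞ M] in
theorem eventually_chartAct_one (y₀ : M) : ∀ᶠ a in 𝓝 (extChartAt 𝓘(ℝ, F) y₀ y₀),
    chartAct E G y₀ (extChartAt 𝓘(ℝ, E) (1 : G) 1, a) = a := by
  filter_upwards [eventually_mem_target (E := F) y₀] with a ha
  simp only [chartAct, extChartAt_to_inv, one_smul]
  exact (extChartAt 𝓘(ℝ, F) y₀).right_inv ha

theorem eventually_differentiableAt_chartAct (y₀ : M) :
    ∀ᶠ c in 𝓝 (extChartAt 𝓘(ℝ, E) (1 : G) 1, extChartAt 𝓘(ℝ, F) y₀ y₀),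
      DifferentiableAt ℝ (chartAct E G y₀) c := by
  filter_upwards [((contDiffAt_chartAct (E := E) (G := G) y₀).of_le
    (show (1 : ℕ∞ω) ≤ ∞ by simp)).eventually (by simp)] with c hc
  exact hc.differentiableAt (by simp)

/-- The fundamental vector field in the chart. -/
theorem eventually_orbitDeriv_chart (y₀ : M) (Z : E) :
    ∀ᶠ y in 𝓝 y₀, fderiv ℝ (chartAct E G y₀)
      (extChartAt 𝓘(ℝ, E) (1 : G) 1, extChartAt 𝓘(ℝ, F) y₀ y) (Z, 0) =
      mderiv F F (extChartAt 𝓘(ℝ, F) y₀) y (orbitDeriv E F G y Z) := by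
  have hc : Filter.Tendsto (fun y : M => (extChartAt 𝓘(ℝ, E) (1 : G) 1, extChartAt 𝓘(ℝ, F) y₀ y))
      (𝓝 y₀) (𝓝 (extChartAt 𝓘(ℝ, E) (1 : G) 1, extChartAt 𝓘(ℝ, F) y₀ y₀)) :=
    tendsto_const_nhds.prodMk_nhds (continuousAt_extChartAt y₀)
  filter_upwards [hc.eventually (eventually_differentiableAt_chartAct (E := E) (G := G) y₀),
    eventually_mem_source (E := F) y₀] with y hd hy
  have h1 := HasFDerivAt.comp (f := fun ζ : E => (ζ, extChartAt 𝓘(ℝ, F) y₀ y))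
    (extChartAt 𝓘(ℝ, E) (1 : G) 1) hd.hasFDerivAt
    (hasFDerivAt_prodMk_left (extChartAt 𝓘(ℝ, E) (1 : G) 1) (extChartAt 𝓘(ℝ, F) y₀ y))
  have h2 : (fun ζ : E => chartAct E G y₀ (ζ, extChartAt 𝓘(ℝ, F) y₀ y)) = fun ζ : E =>
      extChartAt 𝓘(ℝ, F) y₀ ((extChartAt 𝓘(ℝ, E) (1 : G)).symm ζ • y) := by
    ext ζ
    simp only [chartAct, (extChartAt 𝓘(ℝ, F) y₀).left_inv hy]
  have h3 := h1.fderiv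
  have h0 := (contMDiffAt_extChartAt_symm_of_mem (E := E)
    (mem_extChartAt_target (I := 𝓘(ℝ, E)) (1 : G))).mdifferentiableAt (by simp)
  have hsymm : (extChartAt 𝓘(ℝ, E) (1 : G)).symm (extChartAt 𝓘(ℝ, E) (1 : G) 1) = 1 := by simp
  have h4 : fderiv ℝ (fun ζ : E => chartAct E G y₀ (ζ, extChartAt 𝓘(ℝ, F) y₀ y))
      (extChartAt 𝓘(ℝ, E) (1 : G) 1) = (mderiv F F (extChartAt 𝓘(ℝ, F) y₀) y).comp
        (mderiv E F (fun q : G => q • y) 1) := by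
    rw [h2, ← mderiv_eq_fderiv,
      mderiv_comp (f := fun ζ => (extChartAt 𝓘(ℝ, E) (1 : G)).symm ζ • y) (y := y)
        ((contMDiffAt_extChartAt_of_mem hy).mdifferentiableAt (by simp))
        (MDifferentiableAt.comp_of_eq _ (mdifferentiableAt_smul_right 1 y) h0 hsymm)
        (by rw [hsymm, one_smul]),
      mderiv_comp (mdifferentiableAt_smul_right 1 y) h0 hsymm, mderiv_extChartAt_symm_self,
      ContinuousLinearMap.comp_id]
  have h5 := congrArg (fun L : E →L[ℝ] F => L Z) (h3.symm.trans h4)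
  simpa [orbitDeriv] using h5

/-- Invariance of the metric, for the group elements near the identity and in the chart. -/
theorem eventually_chartAct_isometry {g : SmoothMetric F M} (hg : IsInvariantMetric G g) (y₀ : M)
    (v : F) :
    ∀ᶠ ζ in 𝓝 (extChartAt 𝓘(ℝ, E) (1 : G) 1),
      chartMetric g y₀ (chartAct E G y₀ (ζ, extChartAt 𝓘(ℝ, F) y₀ y₀))
        (fderiv ℝ (chartAct E G y₀) (ζ, extChartAt 𝓘(ℝ, F) y₀ y₀) (0, v))
        (fderiv ℝ (chartAct E G y₀) (ζ, extChartAt 𝓘(ℝ, F) y₀ y₀) (0, v)) =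
      chartMetric g y₀ (extChartAt 𝓘(ℝ, F) y₀ y₀) v v := by
  have hc : Filter.Tendsto (fun ζ : E => (ζ, extChartAt 𝓘(ℝ, F) y₀ y₀))
      (𝓝 (extChartAt 𝓘(ℝ, E) (1 : G) 1))
      (𝓝 (extChartAt 𝓘(ℝ, E) (1 : G) 1, extChartAt 𝓘(ℝ, F) y₀ y₀)) :=
    Filter.tendsto_id.prodMk_nhds tendsto_const_nhds
  have h0 := (contMDiffAt_extChartAt_symm_of_mem (E := E)
    (mem_extChartAt_target (I := 𝓘(ℝ, E)) (1 : G)))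
  have hs : Filter.Tendsto (fun ζ : E => (extChartAt 𝓘(ℝ, E) (1 : G)).symm ζ • y₀)
      (𝓝 (extChartAt 𝓘(ℝ, E) (1 : G) 1)) (𝓝 y₀) := by
    have h1 : ContinuousAt (fun q : G => q • y₀)
        ((extChartAt 𝓘(ℝ, E) (1 : G)).symm (extChartAt 𝓘(ℝ, E) (1 : G) 1)) :=
      (mdifferentiableAt_smul_right (E := E) (F := F) _ y₀).continuousAt
    have h2 := ContinuousAt.comp h1 h0.continuousAt
    simpa [ContinuousAt, Function.comp_def] using h2
  filter_upwards [hc.eventually (eventually_differentiableAt_chartAct (E := E) (G := G) y₀),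
    hs.eventually (eventually_mem_source (E := F) y₀)] with ζ hd hζ
  set p := (extChartAt 𝓘(ℝ, E) (1 : G)).symm ζ with hp
  have h1 := (HasFDerivAt.comp (f := fun a : F => (ζ, a)) (extChartAt 𝓘(ℝ, F) y₀ y₀)
    hd.hasFDerivAt (hasFDerivAt_prodMk_right ζ (extChartAt 𝓘(ℝ, F) y₀ y₀))).fderiv
  have h3 := (contMDiffAt_extChartAt_symm_of_mem (E := F)
    (mem_extChartAt_target (I := 𝓘(ℝ, F)) y₀)).mdifferentiableAt (by simp)
  have hsymm : (extChartAt 𝓘(ℝ, F) y₀).symm (extChartAt 𝓘(ℝ, F) y₀ y₀) = y₀ := by simp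
  have hpd : MDifferentiableAt 𝓘(ℝ, F) 𝓘(ℝ, F) (fun z : M => p • z) y₀ :=
    mdifferentiableAt_smul_left E p y₀
  have h2 : fderiv ℝ (fun a : F => chartAct E G y₀ (ζ, a)) (extChartAt 𝓘(ℝ, F) y₀ y₀) =
      (mderiv F F (extChartAt 𝓘(ℝ, F) y₀) (p • y₀)).comp (mderiv F F (fun z : M => p • z) y₀) := by
    change fderiv ℝ (fun a : F => extChartAt 𝓘(ℝ, F) y₀ (p • (extChartAt 𝓘(ℝ, F) y₀).symm a)) _ = _
    rw [← mderiv_eq_fderiv,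
      mderiv_comp (f := fun a => p • (extChartAt 𝓘(ℝ, F) y₀).symm a) (y := p • y₀)
        ((contMDiffAt_extChartAt_of_mem hζ).mdifferentiableAt (by simp))
        (MDifferentiableAt.comp_of_eq _ hpd h3 hsymm) (by rw [hsymm]),
      mderiv_comp (g := fun z : M => p • z) hpd h3 hsymm, mderiv_extChartAt_symm_self,
      ContinuousLinearMap.comp_id]
  have h4 : fderiv ℝ (chartAct E G y₀) (ζ, extChartAt 𝓘(ℝ, F) y₀ y₀) (0, v) =
      mderiv F F (extChartAt 𝓘(ℝ, F) y₀) (p • y₀) (mderiv F F (fun z : M => p • z) y₀ v) := by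
    have h5 := congrArg (fun L : F →L[ℝ] F => L v) (h1.symm.trans h2)
    simpa using h5
  have h6 : chartAct E G y₀ (ζ, extChartAt 𝓘(ℝ, F) y₀ y₀) = extChartAt 𝓘(ℝ, F) y₀ (p • y₀) := by
    simp only [chartAct, hsymm, hp]
  rw [h4, h6, chartMetric_mderiv g hζ, chartMetric_self]
  exact hg p y₀ v v

/-- Noether's theorem: along a curve `x`, the derivative of the momentum `g(ẋ, K)` of a Killing
field `K` is `g(∇_ẋ ẋ, K)`. -/
theorem hasDerivAt_momentum [FiniteDimensional ℝ F] {g : SmoothMetric F M} {nabla : Connection F M}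
    (hnabla : IsLeviCivita g nabla) (hg : IsInvariantMetric G g) {x : ℝ → M} {t : ℝ}
    (hx : ContMDiffAt 𝓘(ℝ, ℝ) 𝓘(ℝ, F) 2 x t) (Z : E) :
    HasDerivAt (fun s => metricForm g (x s) (velocity x s) (orbitDeriv E F G (x s) Z))
      (metricForm g (x t) (covDerivAlong nabla x (velocity x) t) (orbitDeriv E F G (x t) Z)) t := by
  have : IsManifold 𝓘(ℝ, F) 1 M := .of_le (n := ∞) (by simp)
  set y₀ := x t with hy₀
  set u : ℝ → F := fun s => extChartAt 𝓘(ℝ, F) y₀ (x s) with hu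
  set e₀ := extChartAt 𝓘(ℝ, E) (1 : G) 1 with he₀
  set κ : F → F := fun a => fderiv ℝ (chartAct E G y₀) (e₀, a) (Z, 0) with hκ
  have hut : u t = extChartAt 𝓘(ℝ, F) y₀ y₀ := rfl
  have hv := eventually_velocity_chart hx
  have huv : deriv u t = velocity x t := by
    rw [hv.self_of_nhds.2.deriv, mderiv_chart_self]; rfl
  have hκt : κ (u t) = orbitDeriv E F G y₀ Z := by
    have h := (eventually_orbitDeriv_chart (E := E) (F := F) (G := G) y₀ Z).self_of_nhds
    rw [mderiv_chart_self] at h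
    exact h
  have hu2 := contDiffAt_chart_curve hx
  have hud : HasDerivAt u (deriv u t) t := (hu2.differentiableAt (by simp)).hasDerivAt
  have hudd : HasDerivAt (deriv u) (deriv (deriv u) t) t := by
    have h1 : ContDiffAt ℝ 1 (deriv u) t := by
      have h2 : ContDiffAt ℝ 1 (fun s => fderiv ℝ u s 1) t :=
        (hu2.fderiv_right (m := 1) (by norm_num)).clm_apply contDiffAt_const
      exact h2
    exact (h1.differentiableAt (by simp)).hasDerivAt
  have hκd : HasFDerivAt κ (fderiv ℝ κ (u t)) (u t) := by
    have h1 : ContDiffAt ℝ ∞ (fderiv ℝ (chartAct E G y₀)) (e₀, u t) :=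
      (contDiffAt_chartAct (E := E) (G := G) y₀).fderiv_right (m := ∞) (by simp)
    have h2 : ContDiffAt ℝ ∞ κ (u t) :=
      (ContDiffAt.comp (f := fun a : F => (e₀, a)) (u t) h1 (by fun_prop)).clm_apply
        contDiffAt_const
    exact (h2.differentiableAt (by simp)).hasFDerivAt
  have hgd := (differentiableAt_chartMetric g y₀).hasFDerivAt
  have hgu : HasDerivAt (fun s => chartMetric g y₀ (u s))
      (fderiv ℝ (chartMetric g y₀) (u t) (deriv u t)) t := 
    HasFDerivAt.comp_hasDerivAt_of_eq (E := F →L[ℝ] F →L[ℝ] ℝ) t hgd hud hut.symm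
  have hκu : HasDerivAt (fun s => κ (u s)) (fderiv ℝ κ (u t) (deriv u t)) t :=
    HasFDerivAt.comp_hasDerivAt t hκd hud
  have hmain := (hgu.clm_apply hudd).clm_apply hκu
  have hkill := lieDerivative_metric_eq_zero (Z := Z) (v := deriv u t)
    (contDiffAt_chartAct (E := E) (G := G) y₀) (eventually_chartAct_one y₀)
    (differentiableAt_chartMetric g y₀)
    (fun v w => by rw [chartMetric_self, metricForm_symm]) (eventually_chartAct_isometry hg y₀ _)
  have hcong : (fun s => metricForm g (x s) (velocity x s) (orbitDeriv E F G (x s) Z)) =ᶠ[𝓝 t]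
      fun s => chartMetric g y₀ (u s) (deriv u s) (κ (u s)) := by
    filter_upwards [hv, hx.continuousAt.eventually
      (eventually_orbitDeriv_chart (E := E) (F := F) (G := G) y₀ Z)] with s hs hs'
    have h1 := chartMetric_mderiv g hs.1 (velocity x s) (orbitDeriv E F G (x s) Z)
    rw [← h1, ← hs.2.deriv, ← hs']
  refine (hmain.congr_of_eventuallyEq hcong).congr_deriv ?_
  have hkos := metricForm_christoffel_self hnabla y₀ (deriv u t) (κ (u t))
  have hcov := covDerivAlong_velocity nabla hx
  have hcov' : (covDerivAlong nabla x (velocity x) t : F) =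
      deriv (deriv u) t + christoffel nabla y₀ (deriv u t) (deriv u t) := by
    rw [huv]; exact hcov
  have hgoal : metricForm g y₀ (covDerivAlong nabla x (velocity x) t) (orbitDeriv E F G y₀ Z) =
      metricForm g y₀ (deriv (deriv u) t + christoffel nabla y₀ (deriv u t) (deriv u t))
        (κ (u t)) := by
    rw [hκt]
    exact congrArg (fun v : F => metricForm g y₀ v (orbitDeriv E F G y₀ Z)) hcov'
  refine Eq.trans ?_ hgoal.symm
  change fderiv ℝ (chartMetric g y₀) (u t) (κ (u t)) (deriv u t) (deriv u t) +
      2 * chartMetric g y₀ (u t) (fderiv ℝ κ (u t) (deriv u t)) (deriv u t) = 0 at hkill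
  have hst : chartMetric g y₀ (u t) = metricForm g y₀ := chartMetric_self g y₀
  rw [hst, metricForm_symm] at hkill
  simp only [map_add, _root_.add_apply, hst, hkos]
  rw [← hut]
  linarith

end Noether

/-! ### Orbit maps, translations and momenta -/

section Orbit

variable {E F : Type*} [NormedAddCommGroup E] [NormedSpace ℝ E]
  [NormedAddCommGroup F] [NormedSpace ℝ F]
  {G : Type*} [TopologicalSpace G] [ChartedSpace E G] [Group G] [LieGroup 𝓘(ℝ, E) ∞ G]
  {M : Type*} [TopologicalSpace M] [ChartedSpace F M] [IsManifold 𝓘(ℝ, F) ∞ M] [MulAction G M]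
  [ContMDiffSMul 𝓘(ℝ, E) 𝓘(ℝ, F) ∞ G M]

variable (F) in
/-- The differential at `y` of the translation by `p`. -/
def transDeriv (p : G) (y : M) : F →L[ℝ] F := mderiv F F (fun z : M => p • z) y

omit [IsManifold 𝓘(ℝ, F) ∞ M] in
/-- The value of a fundamental vector field at `p • y`, transported back to `y`:
`q p y = p (p⁻¹ q p) y`. -/
theorem orbitDeriv_smul (p : G) (y : M) :
    orbitDeriv E F G (p • y) =
      (transDeriv F p y).comp ((orbitDeriv E F G y).comp (Adj E p⁻¹)) := by
  have h1 : (fun q : G => q • p • y) = fun q : G => p • ((p⁻¹ * q * p⁻¹⁻¹) • y) := by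
    ext q
    simp only [smul_smul, inv_inv, ← mul_assoc, mul_inv_cancel, one_mul]
  unfold orbitDeriv transDeriv Adj
  rw [h1, mderiv_comp (f := fun q : G => (p⁻¹ * q * p⁻¹⁻¹) • y) (g := fun z : M => p • z) (y := y)
    (mdifferentiableAt_smul_left E p y)
    (MDifferentiableAt.comp_of_eq (y := (1 : G)) _ (mdifferentiableAt_smul_right 1 y)
      (mdifferentiableAt_conj p⁻¹ 1) (by simp)) (by simp),
    mderiv_comp (f := fun q : G => p⁻¹ * q * p⁻¹⁻¹) (g := fun q : G => q • y) (y := 1)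
      (mdifferentiableAt_smul_right 1 y) (mdifferentiableAt_conj p⁻¹ 1) (by simp)]

theorem transDeriv_comp_inv (E : Type*) [NormedAddCommGroup E] [NormedSpace ℝ E]
    {F : Type*} [NormedAddCommGroup F] [NormedSpace ℝ F]
    {G : Type*} [TopologicalSpace G] [ChartedSpace E G] [Group G]
    {M : Type*} [TopologicalSpace M] [ChartedSpace F M] [MulAction G M]
    [ContMDiffSMul 𝓘(ℝ, E) 𝓘(ℝ, F) ∞ G M] (p : G) (y : M) :
    (transDeriv F p y).comp (transDeriv F p⁻¹ (p • y)) = ContinuousLinearMap.id ℝ F := by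
  unfold transDeriv
  rw [← mderiv_comp (f := fun z : M => p⁻¹ • z) (g := fun z : M => p • z)
    (mdifferentiableAt_smul_left E p y) (mdifferentiableAt_smul_left E p⁻¹ (p • y)) (by simp)]
  simp only [smul_inv_smul]
  exact mderiv_id (p • y)

omit [LieGroup 𝓘(ℝ, E) ∞ G] [IsManifold 𝓘(ℝ, F) ∞ M] in
/-- The velocity of the curve `p(s) • y` in terms of the logarithmic derivative of `p`. -/
theorem HasLogDerivAt.hasVelocityAt_smul {p : ℝ → G} {η : E} {t : ℝ} (h : HasLogDerivAt p η t)
    (y : M) : HasVelocityAt F (fun s => p s • y)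
      (transDeriv F (p t) y (orbitDeriv E F G y η)) t := by
  have h1 : HasVelocityAt E (fun s => (p t)⁻¹ * p s) η t := h
  have h2 := h1.comp (mdifferentiableAt_smul_right (E := E) (F := F) (1 : G) y) (by simp)
  have h3 := h2.comp (mdifferentiableAt_smul_left E (F := F) (p t) y) (by simp)
  simpa [smul_smul, transDeriv, orbitDeriv] using h3

variable (E F G) in
/-- The orbit map of `o` has smooth local sections through every point of `G`. -/
def HasLocalSections (o : M) : Prop :=
  ∀ p : G, ∃ σ : M → G, ContMDiffAt 𝓘(ℝ, F) 𝓘(ℝ, E) ∞ σ (p • o) ∧ σ (p • o) = p ∧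
    ∀ᶠ y in 𝓝 (p • o), σ y • o = y

omit [LieGroup 𝓘(ℝ, E) ∞ G] [IsManifold 𝓘(ℝ, F) ∞ M] in
theorem HasLocalSections.orbitDeriv_surjective {o : M} (h : HasLocalSections E F G o) :
    Function.Surjective (orbitDeriv E F G o) := by
  obtain ⟨σ, h1, h2, h3⟩ := h 1
  rw [one_smul] at h1 h2 h3
  have h4 := mderiv_comp (f := σ) (g := fun q : G => q • o) (y := 1)
    (mdifferentiableAt_smul_right (E := E) (F := F) 1 o) (h1.mdifferentiableAt (by simp)) h2
  have h5 : mderiv F F (fun z => σ z • o) o = ContinuousLinearMap.id ℝ F :=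
    (mderiv_congr h3).trans (mderiv_id o)
  intro v
  exact ⟨mderiv F E σ o v, congrArg (fun L : F →L[ℝ] F => L v) (h4.symm.trans h5)⟩

variable (E G) in
/-- The momentum at `y` of a tangent vector `v`: the functional `Z ↦ g(v, K_Z)` on the Lie algebra,
where `K_Z` is the fundamental vector field of `Z`. -/
def momentum (g : SmoothMetric F M) (y : M) : F →L[ℝ] E →L[ℝ] ℝ :=
  ((ContinuousLinearMap.compL ℝ E F ℝ).flip (orbitDeriv E F G y)).comp (metricForm g y)

omit [LieGroup 𝓘(ℝ, E) ∞ G] [ContMDiffSMul 𝓘(ℝ, E) 𝓘(ℝ, F) ∞ G M] in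
theorem momentum_apply (g : SmoothMetric F M) (y : M) (v : F) (Z : E) :
    momentum E G g y v Z = metricForm g y v (orbitDeriv E F G y Z) := rfl

omit [TopologicalSpace G] in
theorem metricForm_transDeriv {g : SmoothMetric F M} (hg : IsInvariantMetric G g) (p : G) (y : M)
    (u v : F) :
    metricForm g (p • y) (transDeriv F p y u) (transDeriv F p y v) = metricForm g y u v :=
  hg p y u v

theorem momentum_smul {g : SmoothMetric F M} (hg : IsInvariantMetric G g) (p : G) (y : M) (v : F) :
    momentum E G g (p • y) (transDeriv F p y v) = (momentum E G g y v).comp (Adj E p⁻¹) := by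
  ext Z
  rw [momentum_apply, orbitDeriv_smul]
  exact metricForm_transDeriv hg p y v _

omit [LieGroup 𝓘(ℝ, E) ∞ G] in
/-- The fundamental vector fields span the tangent space, so a tangent vector is determined by its
momentum. -/
theorem HasLocalSections.momentum_injective {o : M} (h : HasLocalSections E F G o)
    (g : SmoothMetric F M) : Function.Injective (momentum E G g o) := by
  rw [injective_iff_map_eq_zero]
  intro v hv
  by_contra hne
  obtain ⟨Z, hZ⟩ := h.orbitDeriv_surjective v
  have h1 := congrArg (fun L : E →L[ℝ] ℝ => L Z) hv
  change momentum E G g o v Z = 0 at h1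
  rw [momentum_apply, hZ] at h1
  exact (metricForm_pos g o v hne).ne' h1

theorem HasLocalSections.momentum_smul_injective {o : M} (h : HasLocalSections E F G o)
    {g : SmoothMetric F M} (hg : IsInvariantMetric G g) (p : G) :
    Function.Injective (momentum E G g (p • o)) := by
  rw [injective_iff_map_eq_zero]
  intro v hv
  have hv' : v = transDeriv F p o (transDeriv F p⁻¹ (p • o) v) :=
    (congrArg (fun L : F →L[ℝ] F => L v) (transDeriv_comp_inv E p o)).symm
  rw [hv', momentum_smul hg] at hv
  have h1 : momentum E G g o (transDeriv F p⁻¹ (p • o) v) = 0 := by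
    ext Z
    have h2 := congrArg (fun L : E →L[ℝ] ℝ => L (Adj E p Z)) hv
    simpa [Adj_inv_apply] using h2
  rw [hv', (h.momentum_injective g).eq_iff' (map_zero _) |>.1 h1, map_zero]

end Orbit

/-! ### The equation of motion for position and momentum -/

theorem hasDerivAt_of_clm_apply {V W : Type*} [NormedAddCommGroup V] [NormedSpace ℝ V]
    [FiniteDimensional ℝ V] [NormedAddCommGroup W] [NormedSpace ℝ W] {f : ℝ → V →L[ℝ] W}
    {f' : V →L[ℝ] W} {t : ℝ} (h : ∀ v, HasDerivAt (fun s => f s v) (f' v) t) :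
    HasDerivAt f f' t := by
  have hd := (differentiableAt_of_clm_apply fun v => (h v).differentiableAt).hasDerivAt
  refine hd.congr_deriv (ContinuousLinearMap.ext fun v => ?_)
  have h1 := hd.clm_apply (hasDerivAt_const t v)
  simpa using h1.unique (h v)

section Uniqueness

variable {E F : Type*} [NormedAddCommGroup E] [NormedSpace ℝ E]
  [NormedAddCommGroup F] [NormedSpace ℝ F]
  {G : Type*} [TopologicalSpace G] [ChartedSpace E G] [Group G] [LieGroup 𝓘(ℝ, E) ∞ G]
  {M : Type*} [TopologicalSpace M] [ChartedSpace F M] [IsManifold 𝓘(ℝ, F) ∞ M] [MulAction G M]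
  [ContMDiffSMul 𝓘(ℝ, E) 𝓘(ℝ, F) ∞ G M]

/-- The map `(a, ζ) ↦ σ(a) ζ • o`, read in the charts at `y₀` and at the identity; its derivative in
`ζ` parametrizes the tangent spaces near `y₀` by the Lie algebra. -/
def chartFrame (o y₀ : M) (σ : M → G) (c : F × E) : F :=
  extChartAt 𝓘(ℝ, F) y₀ ((σ ((extChartAt 𝓘(ℝ, F) y₀).symm c.1) *
    (extChartAt 𝓘(ℝ, E) (1 : G)).symm c.2) • o)

theorem contDiffAt_chartFrame {o y₀ : M} {σ : M → G}
    (hσ : ContMDiffAt 𝓘(ℝ, F) 𝓘(ℝ, E) ∞ σ y₀) (hσo : σ y₀ • o = y₀) :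
    ContDiffAt ℝ ∞ (chartFrame o y₀ σ)
      (extChartAt 𝓘(ℝ, F) y₀ y₀, extChartAt 𝓘(ℝ, E) (1 : G) 1) := by
  rw [← contMDiffAt_iff_contDiffAt]
  set c₀ : F × E := (extChartAt 𝓘(ℝ, F) y₀ y₀, extChartAt 𝓘(ℝ, E) (1 : G) 1) with hc₀
  have hf : ContMDiffAt 𝓘(ℝ, F × E) 𝓘(ℝ, F) ∞
      (fun c : F × E => (extChartAt 𝓘(ℝ, F) y₀).symm c.1) c₀ :=
    (contMDiffAt_extChartAt_symm_of_mem (mem_extChartAt_target y₀)).comp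
      c₀ contDiff_fst.contMDiff.contMDiffAt
  have hg : ContMDiffAt 𝓘(ℝ, F × E) 𝓘(ℝ, E) ∞
      (fun c : F × E => (extChartAt 𝓘(ℝ, E) (1 : G)).symm c.2) c₀ :=
    (contMDiffAt_extChartAt_symm_of_mem (mem_extChartAt_target (1 : G))).comp
      c₀ contDiff_snd.contMDiff.contMDiffAt
  have h1 : (extChartAt 𝓘(ℝ, F) y₀).symm c₀.1 = y₀ := by simp [hc₀]
  have hσf : ContMDiffAt 𝓘(ℝ, F × E) 𝓘(ℝ, E) ∞
      (fun c : F × E => σ ((extChartAt 𝓘(ℝ, F) y₀).symm c.1)) c₀ :=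
    ContMDiffAt.comp_of_eq hσ hf h1
  have hm : ContMDiffAt 𝓘(ℝ, F × E) 𝓘(ℝ, F) ∞ (fun c : F × E =>
      (σ ((extChartAt 𝓘(ℝ, F) y₀).symm c.1) *
        (extChartAt 𝓘(ℝ, E) (1 : G)).symm c.2) • o) c₀ :=
    (contMDiff_smul (I := 𝓘(ℝ, E)) (I' := 𝓘(ℝ, F)) (n := ∞) (G := G) (M := M)).contMDiffAt.comp
      c₀ ((hσf.mul hg).prodMk contMDiffAt_const)
  refine ContMDiffAt.comp _ (contMDiffAt_extChartAt_of_mem ?_) hm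
  simp [hc₀, hσo]

theorem eventually_fderiv_chartFrame {o y₀ : M} {σ : M → G}
    (hσ : ContMDiffAt 𝓘(ℝ, F) 𝓘(ℝ, E) ∞ σ y₀) (hσo : ∀ᶠ y in 𝓝 y₀, σ y • o = y) :
    ∀ᶠ y in 𝓝 y₀, ∀ Z : E, fderiv ℝ (chartFrame o y₀ σ)
      (extChartAt 𝓘(ℝ, F) y₀ y, extChartAt 𝓘(ℝ, E) (1 : G) 1) (0, Z) =
      mderiv F F (extChartAt 𝓘(ℝ, F) y₀) y
        (transDeriv F (σ y) o (orbitDeriv E F G o Z)) := by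
  have hc : Filter.Tendsto (fun y : M => (extChartAt 𝓘(ℝ, F) y₀ y, extChartAt 𝓘(ℝ, E) (1 : G) 1))
      (𝓝 y₀) (𝓝 (extChartAt 𝓘(ℝ, F) y₀ y₀, extChartAt 𝓘(ℝ, E) (1 : G) 1)) :=
    (continuousAt_extChartAt y₀).prodMk_nhds tendsto_const_nhds
  have hd := ((contDiffAt_chartFrame hσ hσo.self_of_nhds).of_le
    (show (1 : ℕ∞ω) ≤ ∞ by simp)).eventually (by simp)
  filter_upwards [hc.eventually hd, eventually_mem_source (E := F) y₀, hσo] with y hd hy hyo Z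
  set e₀ := extChartAt 𝓘(ℝ, E) (1 : G) 1 with he₀
  have h1 := (HasFDerivAt.comp (f := fun ζ : E => (extChartAt 𝓘(ℝ, F) y₀ y, ζ)) e₀
    (hd.differentiableAt (by simp)).hasFDerivAt
    (hasFDerivAt_prodMk_right (extChartAt 𝓘(ℝ, F) y₀ y) e₀)).fderiv
  have h0 := (contMDiffAt_extChartAt_symm_of_mem (E := E)
    (mem_extChartAt_target (I := 𝓘(ℝ, E)) (1 : G))).mdifferentiableAt (by simp)
  have hsymm : (extChartAt 𝓘(ℝ, E) (1 : G)).symm e₀ = 1 := by simp [he₀]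
  have h2 : (fun ζ : E => chartFrame o y₀ σ (extChartAt 𝓘(ℝ, F) y₀ y, ζ)) = fun ζ : E =>
      extChartAt 𝓘(ℝ, F) y₀ (σ y • ((extChartAt 𝓘(ℝ, E) (1 : G)).symm ζ • o)) := by
    ext ζ
    simp only [chartFrame, (extChartAt 𝓘(ℝ, F) y₀).left_inv hy, mul_smul]
  have hd1 : MDifferentiableAt 𝓘(ℝ, E) 𝓘(ℝ, F)
      (fun ζ : E => (extChartAt 𝓘(ℝ, E) (1 : G)).symm ζ • o) e₀ :=
    MDifferentiableAt.comp_of_eq _ (mdifferentiableAt_smul_right 1 o) h0 hsymm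
  have hd2 : MDifferentiableAt 𝓘(ℝ, E) 𝓘(ℝ, F)
      (fun ζ : E => σ y • ((extChartAt 𝓘(ℝ, E) (1 : G)).symm ζ • o)) e₀ :=
    MDifferentiableAt.comp_of_eq (y := o) _ (mdifferentiableAt_smul_left E (σ y) o) hd1
      (by rw [hsymm, one_smul])
  have h4 : fderiv ℝ (fun ζ : E => chartFrame o y₀ σ (extChartAt 𝓘(ℝ, F) y₀ y, ζ)) e₀ =
      (mderiv F F (extChartAt 𝓘(ℝ, F) y₀) y).comp
        ((transDeriv F (σ y) o).comp (orbitDeriv E F G o)) := by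
    rw [h2, ← mderiv_eq_fderiv,
      mderiv_comp (f := fun ζ => σ y • ((extChartAt 𝓘(ℝ, E) (1 : G)).symm ζ • o)) (y := y)
        ((contMDiffAt_extChartAt_of_mem hy).mdifferentiableAt (by simp)) hd2
        (by rw [hsymm, one_smul, hyo]),
      mderiv_comp (f := fun ζ => (extChartAt 𝓘(ℝ, E) (1 : G)).symm ζ • o)
        (g := fun z : M => σ y • z) (y := o) (mdifferentiableAt_smul_left E (σ y) o) hd1
        (by rw [hsymm, one_smul]),
      mderiv_comp (g := fun q : G => q • o) (mdifferentiableAt_smul_right 1 o) h0 hsymm,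
      mderiv_extChartAt_symm_self, ContinuousLinearMap.comp_id]
    rfl
  have h5 := congrArg (fun L : E →L[ℝ] F => L Z) (h1.symm.trans h4)
  simpa using h5

/-- The vector field on (chart of `M`) × (dual of the Lie algebra) that governs the position and the
momentum of a charged particle. Here `σ` is a local section of the orbit map of `o`, the linear map
`ρ` recovers a tangent vector at `o` from its momentum, `r` is a right inverse of the differential
of the orbit map, and `T` is the force at `o`. -/
def chargedField (g : SmoothMetric F M) (T : F →L[ℝ] F) (o y₀ : M) (σ : M → G)
    (ρ : (E →L[ℝ] ℝ) →L[ℝ] F) (r : F →L[ℝ] E) (c : F × (E →L[ℝ] ℝ)) : F × (E →L[ℝ] ℝ) :=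
  (fderiv ℝ (chartFrame o y₀ σ) (c.1, extChartAt 𝓘(ℝ, E) (1 : G) 1)
    (0, r (ρ (c.2.comp (Adj E (σ ((extChartAt 𝓘(ℝ, F) y₀).symm c.1)))))),
  (momentum E G g o (T (ρ (c.2.comp (Adj E (σ ((extChartAt 𝓘(ℝ, F) y₀).symm c.1))))))).comp
    (Adj E (σ ((extChartAt 𝓘(ℝ, F) y₀).symm c.1))⁻¹))

theorem contDiffAt_chargedField [CompleteSpace E] (g : SmoothMetric F M) (T : F →L[ℝ] F) {o y₀ : M}
    {σ : M → G} (hσ : ContMDiffAt 𝓘(ℝ, F) 𝓘(ℝ, E) ∞ σ y₀) (hσo : σ y₀ • o = y₀)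
    (ρ : (E →L[ℝ] ℝ) →L[ℝ] F) (r : F →L[ℝ] E) (P : E →L[ℝ] ℝ) :
    ContDiffAt ℝ ∞ (chargedField g T o y₀ σ ρ r) (extChartAt 𝓘(ℝ, F) y₀ y₀, P) := by
  set c₀ : F × (E →L[ℝ] ℝ) := (extChartAt 𝓘(ℝ, F) y₀ y₀, P) with hc₀
  have hq : ContMDiffAt 𝓘(ℝ, F × (E →L[ℝ] ℝ)) 𝓘(ℝ, E) ∞
      (fun c : F × (E →L[ℝ] ℝ) => σ ((extChartAt 𝓘(ℝ, F) y₀).symm c.1)) c₀ := by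
    refine ContMDiffAt.comp_of_eq (y := y₀) hσ ?_ (by simp [hc₀])
    exact (contMDiffAt_extChartAt_symm_of_mem (mem_extChartAt_target y₀)).comp
      c₀ contDiff_fst.contMDiff.contMDiffAt
  have hA : ContDiffAt ℝ ∞ (fun c : F × (E →L[ℝ] ℝ) =>
      Adj E (σ ((extChartAt 𝓘(ℝ, F) y₀).symm c.1))) c₀ := by
    rw [← contMDiffAt_iff_contDiffAt]
    exact contMDiff_Adj.contMDiffAt.comp c₀ hq
  have hA' : ContDiffAt ℝ ∞ (fun c : F × (E →L[ℝ] ℝ) =>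
      Adj E (σ ((extChartAt 𝓘(ℝ, F) y₀).symm c.1))⁻¹) c₀ := by
    rw [← contMDiffAt_iff_contDiffAt]
    exact contMDiff_Adj.contMDiffAt.comp c₀ hq.inv
  have hξ : ContDiffAt ℝ ∞ (fun c : F × (E →L[ℝ] ℝ) =>
      ρ (c.2.comp (Adj E (σ ((extChartAt 𝓘(ℝ, F) y₀).symm c.1))))) c₀ :=
    ρ.contDiff.contDiffAt.comp c₀ (contDiffAt_snd.clm_comp hA)
  have hm : ContDiffAt ℝ ∞ (fun c : F × (E →L[ℝ] ℝ) =>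
      fderiv ℝ (chartFrame o y₀ σ) (c.1, extChartAt 𝓘(ℝ, E) (1 : G) 1)) c₀ :=
    ContDiffAt.comp (f := fun c : F × (E →L[ℝ] ℝ) => (c.1, extChartAt 𝓘(ℝ, E) (1 : G) 1)) c₀
      ((contDiffAt_chartFrame hσ hσo).fderiv_right (m := ∞) (by simp)) (by fun_prop)
  refine ContDiffAt.prodMk ?_ ?_
  · exact hm.clm_apply (contDiffAt_const.prodMk (r.contDiff.contDiffAt.comp c₀ hξ))
  · exact (((momentum E G g o).comp T).contDiff.contDiffAt.comp c₀ hξ).clm_comp hA'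

variable (F) in
/-- The velocity of a curve, as an element of the model space. -/
def vel (x : ℝ → M) (t : ℝ) : F := velocity x t

omit [IsManifold 𝓘(ℝ, F) ∞ M] in
theorem HasVelocityAt.vel_eq {x : ℝ → M} {v : F} {t : ℝ} (h : HasVelocityAt F x v t) :
    vel F x t = v := h.velocity_eq

/-- A tensor field of type `(1,1)`, as a family of endomorphisms of the model space. -/
def tensorForm (A : ∀ y : M, TangentSpace 𝓘(ℝ, F) y →L[ℝ] TangentSpace 𝓘(ℝ, F) y) (y : M) :
    F →L[ℝ] F := A y

omit [IsManifold 𝓘(ℝ, F) ∞ M] in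
omit [TopologicalSpace G] in
theorem tensorForm_transDeriv
    {A : ∀ y : M, TangentSpace 𝓘(ℝ, F) y →L[ℝ] TangentSpace 𝓘(ℝ, F) y}
    (hA : IsInvariantTensor G A) (p : G) (y : M) (u : F) :
    tensorForm A (p • y) (transDeriv F p y u) = transDeriv F p y (tensorForm A y u) :=
  hA p y u

/-- Noether's theorem for all fundamental vector fields at once. -/
theorem hasDerivAt_momentum_clm [FiniteDimensional ℝ E] [FiniteDimensional ℝ F]
    {g : SmoothMetric F M} {nabla : Connection F M}
    (hnabla : IsLeviCivita g nabla) (hg : IsInvariantMetric G g) {x : ℝ → M} {t : ℝ}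
    (hx : ContMDiffAt 𝓘(ℝ, ℝ) 𝓘(ℝ, F) 2 x t) :
    HasDerivAt (fun s => momentum E G g (x s) (vel F x s))
      (momentum E G g (x t) (covDerivAlong nabla x (velocity x) t)) t :=
  hasDerivAt_of_clm_apply fun Z => hasDerivAt_momentum hnabla hg hx Z

/-- Position and momentum of a charged particle satisfy an ordinary differential equation of first
order near each time. -/
theorem eventually_hasDerivAt_position_momentum [FiniteDimensional ℝ E] [FiniteDimensional ℝ F]
    {g : SmoothMetric F M} {nabla : Connection F M}
    (hnabla : IsLeviCivita g nabla) (hg : IsInvariantMetric G g)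
    {A : ∀ y : M, TangentSpace 𝓘(ℝ, F) y →L[ℝ] TangentSpace 𝓘(ℝ, F) y}
    (hA : IsInvariantTensor G A) (k : ℝ) {o y₀ : M} {σ : M → G}
    (hσ : ContMDiffAt 𝓘(ℝ, F) 𝓘(ℝ, E) ∞ σ y₀) (hσo : ∀ᶠ y in 𝓝 y₀, σ y • o = y)
    {ρ : (E →L[ℝ] ℝ) →L[ℝ] F} (hρ : ∀ v, ρ (momentum E G g o v) = v)
    {r : F →L[ℝ] E} (hr : ∀ v, orbitDeriv E F G o (r v) = v)
    {x : ℝ → M} {t₀ : ℝ} (hx₀ : x t₀ = y₀)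
    (hx : ∀ᶠ t in 𝓝 t₀, ContMDiffAt 𝓘(ℝ, ℝ) 𝓘(ℝ, F) 2 x t ∧
      covDerivAlong nabla x (velocity x) t = k • A (x t) (velocity x t)) :
    ∀ᶠ t in 𝓝 t₀, HasDerivAt
      (fun s => (extChartAt 𝓘(ℝ, F) y₀ (x s), momentum E G g (x s) (vel F x s)))
      (chargedField g (k • tensorForm A o) o y₀ σ ρ r
        (extChartAt 𝓘(ℝ, F) y₀ (x t), momentum E G g (x t) (vel F x t))) t := by
  have hxc : Filter.Tendsto x (𝓝 t₀) (𝓝 y₀) := hx₀ ▸ hx.self_of_nhds.1.continuousAt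
  filter_upwards [hx, hxc.eventually (eventually_fderiv_chartFrame hσ hσo), hxc.eventually hσo,
    hxc.eventually (eventually_mem_source (E := F) y₀)] with t ht hframe hto hts
  have hv : HasVelocityAt F x (vel F x t) t :=
    (ht.1.mdifferentiableAt (by simp)).hasVelocityAt
  set q := σ (x t) with hq
  obtain ⟨ξ, hξ⟩ : ∃ ξ : F, vel F x t = transDeriv F q o ξ := by
    refine ⟨transDeriv F q⁻¹ (q • o) (vel F x t), ?_⟩
    exact (congrArg (fun L : F →L[ℝ] F => L (vel F x t)) (transDeriv_comp_inv E q o)).symm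
  have hmom : momentum E G g (x t) (vel F x t) = (momentum E G g o ξ).comp (Adj E q⁻¹) := by
    rw [hξ, ← momentum_smul hg, hto]
  have hrec : ρ ((momentum E G g (x t) (vel F x t)).comp (Adj E q)) = ξ := by
    rw [hmom, ContinuousLinearMap.comp_assoc, Adj_inv_comp, ContinuousLinearMap.comp_id, hρ]
  have hsymm : (extChartAt 𝓘(ℝ, F) y₀).symm (extChartAt 𝓘(ℝ, F) y₀ (x t)) = x t :=
    (extChartAt 𝓘(ℝ, F) y₀).left_inv hts
  have h1 : HasDerivAt (fun s => extChartAt 𝓘(ℝ, F) y₀ (x s))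
      (mderiv F F (extChartAt 𝓘(ℝ, F) y₀) (x t) (vel F x t)) t := by
    rw [← hasVelocityAt_iff_hasDerivAt]
    exact hv.comp ((contMDiffAt_extChartAt_of_mem hts).mdifferentiableAt (by simp)) rfl
  have h2 := hasDerivAt_momentum_clm (E := E) hnabla hg ht.1
  have h3 : momentum E G g (x t) (covDerivAlong nabla x (velocity x) t) =
      (momentum E G g o ((k • tensorForm A o) ξ)).comp (Adj E q⁻¹) := by
    have h4 : (covDerivAlong nabla x (velocity x) t : F) = k • tensorForm A (x t) (vel F x t) :=
      ht.2
    have h5 : tensorForm A (x t) (vel F x t) = transDeriv F q o (tensorForm A o ξ) := by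
      rw [hξ, ← tensorForm_transDeriv hA, hto]
    refine (congrArg (momentum E G g (x t)) (h4.trans (congrArg (fun v : F => k • v) h5))).trans ?_
    rw [map_smul, ← hto, momentum_smul hg]
    simp
  have h6 : chargedField g (k • tensorForm A o) o y₀ σ ρ r
        (extChartAt 𝓘(ℝ, F) y₀ (x t), momentum E G g (x t) (vel F x t)) =
      (mderiv F F (extChartAt 𝓘(ℝ, F) y₀) (x t) (vel F x t),
        momentum E G g (x t) (covDerivAlong nabla x (velocity x) t)) := by
    unfold chargedField
    simp only [hsymm, ← hq, hrec, hframe, hr, h3, ← hξ]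
  rw [h6]
  exact h1.prodMk h2

/-- Local uniqueness: position and momentum at one time determine the motion near that time. -/
theorem eventuallyEq_of_charged [FiniteDimensional ℝ E] [FiniteDimensional ℝ F]
    {g : SmoothMetric F M} {nabla : Connection F M}
    (hnabla : IsLeviCivita g nabla) (hg : IsInvariantMetric G g)
    {A : ∀ y : M, TangentSpace 𝓘(ℝ, F) y →L[ℝ] TangentSpace 𝓘(ℝ, F) y}
    (hA : IsInvariantTensor G A) (k : ℝ) {o : M} (ho : HasLocalSections E F G o)
    (htrans : ∀ y : M, ∃ p : G, p • o = y)
    {x x' : ℝ → M} {t₀ : ℝ}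
    (hx : ∀ᶠ t in 𝓝 t₀, ContMDiffAt 𝓘(ℝ, ℝ) 𝓘(ℝ, F) 2 x t ∧
      covDerivAlong nabla x (velocity x) t = k • A (x t) (velocity x t))
    (hx' : ∀ᶠ t in 𝓝 t₀, ContMDiffAt 𝓘(ℝ, ℝ) 𝓘(ℝ, F) 2 x' t ∧
      covDerivAlong nabla x' (velocity x') t = k • A (x' t) (velocity x' t))
    (h0 : x t₀ = x' t₀)
    (h1 : momentum E G g (x t₀) (vel F x t₀) = momentum E G g (x' t₀) (vel F x' t₀)) :
    ∀ᶠ t in 𝓝 t₀, x t = x' t ∧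
      momentum E G g (x t) (vel F x t) = momentum E G g (x' t) (vel F x' t) := by
  have : CompleteSpace E := FiniteDimensional.complete ℝ E
  obtain ⟨p, hp⟩ := htrans (x t₀)
  obtain ⟨σ, hσ, hσp, hσo⟩ := ho p
  rw [hp] at hσ hσp hσo
  obtain ⟨ρ, hρ⟩ := LinearMap.exists_leftInverse_of_injective (momentum E G g o : F →ₗ[ℝ] E →L[ℝ] ℝ)
    (LinearMap.ker_eq_bot.2 (ho.momentum_injective g))
  obtain ⟨r, hr⟩ := LinearMap.exists_rightInverse_of_surjective
    (orbitDeriv E F G o : E →ₗ[ℝ] F) (LinearMap.range_eq_top.2 ho.orbitDeriv_surjective)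
  have hρ' : ∀ v, LinearMap.toContinuousLinearMap ρ (momentum E G g o v) = v :=
    fun v => LinearMap.congr_fun hρ v
  have hr' : ∀ v, orbitDeriv E F G o (LinearMap.toContinuousLinearMap r v) = v :=
    fun v => LinearMap.congr_fun hr v
  obtain ⟨K, s, hs, hK⟩ := ((contDiffAt_chargedField g (k • tensorForm A o) hσ hσo.self_of_nhds
    (LinearMap.toContinuousLinearMap ρ) (LinearMap.toContinuousLinearMap r)
    (momentum E G g (x t₀) (vel F x t₀))).of_le
      (show (1 : ℕ∞ω) ≤ ∞ by simp)).exists_lipschitzOnWith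
  have e1 := eventually_hasDerivAt_position_momentum hnabla hg hA k hσ hσo hρ' hr' rfl hx
  have e2 := eventually_hasDerivAt_position_momentum hnabla hg hA k hσ hσo hρ' hr' h0.symm hx'
  have h01 : (extChartAt 𝓘(ℝ, F) (x t₀) (x' t₀), momentum E G g (x' t₀) (vel F x' t₀)) =
      (extChartAt 𝓘(ℝ, F) (x t₀) (x t₀), momentum E G g (x t₀) (vel F x t₀)) := by
    rw [h1, ← h0]
  have m1 := e1.self_of_nhds.continuousAt.eventually_mem hs
  have m2 := e2.self_of_nhds.continuousAt.eventually_mem (h01.symm ▸ hs)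
  have hu := ODE_solution_unique_of_eventually (v := fun _ => chargedField g (k • tensorForm A o) o
    (x t₀) σ (LinearMap.toContinuousLinearMap ρ) (LinearMap.toContinuousLinearMap r))
    (s := fun _ => s) (Filter.Eventually.of_forall fun _ => hK) (e1.and m1) (e2.and m2) h01.symm
  have c1 : Filter.Tendsto x (𝓝 t₀) (𝓝 (x t₀)) := hx.self_of_nhds.1.continuousAt
  have c2 : Filter.Tendsto x' (𝓝 t₀) (𝓝 (x t₀)) := h0 ▸ hx'.self_of_nhds.1.continuousAt
  filter_upwards [hu, c1.eventually (eventually_mem_source (E := F) (x t₀)),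
    c2.eventually (eventually_mem_source (E := F) (x t₀))] with t ht ht1 ht2
  have ht' := Prod.ext_iff.1 ht
  exact ⟨(extChartAt 𝓘(ℝ, F) (x t₀)).injOn ht1 ht2 ht'.1, ht'.2⟩

/-- Uniqueness of the motion of a charged particle on an interval, for an electromagnetic field that
is invariant under a transitive group of isometries. -/
theorem eqOn_of_charged [FiniteDimensional ℝ E] [FiniteDimensional ℝ F] [T2Space M]
    {g : SmoothMetric F M} {nabla : Connection F M}
    (hnabla : IsLeviCivita g nabla) (hg : IsInvariantMetric G g)
    {A : ∀ y : M, TangentSpace 𝓘(ℝ, F) y →L[ℝ] TangentSpace 𝓘(ℝ, F) y}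
    (hA : IsInvariantTensor G A) {k : ℝ} {o : M} (ho : HasLocalSections E F G o)
    (htrans : ∀ y : M, ∃ p : G, p • o = y)
    {x x' : ℝ → M} {J : Set ℝ} (hJ : IsOpen J) (hJc : J.OrdConnected)
    (hx : IsChargedMotionOn nabla A k J x) (hx' : IsChargedMotionOn nabla A k J x')
    {t₀ : ℝ} (ht₀ : t₀ ∈ J) (h0 : x t₀ = x' t₀) (h1 : vel F x t₀ = vel F x' t₀) :
    EqOn x x' J := by
  have key : ∀ {y : ℝ → M}, IsChargedMotionOn nabla A k J y → ∀ t ∈ J,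
      ∀ᶠ s in 𝓝 t, ContMDiffAt 𝓘(ℝ, ℝ) 𝓘(ℝ, F) 2 y s ∧
        covDerivAlong nabla y (velocity y) s = k • A (y s) (velocity y s) := by
    intro y hy t ht
    filter_upwards [hJ.mem_nhds ht] with s hs
    exact ⟨hy.1.contMDiffAt (hJ.mem_nhds hs), hy.2 s hs⟩
  have hcm : ∀ {y : ℝ → M}, IsChargedMotionOn nabla A k J y → ∀ t ∈ J,
      ContinuousAt (fun s => momentum E G g (y s) (vel F y s)) t := fun hy t ht =>
    (hasDerivAt_momentum_clm hnabla hg (key hy t ht).self_of_nhds.1).continuousAt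
  set S : Set ℝ := {t | t ∈ J ∧ x t = x' t ∧
    momentum E G g (x t) (vel F x t) = momentum E G g (x' t) (vel F x' t)} with hS
  have hSo : IsOpen S := by
    rw [isOpen_iff_mem_nhds]
    rintro t ⟨ht, h2, h3⟩
    filter_upwards [hJ.mem_nhds ht, eventuallyEq_of_charged hnabla hg hA k ho htrans
      (key hx t ht) (key hx' t ht) h2 h3] with s hs hs'
    exact ⟨hs, hs'⟩
  have hsub : J ⊆ S := by
    refine hJc.isPreconnected.subset_of_closure_inter_subset hSo ⟨t₀, ht₀, ht₀, h0, ?_⟩ ?_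
    · rw [h0, h1]
    · rintro t ⟨htS, htJ⟩
      have hne : (𝓝[S] t).NeBot := mem_closure_iff_nhdsWithin_neBot.1 htS
      have hmem : ∀ᶠ s in 𝓝[S] t, s ∈ S := self_mem_nhdsWithin
      refine ⟨htJ, ?_, ?_⟩
      · have c1 : Filter.Tendsto x (𝓝[S] t) (𝓝 (x t)) :=
          (key hx t htJ).self_of_nhds.1.continuousAt.mono_left nhdsWithin_le_nhds
        have c2 : Filter.Tendsto x' (𝓝[S] t) (𝓝 (x' t)) :=
          (key hx' t htJ).self_of_nhds.1.continuousAt.mono_left nhdsWithin_le_nhds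
        exact tendsto_nhds_unique_of_eventuallyEq c1 c2 (hmem.mono fun s hs => hs.2.1)
      · have c1 := (hcm hx t htJ).tendsto.mono_left (nhdsWithin_le_nhds (s := S))
        have c2 := (hcm hx' t htJ).tendsto.mono_left (nhdsWithin_le_nhds (s := S))
        exact tendsto_nhds_unique_of_eventuallyEq c1 c2 (hmem.mono fun s hs => hs.2.2)
  exact fun t ht => (hsub ht).2.1

end Uniqueness

/-! ### The motion generated by two exponentials -/

section Existence

variable {E F : Type*} [NormedAddCommGroup E] [NormedSpace ℝ E] [FiniteDimensional ℝ E]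
  [NormedAddCommGroup F] [NormedSpace ℝ F] [FiniteDimensional ℝ F]
  {G : Type*} [TopologicalSpace G] [ChartedSpace E G] [Group G] [LieGroup 𝓘(ℝ, E) ∞ G]
  {M : Type*} [TopologicalSpace M] [ChartedSpace F M] [IsManifold 𝓘(ℝ, F) ∞ M] [MulAction G M]
  [ContMDiffSMul 𝓘(ℝ, E) 𝓘(ℝ, F) ∞ G M]

/-- The curve `p(t) • o` is a motion of a charged particle as soon as its momentum changes at the
rate that the electromagnetic force prescribes: a transitive group has enough Killing fields to
detect the acceleration. -/
theorem isChargedMotionOn_smul {g : SmoothMetric F M} {nabla : Connection F M}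
    (hnabla : IsLeviCivita g nabla) (hg : IsInvariantMetric G g)
    {A : ∀ y : M, TangentSpace 𝓘(ℝ, F) y →L[ℝ] TangentSpace 𝓘(ℝ, F) y}
    (hA : IsInvariantTensor G A) {k : ℝ} {o : M} (ho : HasLocalSections E F G o)
    {p : ℝ → G} (hp : ContMDiff 𝓘(ℝ, ℝ) 𝓘(ℝ, E) 2 p) {η : ℝ → E}
    (hη : ∀ t, HasLogDerivAt p (η t) t)
    (h : ∀ t Z, HasDerivAt (fun s => metricForm g o (orbitDeriv E F G o (η s))
        (orbitDeriv E F G o (Adj E (p s)⁻¹ Z)))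
      (k * metricForm g o (tensorForm A o (orbitDeriv E F G o (η t)))
        (orbitDeriv E F G o (Adj E (p t)⁻¹ Z))) t) :
    IsChargedMotionOn nabla A k univ (fun t => p t • o) := by
  have hC : ContMDiff 𝓘(ℝ, ℝ) 𝓘(ℝ, F) 2 (fun t => p t • o) :=
    ((contMDiff_smul (I := 𝓘(ℝ, E)) (I' := 𝓘(ℝ, F)) (n := ∞) (G := G) (M := M)).of_le
      ENat.LEInfty.out).comp (hp.prodMk contMDiff_const)
  refine ⟨hC.contMDiffOn, fun t _ => ?_⟩
  have hvel : ∀ s, vel F (fun t => p t • o) s =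
      transDeriv F (p s) o (orbitDeriv E F G o (η s)) := fun s =>
    ((hη s).hasVelocityAt_smul o).vel_eq
  have hmom : ∀ s (Z : E), momentum E G g (p s • o) (vel F (fun t => p t • o) s) Z =
      metricForm g o (orbitDeriv E F G o (η s)) (orbitDeriv E F G o (Adj E (p s)⁻¹ Z)) := by
    intro s Z
    rw [hvel, momentum_smul hg]
    rfl
  have h1 := hasDerivAt_momentum_clm (E := E) (G := G) hnabla hg (hC.contMDiffAt (x := t))
  refine ho.momentum_smul_injective hg (p t) (ContinuousLinearMap.ext fun Z => ?_)
  have h2 := h1.clm_apply (hasDerivAt_const t Z)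
  have h3 := h t Z
  simp only [hmom] at h2
  have h4 := h2.unique h3
  simp only [map_zero, add_zero] at h4
  have h5 : (k • A (p t • o) (velocity (fun t => p t • o) t) : F) =
      transDeriv F (p t) o (k • tensorForm A o (orbitDeriv E F G o (η t))) := by
    have h6 : tensorForm A (p t • o) (vel F (fun t => p t • o) t) =
        transDeriv F (p t) o (tensorForm A o (orbitDeriv E F G o (η t))) := by
      rw [hvel, tensorForm_transDeriv hA]
    rw [map_smul]
    exact congrArg (fun v : F => k • v) h6
  refine h4.trans (Eq.symm ?_)
  refine (congrArg (fun v : F => momentum E G g (p t • o) v Z) h5).trans ?_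
  rw [momentum_smul hg]
  simp only [map_smul]
  rfl

variable [T2Space G]

/-- The two-exponential curve in the group. With `N = Xb + (k / c) W` its factors have the
generators `Xa + c N` and `(1 - c) N`. -/
def motionLift (G : Type*) [TopologicalSpace G] [ChartedSpace E G] [Group G] [T2Space G]
    [LieGroup 𝓘(ℝ, E) ∞ G] (c : ℝ) (Xa N : E) (t : ℝ) : G :=
  gexp G (t • (Xa + c • N)) * gexp G ((t * (1 - c)) • N)

theorem contMDiff_motionLift (c : ℝ) (Xa N : E) :
    ContMDiff 𝓘(ℝ, ℝ) 𝓘(ℝ, E) 2 (motionLift G c Xa N) := by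
  have h1 : ContMDiff 𝓘(ℝ, ℝ) 𝓘(ℝ, ℝ) 2 (fun t : ℝ => t * (1 - c)) :=
    (contDiff_id.mul contDiff_const).contMDiff
  have h2 : ContMDiff (𝓘(ℝ, E).prod 𝓘(ℝ, E)) 𝓘(ℝ, E) 2 (fun q : G × G => q.1 * q.2) :=
    (contMDiff_mul 𝓘(ℝ, E) ∞).of_le ENat.LEInfty.out
  exact h2.comp ((contMDiff_gexp_smul (Xa + c • N)).prodMk ((contMDiff_gexp_smul N).comp h1))

/-- The part `Ad(exp(t (1 - c) N)⁻¹) Xa` of the logarithmic derivative of `motionLift`, whose other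
part is the constant `N`. -/
def movingPart (G : Type*) [TopologicalSpace G] [ChartedSpace E G] [Group G] [T2Space G]
    [LieGroup 𝓘(ℝ, E) ∞ G] (c : ℝ) (Xa N : E) (t : ℝ) : E :=
  Adj E (gexp G ((t * (1 - c)) • N))⁻¹ Xa

variable [CompleteSpace E]

theorem Adj_gexp_smul_self (N : E) (t : ℝ) : Adj E (gexp G (t • N)) N = N :=
  Adj_gexp_eq_self (adj_self (G := G) N) t

theorem Adj_gexp_smul_inv_self (N : E) (t : ℝ) : Adj E (gexp G (t • N))⁻¹ N = N := by
  have h := congrArg (Adj E (gexp G (t • N))⁻¹) (Adj_gexp_smul_self (G := G) N t)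
  rw [Adj_inv_apply] at h
  exact h.symm

theorem hasLogDerivAt_motionLift (c : ℝ) (Xa N : E) (t : ℝ) :
    HasLogDerivAt (motionLift G c Xa N) (movingPart G c Xa N t + N) t := by
  have h := (hasLogDerivAt_gexp (G := G) (Xa + c • N) t).mul (hasLogDerivAt_gexp_mul N (1 - c) t)
  have h1 : Adj E (gexp G ((t * (1 - c)) • N))⁻¹ (Xa + c • N) + (1 - c) • N =
      movingPart G c Xa N t + N := by
    rw [map_add, map_smul, Adj_gexp_smul_inv_self, movingPart, add_assoc, ← add_smul]
    simp
  rwa [h1] at h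

/-- The invariant behind the conservation of momentum: translated back to the identity, the moving
part plus `c N` is the constant generator `Xa + c N` of the first factor. -/
theorem Adj_motionLift (c : ℝ) (Xa N : E) (t : ℝ) :
    Adj E (motionLift G c Xa N t) (movingPart G c Xa N t + c • N) = Xa + c • N := by
  rw [motionLift, Adj_mul]
  change Adj E _ (Adj E _ _) = _
  rw [map_add, map_smul, Adj_gexp_smul_self, movingPart, Adj_apply_inv, Adj_gexp_smul_self]

/-- The curve generated by the two exponentials is the motion of a charged particle. The metric
satisfies `g(dπ X, dπ Z) = lam B(X, Z)` for `X` in `ma` and `lam c B(X, Z)` for `X` in `mb`. -/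
theorem isChargedMotionOn_motionLift {g : SmoothMetric F M} {nabla : Connection F M}
    (hnabla : IsLeviCivita g nabla) (hg : IsInvariantMetric G g)
    {A : ∀ y : M, TangentSpace 𝓘(ℝ, F) y →L[ℝ] TangentSpace 𝓘(ℝ, F) y}
    (hA : IsInvariantTensor G A) {k : ℝ} {o : M} (ho : HasLocalSections E F G o)
    (B : E →ₗ[ℝ] E →ₗ[ℝ] ℝ) (hB_Ad : ∀ (p : G) X Y, B (Adj E p X) (Adj E p Y) = B X Y)
    {ma mb : Submodule ℝ E} {lam c : ℝ} (hc : c ≠ 0)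
    (hga : ∀ X ∈ ma, ∀ Z, metricForm g o (orbitDeriv E F G o X) (orbitDeriv E F G o Z) =
      lam * B X Z)
    (hgb : ∀ X ∈ mb, ∀ Z, metricForm g o (orbitDeriv E F G o X) (orbitDeriv E F G o Z) =
      lam * c * B X Z)
    (hab : ∀ X ∈ ma, ∀ Y ∈ mb, adj G X Y ∈ ma)
    {W : E} (hW : orbitDeriv E F G o W = 0)
    (hWa : ∀ X ∈ ma, adj G W X ∈ ma) (hWb : ∀ X ∈ mb, adj G W X ∈ mb)
    (hAa : ∀ X ∈ ma, tensorForm A o (orbitDeriv E F G o X) = orbitDeriv E F G o (adj G W X))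
    (hAb : ∀ X ∈ mb, tensorForm A o (orbitDeriv E F G o X) =
      orbitDeriv E F G o ((1 / c) • adj G W X))
    {Xa Xb : E} (hXa : Xa ∈ ma) (hXb : Xb ∈ mb) :
    IsChargedMotionOn nabla A k univ
      (fun t => motionLift G c Xa (Xb + (k / c) • W) t • o) := by
  set N := Xb + (k / c) • W with hN
  -- `ad N` maps `ma` to itself, hence so does `Ad(exp(r N))`
  have hma : ∀ t, movingPart G c Xa N t ∈ ma := by
    intro t
    refine Adj_gexp_inv_mem (fun X hX => ?_) _ hXa
    have h1 : adj G N X = -adj G X Xb + (k / c) • adj G W X := by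
      rw [hN, map_add, map_smul, adj_antisymm X Xb]
      simp
    rw [h1]
    exact ma.add_mem (ma.neg_mem (hab X hX Xb hXb)) (ma.smul_mem _ (hWa X hX))
  have hP : ∀ t, orbitDeriv E F G o (movingPart G c Xa N t + N) =
      orbitDeriv E F G o (movingPart G c Xa N t) + orbitDeriv E F G o Xb := by
    intro t
    rw [hN]
    simp only [map_add, map_smul, hW, smul_zero, add_zero]
  have hB' : ∀ (p : G) X Z, B X (Adj E p⁻¹ Z) = B (Adj E p X) Z := by
    intro p X Z
    rw [← hB_Ad p X, Adj_apply_inv]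
  refine isChargedMotionOn_smul hnabla hg hA ho (contMDiff_motionLift c Xa N)
    (hasLogDerivAt_motionLift c Xa N) fun t Z => ?_
  -- the momentum is `lam B(U - k Ad(p) W, Z)`, where `U` is the generator of the first factor
  have hmom : (fun s => metricForm g o (orbitDeriv E F G o (movingPart G c Xa N s + N))
      (orbitDeriv E F G o (Adj E (motionLift G c Xa N s)⁻¹ Z))) = fun s =>
      lam * (B.flip Z) ((Xa + c • N) - k • Adj E (motionLift G c Xa N s) W) := by
    ext s
    rw [hP, map_add, _root_.add_apply, hga _ (hma s), hgb _ hXb, hB', hB',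
      ← Adj_motionLift (G := G) c Xa N s, hN]
    simp only [map_add, map_sub, map_smul, LinearMap.flip_apply, smul_eq_mul]
    field_simp
    ring
  rw [hmom]
  have hd := (hasLogDerivAt_motionLift (G := G) c Xa N t).hasDerivAt_Adj_apply W
  have hd2 := ((LinearMap.toContinuousLinearMap (B.flip Z)).hasFDerivAt.comp_hasDerivAt t
    ((hd.const_smul k).const_sub (Xa + c • N))).const_mul lam
  refine hd2.congr_deriv ?_
  have h1 : adj G (movingPart G c Xa N t + N) W =
      -(adj G W (movingPart G c Xa N t) + adj G W Xb) := by
    rw [adj_antisymm, hN]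
    simp only [map_add, map_smul, adj_self, smul_zero, add_zero]
  rw [h1, hP, map_add (tensorForm A o), hAa _ (hma t), hAb _ hXb, map_add, _root_.add_apply,
    hga _ (hWa _ (hma t)), hgb _ (mb.smul_mem _ (hWb _ hXb)), hB', hB']
  simp only [LinearMap.coe_toContinuousLinearMap', map_neg, map_add, map_smul, smul_eq_mul,
    LinearMap.flip_apply, LinearMap.smul_apply]
  field_simp

omit [FiniteDimensional ℝ F] in
omit [IsManifold 𝓘(ℝ, F) ∞ M] in
theorem vel_motionLift_zero (o : M) (c : ℝ) (Xa N : E) :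
    vel F (fun t => motionLift G c Xa N t • o) 0 = orbitDeriv E F G o (Xa + N) := by
  have h := ((hasLogDerivAt_motionLift (G := G) c Xa N 0).hasVelocityAt_smul (F := F) o).vel_eq
  have h0 : motionLift G c Xa N 0 = 1 := by simp [motionLift, gexp_zero]
  have h1 : movingPart G c Xa N 0 = Xa := by simp [movingPart, gexp_zero, Adj_one]
  have h2 : transDeriv F (1 : G) o = ContinuousLinearMap.id ℝ F := by
    have := mderiv_id (E₁ := F) o
    simpa [transDeriv] using this
  rw [h, h0, h1, h2]
  rfl

end Existence

/-! ### Homogeneous spaces -/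

/-- A submersion has a smooth local section through every point of its domain. -/
theorem Manifold.IsSubmersion.exists_local_section {E F : Type*} [NormedAddCommGroup E]
    [NormedSpace ℝ E] [NormedAddCommGroup F] [NormedSpace ℝ F]
    {N M : Type*} [TopologicalSpace N] [ChartedSpace E N] [IsManifold 𝓘(ℝ, E) ∞ N]
    [TopologicalSpace M] [ChartedSpace F M] [IsManifold 𝓘(ℝ, F) ∞ M] {f : N → M}
    (hf : Manifold.IsSubmersion 𝓘(ℝ, E) 𝓘(ℝ, F) ∞ f) (x : N) :
    ∃ σ : M → N, ContMDiffAt 𝓘(ℝ, F) 𝓘(ℝ, E) ∞ σ (f x) ∧ σ (f x) = x ∧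
      ∀ᶠ y in 𝓝 (f x), f (σ y) = y := by
  have h := hf.isSubmersionAt x
  set d := h.domChart with hd
  set c := h.codChart with hc
  set L := h.equiv with hL
  have hxd : x ∈ d.source := h.mem_domChart_source
  have hxc : f x ∈ c.source := h.mem_codChart_source
  have hdt : d x ∈ d.target := d.map_source hxd
  -- in the charts `f` is the first projection, and the second coordinate stays as at `x`
  have hw : ∀ z ∈ d.target, c (f (d.symm z)) = (L z).1 := by
    intro z hz
    have hz' : z ∈ (h.domChart.extend 𝓘(ℝ, E)).target := by simpa using hz
    have h1 := h.writtenInCharts hz'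
    simpa using h1
  have hsrc : ∀ z ∈ d.target, f (d.symm z) ∈ c.source := fun z hz =>
    h.source_subset_preimage_source (d.map_target hz)
  have hx1 : L.symm (c (f x), (L (d x)).2) = d x := by
    have h1 : c (f x) = (L (d x)).1 := by
      rw [← hw _ hdt, d.left_inv hxd]
    rw [h1, Prod.mk.eta, ContinuousLinearEquiv.symm_apply_apply]
  have hcs : ContMDiffAt 𝓘(ℝ, F) 𝓘(ℝ, F) ∞ c (f x) :=
    contMDiffAt_of_mem_maximalAtlas h.codChart_mem_maximalAtlas hxc
  have hds : ContMDiffAt 𝓘(ℝ, E) 𝓘(ℝ, E) ∞ d.symm (d x) :=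
    contMDiffAt_symm_of_mem_maximalAtlas h.domChart_mem_maximalAtlas hdt
  have hLs : ContMDiffAt 𝓘(ℝ, F) 𝓘(ℝ, E) ∞ (fun y => L.symm (c y, (L (d x)).2)) (f x) := by
    have h1 : ContDiff ℝ ∞ (fun a : F => L.symm (a, (L (d x)).2)) :=
      L.symm.contDiff.comp (contDiff_id.prodMk contDiff_const)
    exact h1.contMDiff.contMDiffAt.comp (f x) hcs
  refine ⟨fun y => d.symm (L.symm (c y, (L (d x)).2)), ?_, ?_, ?_⟩
  · exact ContMDiffAt.comp_of_eq (y := d x) hds hLs hx1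
  · change d.symm (L.symm (c (f x), (L (d x)).2)) = x
    rw [hx1, d.left_inv hxd]
  · have h2 : ∀ᶠ y in 𝓝 (f x), L.symm (c y, (L (d x)).2) ∈ d.target :=
      hLs.continuousAt.eventually_mem (d.open_target.mem_nhds (hx1.symm ▸ hdt))
    filter_upwards [h2, c.open_source.mem_nhds hxc] with y hy hyc
    refine c.injOn (hsrc _ hy) hyc ?_
    rw [hw _ hy, ContinuousLinearEquiv.apply_symm_apply]

/-- A curve with vanishing velocity is constant. -/
theorem eq_of_hasVelocityAt_zero {F : Type*} [NormedAddCommGroup F] [NormedSpace ℝ F]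
    {M : Type*} [TopologicalSpace M] [ChartedSpace F M] [IsManifold 𝓘(ℝ, F) ∞ M] {x : ℝ → M}
    (hx : ∀ t, HasVelocityAt F x 0 t) (t t' : ℝ) : x t = x t' := by
  refine IsLocallyConstant.apply_eq_of_preconnectedSpace ?_ t t'
  rw [IsLocallyConstant.iff_eventually_eq]
  intro t
  have h1 := (hx t).continuousAt.eventually (eventually_mem_source (E := F) (x t))
  obtain ⟨ε, hε, h2⟩ := Metric.eventually_nhds_iff_ball.1 h1
  filter_upwards [Metric.ball_mem_nhds t hε] with s hs
  have h3 : ∀ r ∈ Metric.ball t ε, HasDerivAt (fun s => extChartAt 𝓘(ℝ, F) (x t) (x s)) 0 r := by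
    intro r hr
    rw [← hasVelocityAt_iff_hasDerivAt]
    have h4 := (hx r).comp
      ((contMDiffAt_extChartAt_of_mem (h2 r hr)).mdifferentiableAt (by simp)) rfl
    rwa [map_zero] at h4
  have h5 := Metric.isOpen_ball.is_const_of_deriv_eq_zero
    (convex_ball t ε).isPreconnected
    (fun r hr => (h3 r hr).differentiableAt.differentiableWithinAt)
    (fun r hr => (h3 r hr).deriv) hs (Metric.mem_ball_self hε)
  exact (extChartAt 𝓘(ℝ, F) (x t)).injOn (h2 s hs) (mem_extChartAt_source (x t)) h5

section Quotient

/-- The quotient of a topological group by a closed subgroup is Hausdorff. -/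
theorem t2Space_quotient {G : Type*} [TopologicalSpace G] [Group G] [IsTopologicalGroup G]
    {H : Subgroup G} (hH : IsClosed (H : Set G)) : T2Space (G ⧸ H) := by
  rw [t2Space_iff_of_isOpenQuotientMap (QuotientGroup.isOpenQuotientMap_mk (N := H))]
  have h1 : {q : G × G | (QuotientGroup.mk q.1 : G ⧸ H) = QuotientGroup.mk q.2} =
      (fun q : G × G => q.1⁻¹ * q.2) ⁻¹' (H : Set G) := by
    ext q
    simp [QuotientGroup.eq]
  rw [h1]
  exact hH.preimage (by fun_prop)

theorem smul_one_coset {G : Type*} [Group G] {H : Subgroup G} (p : G) :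
    p • ((1 : G) : G ⧸ H) = (p : G ⧸ H) := by
  rw [MulAction.Quotient.smul_coe, smul_eq_mul, mul_one]

variable {E F : Type*} [NormedAddCommGroup E] [NormedSpace ℝ E]
  [NormedAddCommGroup F] [NormedSpace ℝ F]
  {G : Type*} [TopologicalSpace G] [ChartedSpace E G] [Group G] [LieGroup 𝓘(ℝ, E) ∞ G]
  {H : Subgroup G} [ChartedSpace F (G ⧸ H)] [IsManifold 𝓘(ℝ, F) ∞ (G ⧸ H)]

theorem hasLocalSections_of_isSubmersion
    (hsub : Manifold.IsSubmersion 𝓘(ℝ, E) 𝓘(ℝ, F) ∞ (fun p : G => (p : G ⧸ H))) :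
    HasLocalSections E F G ((1 : G) : G ⧸ H) := by
  intro p
  obtain ⟨σ, h1, h2, h3⟩ := hsub.exists_local_section p
  refine ⟨σ, ?_, ?_, ?_⟩ <;> rw [smul_one_coset]
  · exact h1
  · exact h2
  · exact h3.mono fun y hy => (smul_one_coset _).trans hy

/-- The action of a Lie group on its quotient manifold is smooth. -/
theorem contMDiffSMul_of_isSubmersion
    (hsub : Manifold.IsSubmersion 𝓘(ℝ, E) 𝓘(ℝ, F) ∞ (fun p : G => (p : G ⧸ H))) :
    ContMDiffSMul 𝓘(ℝ, E) 𝓘(ℝ, F) ∞ G (G ⧸ H) := by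
  refine ⟨fun ⟨p, y⟩ => ?_⟩
  obtain ⟨q, rfl⟩ := QuotientGroup.mk_surjective y
  obtain ⟨σ, h1, h2, h3⟩ := hsub.exists_local_section q
  have hσ : ContMDiffAt (𝓘(ℝ, E).prod 𝓘(ℝ, F)) 𝓘(ℝ, E) ∞ (fun z : G × (G ⧸ H) => σ z.2)
      (p, (q : G ⧸ H)) := ContMDiffAt.comp (p, (q : G ⧸ H)) h1 contMDiffAt_snd
  have h4 : ContMDiffAt (𝓘(ℝ, E).prod 𝓘(ℝ, F)) 𝓘(ℝ, F) ∞
      (fun z : G × (G ⧸ H) => ((z.1 * σ z.2 : G) : G ⧸ H)) (p, (q : G ⧸ H)) :=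
    ContMDiffAt.comp (p, (q : G ⧸ H)) hsub.contMDiff.contMDiffAt (contMDiffAt_fst.mul hσ)
  refine h4.congr_of_eventuallyEq ?_
  have h5 : ∀ᶠ z : G × (G ⧸ H) in 𝓝 (p, (q : G ⧸ H)), ((σ z.2 : G) : G ⧸ H) = z.2 :=
    (continuousAt_snd (p := (p, (q : G ⧸ H)))).eventually h3
  filter_upwards [h5] with z hz
  conv_lhs => rw [← hz]
  rw [MulAction.Quotient.smul_coe, smul_eq_mul]

/-- The kernel of `dπ` is the Lie algebra of `H`. -/
theorem mem_subgroupLieAlgebra_iff [FiniteDimensional ℝ E] [T2Space G]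
    [ContMDiffSMul 𝓘(ℝ, E) 𝓘(ℝ, F) ∞ G (G ⧸ H)] (V : E) :
    (∀ t : ℝ, gexp G (t • V) ∈ H) ↔ orbitDeriv E F G ((1 : G) : G ⧸ H) V = 0 := by
  have hv := fun t => (hasLogDerivAt_gexp (G := G) V t).hasVelocityAt_smul (F := F)
    ((1 : G) : G ⧸ H)
  have hmem : ∀ p : G, p ∈ H ↔ p • ((1 : G) : G ⧸ H) = ((1 : G) : G ⧸ H) := by
    intro p
    rw [smul_one_coset, eq_comm, QuotientGroup.eq]
    simp
  constructor
  · intro h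
    have h1 : (fun t : ℝ => gexp G (t • V) • ((1 : G) : G ⧸ H)) = fun _ => ((1 : G) : G ⧸ H) :=
      funext fun t => (hmem _).1 (h t)
    have h2 := (hv 0).vel_eq
    rw [h1, zero_smul, gexp_zero] at h2
    have h3 : transDeriv F (1 : G) ((1 : G) : G ⧸ H) = ContinuousLinearMap.id ℝ F := by
      have := mderiv_id (E₁ := F) ((1 : G) : G ⧸ H)
      simpa [transDeriv] using this
    rw [h3] at h2
    have h4 : vel F (fun _ : ℝ => ((1 : G) : G ⧸ H)) 0 = 0 := by
      have := mderiv_const (E₁ := ℝ) (E₂ := F) ((1 : G) : G ⧸ H) (0 : ℝ)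
      exact congrArg (fun L : ℝ →L[ℝ] F => L 1) this
    exact h2.symm.trans h4
  · intro h t
    rw [hmem]
    have h1 := eq_of_hasVelocityAt_zero (F := F)
      (x := fun t : ℝ => gexp G (t • V) • ((1 : G) : G ⧸ H))
      (fun t => by simpa [h] using hv t) t 0
    simpa [gexp_zero] using h1

end Quotient

/-- If `B` is positive definite, the kernel of `P` and its `B`-orthogonal complement `⨆ m i` span.
Hence the form `∑ lam i B` on the complement determines `b(P X, P Z)` for every `Z`. -/
theorem form_apply_of_mem {E F : Type*} [NormedAddCommGroup E] [NormedSpace ℝ E]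
    [FiniteDimensional ℝ E] [NormedAddCommGroup F] [NormedSpace ℝ F] (P : E →L[ℝ] F)
    (b : F →L[ℝ] F →L[ℝ] ℝ) (B : LinearMap.BilinForm ℝ E) (hB_symm : ∀ X Y, B X Y = B Y X)
    (hB_pos : ∀ X, X ≠ 0 → 0 < B X X) {s : ℕ} (m : Fin s → Submodule ℝ E)
    (hm_sum : ∀ X, X ∈ (⨆ i, m i) ↔ ∀ V, P V = 0 → B V X = 0)
    (hm_orth : ∀ i j, i ≠ j → ∀ X ∈ m i, ∀ Y ∈ m j, B X Y = 0) (lam : Fin s → ℝ)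
    (hb : ∀ X Y : Fin s → E, (∀ i, X i ∈ m i) → (∀ i, Y i ∈ m i) →
      b (P (∑ i, X i)) (P (∑ i, Y i)) = ∑ i, lam i * B (X i) (Y i))
    (i : Fin s) {X : E} (hX : X ∈ m i) (Z : E) : b (P X) (P Z) = lam i * B X Z := by
  have hrefl : B.IsRefl := fun X Y h => by rw [hB_symm, h]
  set K : Submodule ℝ E := LinearMap.ker (P : E →ₗ[ℝ] F) with hK
  have hKP : ∀ V, V ∈ K ↔ P V = 0 := fun V => LinearMap.mem_ker
  have hcompl : IsCompl K (B.orthogonal K) := by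
    refine B.isCompl_orthogonal_of_restrict_nondegenerate hrefl ?_
    have h1 : ∀ V : K, (∀ V' : K, B.restrict K V V' = 0) → V = 0 := by
      intro V hV
      by_contra hne
      exact (hB_pos V (by simpa using hne)).ne' (hV V)
    exact ⟨h1, fun V hV => h1 V fun V' => by
      have := hV V'
      rw [LinearMap.BilinForm.restrict_apply, LinearMap.domRestrict_apply] at this ⊢
      rw [hB_symm]; exact this⟩
  obtain ⟨V, hV, Y, hY, rfl⟩ : ∃ V ∈ K, ∃ Y ∈ B.orthogonal K, V + Y = Z := by
    have : Z ∈ K ⊔ B.orthogonal K := by rw [hcompl.sup_eq_top]; trivial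
    exact Submodule.mem_sup.1 this
  have hYm : Y ∈ ⨆ i, m i := (hm_sum Y).2 fun V hV => hY V ((hKP V).2 hV)
  obtain ⟨f, hf, rfl⟩ := (Submodule.mem_iSup_iff_exists_finsupp m Y).1 hYm
  rw [Finsupp.sum_fintype _ _ (fun _ => rfl)]
  have hXV : B X V = 0 := by
    rw [hB_symm]
    exact (hm_sum X).1 (Submodule.mem_iSup_of_mem i hX) V ((hKP V).1 hV)
  have hXf : B X (∑ j, f j) = B X (f i) := by
    rw [map_sum]
    exact Finset.sum_eq_single i (fun j _ hj => hm_orth i j hj.symm X hX _ (hf j)) (by simp)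
  have h1 := hb (Pi.single i X) f (fun j => by
    rcases eq_or_ne j i with rfl | hj
    · simpa using hX
    · simp [hj]) hf
  rw [Finset.sum_pi_single' i X Finset.univ] at h1
  rw [map_add, (hKP V).1 hV, zero_add, map_add (B X), hXV, zero_add, hXf]
  rw [if_pos (Finset.mem_univ i)] at h1
  rw [h1]
  refine (Finset.sum_eq_single i (fun j _ hj => ?_) (by simp)).trans (by simp)
  simp [hj]

end

theorem theorem1
    {E F : Type*} [NormedAddCommGroup E] [NormedSpace ℝ E] [FiniteDimensional ℝ E]
    [NormedAddCommGroup F] [NormedSpace ℝ F] [FiniteDimensional ℝ F]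
    -- a Lie group `G` and a closed subgroup `H`
    {G : Type*} [TopologicalSpace G] [ChartedSpace E G] [Group G] [T2Space G]
    [LieGroup 𝓘(ℝ, E) ∞ G]
    (H : Subgroup G) (hH : IsClosed (H : Set G))
    -- the quotient manifold `G/H`: the smooth structure for which `π : G → G/H` is a submersion
    [ChartedSpace F (G ⧸ H)] [IsManifold 𝓘(ℝ, F) ∞ (G ⧸ H)]
    (hsub : Manifold.IsSubmersion 𝓘(ℝ, E) 𝓘(ℝ, F) ∞ (fun p : G => (p : G ⧸ H)))
    -- an `Ad(G)`-invariant inner product `B` on the Lie algebra `𝔤`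
    (B : LinearMap.BilinForm ℝ (GroupLieAlgebra 𝓘(ℝ, E) G))
    (hB_symm : ∀ X Y, B X Y = B Y X)
    (hB_pos : ∀ X, X ≠ 0 → 0 < B X X)
    (hB_Ad : ∀ (p : G) X Y, B (lieAd p X) (lieAd p Y) = B X Y)
    -- the `B`-orthogonal complement `𝔪` of `𝔥` is the sum of the pairwise `B`-orthogonal,
    -- `Ad(H)`-invariant subspaces `m i`
    {s : ℕ} (m : Fin s → Submodule ℝ (GroupLieAlgebra 𝓘(ℝ, E) G))
    (hm_sum : ∀ X, X ∈ (⨆ i, m i) ↔ ∀ V ∈ subgroupLieAlgebra H, B V X = 0)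
    (hm_orth : ∀ i j, i ≠ j → ∀ X ∈ m i, ∀ Y ∈ m j, B X Y = 0)
    (hm_Ad : ∀ i, ∀ h ∈ H, ∀ X ∈ m i, lieAd h X ∈ m i)
    -- the `G`-invariant metric `g` that is `∑ i, lam i * B` on `𝔪 = ⊕ m i`
    (lam : Fin s → ℝ) (hlam : ∀ i, 0 < lam i)
    (g : SmoothMetric F (G ⧸ H)) (hg : IsInvariantMetric G g)
    (hg_o : ∀ X Y : Fin s → GroupLieAlgebra 𝓘(ℝ, E) G, (∀ i, X i ∈ m i) → (∀ i, Y i ∈ m i) →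
      g.inner ((1 : G) : G ⧸ H) (projDeriv E F H (∑ i, X i)) (projDeriv E F H (∑ i, Y i)) =
        ∑ i, lam i * B (X i) (Y i))
    (nabla : Connection F (G ⧸ H)) (hnabla : IsLeviCivita g nabla)
    -- `[m a, m b] ⊆ m a`
    (a b : Fin s) (hab : ∀ X ∈ m a, ∀ Y ∈ m b, ⁅X, Y⁆ ∈ m a)
    (c : ℝ) (hc : c = lam b / lam a)
    -- the `G`-invariant tensor that is `ad W` on `m a` and `(1/c) ad W` on `m b` at the origin
    (W : GroupLieAlgebra 𝓘(ℝ, E) G) (hW : W ∈ subgroupLieAlgebraCenter H)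
    (A : ∀ y : G ⧸ H, TangentSpace 𝓘(ℝ, F) y →L[ℝ] TangentSpace 𝓘(ℝ, F) y)
    (hA : IsInvariantTensor G A)
    (hA_a : ∀ X ∈ m a, A ((1 : G) : G ⧸ H) (projDeriv E F H X) = projDeriv E F H ⁅W, X⁆)
    (hA_b : ∀ X ∈ m b,
      A ((1 : G) : G ⧸ H) (projDeriv E F H X) = projDeriv E F H ((1 / c) • ⁅W, X⁆))
    (k : ℝ) (Xa Xb : GroupLieAlgebra 𝓘(ℝ, E) G) (hXa : Xa ∈ m a) (hXb : Xb ∈ m b)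
    (γ : ℝ → G ⧸ H)
    (hγ : ∀ t, γ t = (lieExp (t • (Xa + c • Xb + k • W)) *
      lieExp ((t * (1 - c)) • (Xb + (k / c) • W))) • ((1 : G) : G ⧸ H)) :
    -- `γ` is a motion of a charged particle on `ℝ` with the prescribed initial conditions, ...
    (IsChargedMotionOn nabla A k univ γ ∧
      (⟨γ 0, velocity γ 0⟩ : TangentBundle 𝓘(ℝ, F) (G ⧸ H)) =
        ⟨((1 : G) : G ⧸ H), projDeriv E F H (Xa + Xb)⟩) ∧
    -- ... and every motion with these initial conditions on an open interval coincides with `γ`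
    (∀ (J : Set ℝ) (x : ℝ → G ⧸ H), IsOpen J → J.OrdConnected → (0 : ℝ) ∈ J →
      IsChargedMotionOn nabla A k J x →
      (⟨x 0, velocity x 0⟩ : TangentBundle 𝓘(ℝ, F) (G ⧸ H)) =
        ⟨((1 : G) : G ⧸ H), projDeriv E F H (Xa + Xb)⟩ →
      ∀ t ∈ J, x t = γ t) := by
  have : CompleteSpace E := FiniteDimensional.complete ℝ E
  have : IsTopologicalGroup G := topologicalGroup_of_lieGroup 𝓘(ℝ, E) ∞
  have : T2Space (G ⧸ H) := t2Space_quotient hH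
  have : ContMDiffSMul 𝓘(ℝ, E) 𝓘(ℝ, F) ∞ G (G ⧸ H) := contMDiffSMul_of_isSubmersion hsub
  have ho : HasLocalSections E F G ((1 : G) : G ⧸ H) := hasLocalSections_of_isSubmersion hsub
  have htrans : ∀ y : G ⧸ H, ∃ p : G, p • ((1 : G) : G ⧸ H) = y := fun y => by
    obtain ⟨q, rfl⟩ := QuotientGroup.mk_surjective y
    exact ⟨q, smul_one_coset q⟩
  -- all data, with the Lie algebra and the tangent spaces written as the model spaces
  let P : E →L[ℝ] F := projDeriv E F H
  have hP : P = orbitDeriv E F G ((1 : G) : G ⧸ H) := by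
    change mderiv E F (fun p : G => (p : G ⧸ H)) 1 = mderiv E F _ 1
    simp only [smul_one_coset]
  let B' : LinearMap.BilinForm ℝ E := B
  let W' : E := W
  let Xa' : E := Xa
  let Xb' : E := Xb
  let m' : Fin s → Submodule ℝ E := m
  have hker : ∀ V : E, V ∈ (subgroupLieAlgebra H : Set (GroupLieAlgebra 𝓘(ℝ, E) G)) ↔
      P V = 0 := fun V => by rw [hP]; exact mem_subgroupLieAlgebra_iff V
  have hsum : ∀ X : E, X ∈ (⨆ i, m' i) ↔ ∀ V, P V = 0 → B' V X = 0 := fun X =>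
    (hm_sum X).trans (forall_congr' fun V => imp_congr (hker V) Iff.rfl)
  have hform : ∀ i, ∀ X ∈ m' i, ∀ Z, metricForm g ((1 : G) : G ⧸ H) (P X) (P Z) =
      lam i * B' X Z := fun i X hX Z =>
    form_apply_of_mem P (metricForm g ((1 : G) : G ⧸ H)) B' hB_symm hB_pos m' hsum hm_orth lam
      hg_o i hX Z
  have hWm : ∀ i, ∀ X ∈ m' i, adj G W' X ∈ m' i := fun i X hX =>
    adj_mem_of_Adj_gexp_mem (E := E) (V := W') (S := m' i)
      (fun t v hv => hm_Ad i _ (hW.1 t) v hv) hX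
  have hc0 : c ≠ 0 := hc ▸ (div_pos (hlam b) (hlam a)).ne'
  have hbc : lam a * c = lam b := by rw [hc, mul_div_cancel₀ _ (hlam a).ne']
  have hAa : ∀ X ∈ m' a, tensorForm A ((1 : G) : G ⧸ H) (P X) = P (adj G W' X) := by
    intro X hX
    rw [adj_eq_lieBr]
    exact hA_a X hX
  have hAb : ∀ X ∈ m' b, tensorForm A ((1 : G) : G ⧸ H) (P X) =
      P ((1 / c) • adj G W' X) := by
    intro X hX
    rw [adj_eq_lieBr]
    exact hA_b X hX
  have hab' : ∀ X ∈ m' a, ∀ Y ∈ m' b, adj G X Y ∈ m' a := by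
    intro X hX Y hY
    rw [adj_eq_lieBr]
    exact hab X hX Y hY
  have hPW : P W' = 0 := (hker W).1 hW.1
  let N : E := Xb' + (k / c) • W'
  have hγ' : γ = fun t => motionLift G c Xa' N t • ((1 : G) : G ⧸ H) := by
    have hU : Xa' + c • Xb' + k • W' = Xa' + c • N := by
      rw [smul_add, smul_smul, mul_div_cancel₀ _ hc0, add_assoc]
    funext t
    have h1 : γ t = (gexp G (t • (Xa' + c • Xb' + k • W')) *
      gexp G ((t * (1 - c)) • N)) • ((1 : G) : G ⧸ H) := hγ t
    rw [h1, hU]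
    rfl
  have hmotion : IsChargedMotionOn nabla A k univ γ := by
    rw [hγ']
    rw [hP] at hform hAa hAb hPW
    exact isChargedMotionOn_motionLift hnabla hg hA ho B' hB_Ad hc0 (hform a)
      (fun X hX Z => by rw [hbc]; exact hform b X hX Z) hab' hPW (hWm a) (hWm b) hAa hAb hXa hXb
  have hγ0 : γ 0 = ((1 : G) : G ⧸ H) := by
    rw [hγ']
    simp [motionLift, gexp_zero]
  have hvel0 : vel F γ 0 = P (Xa' + Xb') := by
    rw [hγ', vel_motionLift_zero, ← hP, ← add_assoc, map_add P _ ((k / c) • W'), map_smul, hPW,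
      smul_zero, add_zero]
  have hinit : ∀ {x : ℝ → G ⧸ H}, (⟨x 0, velocity x 0⟩ : TangentBundle 𝓘(ℝ, F) (G ⧸ H)) =
      ⟨((1 : G) : G ⧸ H), projDeriv E F H (Xa + Xb)⟩ ↔
      x 0 = ((1 : G) : G ⧸ H) ∧ vel F x 0 = P (Xa' + Xb') := by
    intro x
    constructor
    · intro h
      refine ⟨congrArg TotalSpace.proj h, ?_⟩
      exact congrArg (fun z : TangentBundle 𝓘(ℝ, F) (G ⧸ H) => (z.2 : F)) h
    · rintro ⟨h1, h2⟩
      have h3 : ∀ (y y' : G ⧸ H) (v v' : F), y = y' → v = v' →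
          (⟨y, v⟩ : TangentBundle 𝓘(ℝ, F) (G ⧸ H)) = ⟨y', v'⟩ := by
        rintro y _ v _ rfl rfl
        rfl
      exact h3 _ _ _ _ h1 h2
  refine ⟨⟨hmotion, hinit.2 ⟨hγ0, hvel0⟩⟩, ?_⟩
  intro J x hJ hJc h0 hx hx0
  obtain ⟨h1, h2⟩ := hinit.1 hx0
  exact eqOn_of_charged hnabla hg hA ho htrans hJ hJc hx
    ⟨hmotion.1.mono (subset_univ J), fun t _ => hmotion.2 t trivial⟩ h0 (h1.trans hγ0.symm)
    (h2.trans hvel0.symm)
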